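/- For $n\ge 0$ let $\mathbb H^n$ be the right quaternionic vector space with the quaternionic Hermitian form $K(v,w)=\sum_i \bar v_i w_i$ and Euclidean inner product $\langle v,w\rangle=\operatorname{Re}K(v,w)$, and let $\mathrm{Sp}(n)$ be the group of right $\mathbb H$-linear automorphisms of $\mathbb H^n$ preserving $K$. For a Euclidean space $V$ let $SV=V\times S(V)$ be the unit sphere bundle, with contact form $\alpha|_{(x,v)}(a,b)=\langle v,a\rangle$. Let $\Omega^{k,l}(SV)^{tr}$ be the space of smooth complex-valued translation-invariant differential forms of bidegree $(k,l)$ with respect to the product structure of $SV$, let $\Omega^{k,l}_v(SV)^{tr}=\{\omega\in\Omega^{k,l}(SV)^{tr}:\alpha\wedge\omega=0\}$, and let $\Omega_h^{k,l}(SV)^{tr}=\Omega^{k,l}(SV)^{tr}/\Omega_v^{k,l}(SV)^{tr}$ (horizontal forms); the wedge product makes $\bigoplus_{k,l}\Omega_h^{k,l}(SV)^{tr}$ a bigraded algebra. Denote by $\Omega_h^{k,l}(S\mathbb H^n)^{\mathrm{Sp}(n)}$ the subspace of $\mathrm{Sp}(n)$-invariant elements of $\Omega_h^{k,l}(S\mathbb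 H^n)^{tr}$. Let $\mathbb H^1\hookrightarrow\mathbb H^2\hookrightarrow\mathbb H^3\hookrightarrow\cdots$ be any sequence of quaternionic isometric embeddings (right $\mathbb H$-linear maps preserving $K$). They induce embeddings $S\mathbb H^1\hookrightarrow S\mathbb H^2\hookrightarrow\cdots$ and restriction maps of horizontal forms; set $$\Omega_h^{k,l}(S\mathbb H^\infty)^{\mathrm{Sp}(\infty)}:=\varprojlim_n\,\Omega_h^{k,l}(S\mathbb H^n)^{\mathrm{Sp}(n)},\qquad \Omega_h^{*,*}(S\mathbb H^\infty)^{\mathrm{Sp}(\infty)}:=\bigoplus_{k,l}\Omega_h^{k,l}(S\mathbb H^\infty)^{\mathrm{Sp}(\infty)}.$$ The latter is a bigraded $\mathrm{SU}(2)$-algebra, where $q\in\mathrm{Sp}(1)\cong\mathrm{SU}(2)$ (via $z_1+jz_2\mapsto\begin{pmatrix}z_1&-\bar z_2\\ z_2&\bar z_1\end{pmatrix}$) acts by pull-back along the right multiplication $v\mapsto vq$. Let $V_s=\mathrm{Sym}^s\mathbb C^2$ be the irreducible $\mathrm{SU}(2)$-representation of dimension $s+1$. Then: 1. The algebra $\Omega_h^{*,*}(S\mathbb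 H^\infty)^{\mathrm{Sp}(\infty)}$ is generated by five subspaces, each isomorphic to $V_2$ as $\mathrm{SU}(2)$-representation, contained in the bidegrees $(1,0),(0,1),(2,0),(1,1),(0,2)$ respectively, together with one subspace isomorphic to $V_0$ contained in bidegree $(1,1)$. 2. The restriction maps $$\tilde u_n:\Omega_h^{k,l}(S\mathbb H^\infty)^{\mathrm{Sp}(\infty)}\to\Omega_h^{k,l}(S\mathbb H^n)^{\mathrm{Sp}(n)}$$ are surjective for all $k,l\ge 0$ and $n\ge 1$, and injective whenever $n\ge1$ and $k+l\le n-1$. -/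

import Mathlib

open scoped ContDiff Quaternion

noncomputable section

namespace SphereForms

/-! ### Complex-valued alternating forms on a real vector space -/

/-- `Λ^*(T^*) ⊗ ℂ`, the algebra of complex-valued alternating forms on a (finite-dimensional) real
vector space `T`: the exterior algebra over `ℂ` of the complex-valued real-linear functionals on
`T`. The product is the wedge product. -/
abbrev Ext (T : Type*) [AddCommGroup T] [Module ℝ T] : Type _ :=
  ExteriorAlgebra ℂ (T →ₗ[ℝ] ℂ)

section Fibre

variable {S T U : Type*} [AddCommGroup S] [Module ℝ S] [AddCommGroup T] [Module ℝ T]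
  [AddCommGroup U] [Module ℝ U]

/-- Precomposition of functionals with a linear map. -/
def dualComap (f : S →ₗ[ℝ] T) : (T →ₗ[ℝ] ℂ) →ₗ[ℂ] (S →ₗ[ℝ] ℂ) where
  toFun φ := φ ∘ₗ f
  map_add' _ _ := rfl
  map_smul' _ _ := rfl

/-- Pull-back of alternating forms along a linear map. -/
def extComap (f : S →ₗ[ℝ] T) : Ext T →ₐ[ℂ] Ext S :=
  ExteriorAlgebra.map (dualComap f)

theorem extComap_comp (f : S →ₗ[ℝ] T) (g : T →ₗ[ℝ] U) (τ : Ext U) :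
    extComap f (extComap g τ) = extComap (g ∘ₗ f) τ := by
  have h := ExteriorAlgebra.map_comp_map (R := ℂ) (dualComap g) (dualComap f)
  exact DFunLike.congr_fun h τ

theorem extComap_id (τ : Ext T) : extComap (LinearMap.id : T →ₗ[ℝ] T) τ = τ := by
  have h := ExteriorAlgebra.map_id (R := ℂ) (M := T →ₗ[ℝ] ℂ)
  exact DFunLike.congr_fun h τ

/-- The constant `1`-forms on `S × T` coming from the first factor. -/
def oneFst (S T : Type*) [AddCommGroup S] [Module ℝ S] [AddCommGroup T] [Module ℝ T] :
    Submodule ℂ (Ext (S × T)) :=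
  LinearMap.range (ExteriorAlgebra.ι ℂ ∘ₗ dualComap (LinearMap.fst ℝ S T))

/-- The constant `1`-forms on `S × T` coming from the second factor. -/
def oneSnd (S T : Type*) [AddCommGroup S] [Module ℝ S] [AddCommGroup T] [Module ℝ T] :
    Submodule ℂ (Ext (S × T)) :=
  LinearMap.range (ExteriorAlgebra.ι ℂ ∘ₗ dualComap (LinearMap.snd ℝ S T))

/-- The forms of bidegree `(k, l)` on `S × T`: linear combinations of products of `k` one-forms
from the first factor and `l` one-forms from the second factor. -/
def bideg (S T : Type*) [AddCommGroup S] [Module ℝ S] [AddCommGroup T] [Module ℝ T]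
    (k l : ℕ) : Submodule ℂ (Ext (S × T)) :=
  oneFst S T ^ k * oneSnd S T ^ l

theorem one_mem_bideg : (1 : Ext (S × T)) ∈ bideg S T 0 0 := by
  simp only [bideg, pow_zero, mul_one]
  exact Submodule.one_le.mp le_rfl

theorem oneSnd_mul_oneFst : oneSnd S T * oneFst S T = oneFst S T * oneSnd S T := by
  have key : ∀ a b : (S × T) →ₗ[ℝ] ℂ,
      ExteriorAlgebra.ι ℂ a * ExteriorAlgebra.ι ℂ b
        = - (ExteriorAlgebra.ι ℂ b * ExteriorAlgebra.ι ℂ a) := fun a b =>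
    eq_neg_of_add_eq_zero_left (ExteriorAlgebra.ι_add_mul_swap a b)
  apply le_antisymm
  · rw [Submodule.mul_le]
    rintro _ ⟨a, rfl⟩ _ ⟨b, rfl⟩
    simp only [LinearMap.comp_apply]
    rw [key]
    exact Submodule.neg_mem _ (Submodule.mul_mem_mul ⟨b, rfl⟩ ⟨a, rfl⟩)
  · rw [Submodule.mul_le]
    rintro _ ⟨a, rfl⟩ _ ⟨b, rfl⟩
    simp only [LinearMap.comp_apply]
    rw [key]
    exact Submodule.neg_mem _ (Submodule.mul_mem_mul ⟨b, rfl⟩ ⟨a, rfl⟩)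

theorem mul_mem_bideg {k l k' l' : ℕ} {x y : Ext (S × T)}
    (hx : x ∈ bideg S T k l) (hy : y ∈ bideg S T k' l') :
    x * y ∈ bideg S T (k + k') (l + l') := by
  have hc : Commute (oneSnd S T ^ l) (oneFst S T ^ k') :=
    Commute.pow_pow (show Commute (oneSnd S T) (oneFst S T) from oneSnd_mul_oneFst) _ _
  have h : bideg S T k l * bideg S T k' l' = bideg S T (k + k') (l + l') := by
    simp only [bideg, pow_add]
    calc _ = oneFst S T ^ k * (oneSnd S T ^ l * oneFst S T ^ k') * oneSnd S T ^ l' := by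
          simp only [mul_assoc]
      _ = _ := by rw [hc.eq]; simp only [mul_assoc]
  rw [← h]
  exact Submodule.mul_mem_mul hx hy

theorem extComap_mem_bideg {S' T' : Type*} [AddCommGroup S'] [Module ℝ S'] [AddCommGroup T']
    [Module ℝ T'] (f : S →ₗ[ℝ] S') (g : T →ₗ[ℝ] T') {k l : ℕ} {x : Ext (S' × T')}
    (hx : x ∈ bideg S' T' k l) : extComap (LinearMap.prodMap f g) x ∈ bideg S T k l := by
  have h1 : (oneFst S' T').map (extComap (LinearMap.prodMap f g)).toLinearMap ≤ oneFst S T := by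
    rintro _ ⟨_, ⟨a, rfl⟩, rfl⟩
    exact ⟨a ∘ₗ f, (ExteriorAlgebra.map_apply_ι (dualComap (LinearMap.prodMap f g))
      (dualComap (LinearMap.fst ℝ S' T') a)).symm⟩
  have h2 : (oneSnd S' T').map (extComap (LinearMap.prodMap f g)).toLinearMap ≤ oneSnd S T := by
    rintro _ ⟨_, ⟨a, rfl⟩, rfl⟩
    exact ⟨a ∘ₗ g, (ExteriorAlgebra.map_apply_ι (dualComap (LinearMap.prodMap f g))
      (dualComap (LinearMap.snd ℝ S' T') a)).symm⟩
  have h : (bideg S' T' k l).map (extComap (LinearMap.prodMap f g)).toLinearMap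
      ≤ bideg S T k l := by
    rw [bideg, Submodule.map_mul, Submodule.map_pow, Submodule.map_pow]
    exact mul_le_mul' (pow_le_pow_left' h1 k) (pow_le_pow_left' h2 l)
  exact h ⟨x, hx, rfl⟩

end Fibre

/-! ### Forms on the sphere bundle of a Euclidean space -/

section SphereBundle

variable (V : Type*) [NormedAddCommGroup V] [InnerProductSpace ℝ V]
variable (W : Type*) [NormedAddCommGroup W] [InnerProductSpace ℝ W]
variable (X : Type*) [NormedAddCommGroup X] [InnerProductSpace ℝ X]

/-- The unit sphere bundle `SV = V × S(V)`. -/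
abbrev SphereBundle : Type _ := V × Metric.sphere (0 : V) 1

variable {V} in
/-- The tangent space of `SV` at a point `(x, v)`, namely `V × T_v S(V)` with `T_v S(V) = v^⊥`. -/
abbrev Tan (v : V) : Type _ := V × (ℝ ∙ v)ᗮ

variable {V} in
/-- The inclusion `T_{(x,v)} SV → V × V`. -/
def tanIncl (v : V) : Tan v →ₗ[ℝ] V × V :=
  LinearMap.prodMap LinearMap.id (ℝ ∙ v)ᗮ.subtype

/-- All (not necessarily smooth) complex-valued differential forms on `SV`, with the wedge
product. -/
abbrev RawForms : Type _ := (p : SphereBundle V) → Ext (Tan (p.2 : V))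

/-- The smooth complex-valued forms on a vector space `M`: the algebra generated by the smooth
functions and the constant forms. -/
def ambientForms (M : Type*) [NormedAddCommGroup M] [NormedSpace ℝ M] :
    Subalgebra ℂ (M → Ext M) :=
  Algebra.adjoin ℂ
    ({F | ∃ f : M → ℂ, ContDiff ℝ ∞ f ∧ F = fun p => algebraMap ℂ (Ext M) (f p)} ∪
      {F | ∃ e : Ext M, F = fun _ => e})

/-- Restriction of forms on `V × V` to the submanifold `SV`. -/
def restrictToSphereBundle : (V × V → Ext (V × V)) →ₐ[ℂ] RawForms V :=
  AlgHom.pi fun p => (extComap (tanIncl (p.2 : V))).comp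
    (Pi.evalAlgHom ℂ (fun _ : V × V => Ext (V × V)) (p.1, (p.2 : V)))

/-- The smooth forms `Ω^*(SV)`. Since `SV` is a closed submanifold of `V × V`, these are the
restrictions to `SV` of the smooth forms on `V × V`. -/
def smoothForms : Subalgebra ℂ (RawForms V) :=
  (ambientForms (V × V)).map (restrictToSphereBundle V)

/-- The translation invariant forms on `SV`. The translation `(x, v) ↦ (x + t, v)` has differential
the identity of `V × v^⊥`. -/
def translationInvariantForms : Subalgebra ℂ (RawForms V) where
  carrier := {τ | ∀ (t x : V) (v : Metric.sphere (0 : V) 1), τ (x + t, v) = τ (x, v)}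
  mul_mem' ha hb t x v := by rw [Pi.mul_apply, Pi.mul_apply, ha, hb]
  add_mem' ha hb t x v := by rw [Pi.add_apply, Pi.add_apply, ha, hb]
  algebraMap_mem' _ _ _ _ := rfl

/-- `Ω^{*,*}(SV)^{tr}`, the algebra of smooth translation invariant forms. -/
def trForms : Subalgebra ℂ (RawForms V) := smoothForms V ⊓ translationInvariantForms V

/-- `Ω^{k,l}(SV)^{tr}`. -/
def trFormsBideg (k l : ℕ) : Submodule ℂ (trForms V) where
  carrier := {τ | ∀ p : SphereBundle V, (τ : RawForms V) p ∈ bideg V (ℝ ∙ (p.2 : V))ᗮ k l}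
  add_mem' ha hb p := Submodule.add_mem _ (ha p) (hb p)
  zero_mem' _ := Submodule.zero_mem _
  smul_mem' c _ ha p := Submodule.smul_mem _ c (ha p)

/-- The value of the contact form at a point `(x, v)`, as a functional: `(a, b) ↦ ⟪v, a⟫`. -/
def contactFunctional (v : V) : Tan v →ₗ[ℝ] ℂ :=
  Complex.ofRealLI.toLinearMap ∘ₗ (innerₛₗ ℝ v) ∘ₗ LinearMap.fst ℝ V (ℝ ∙ v)ᗮ

/-- The contact form `α` on `SV`. -/
def contactForm : RawForms V := fun p => ExteriorAlgebra.ι ℂ (contactFunctional V (p.2 : V))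

theorem ι_mul_eq_involute_mul {M : Type*} [AddCommGroup M] [Module ℂ M] (a : M)
    (x : ExteriorAlgebra ℂ M) :
    ExteriorAlgebra.ι ℂ a * x = CliffordAlgebra.involute x * ExteriorAlgebra.ι ℂ a := by
  induction x using ExteriorAlgebra.induction with
  | algebraMap r => rw [AlgHom.commutes, Algebra.commutes]
  | ι y =>
    have h : CliffordAlgebra.involute (ExteriorAlgebra.ι ℂ y) = - ExteriorAlgebra.ι ℂ y :=
      CliffordAlgebra.involute_ι y
    rw [h, neg_mul]
    exact eq_neg_of_add_eq_zero_left (ExteriorAlgebra.ι_add_mul_swap a y)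
  | mul x y hx hy => rw [← mul_assoc, hx, mul_assoc, hy, ← mul_assoc, map_mul]
  | add x y hx hy => rw [mul_add, hx, hy, map_add, add_mul]

/-- The vertical forms `Ω_v^{*,*}(SV)^{tr} = {τ | α ∧ τ = 0}`. -/
def verticalIdeal : Ideal (trForms V) where
  carrier := {τ | contactForm V * (τ : RawForms V) = 0}
  add_mem' {a b} ha hb := by
    simp only [Set.mem_ofPred_eq] at *
    rw [Subalgebra.coe_add, mul_add, ha, hb, add_zero]
  zero_mem' := by simp
  smul_mem' η τ hτ := by
    simp only [Set.mem_ofPred_eq] at *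
    funext p
    have h := congrFun hτ p
    simp only [Pi.mul_apply, Pi.zero_apply, contactForm] at h
    simp only [smul_eq_mul, Subalgebra.coe_mul, Pi.mul_apply, Pi.zero_apply, contactForm]
    rw [← mul_assoc, ι_mul_eq_involute_mul, mul_assoc, h, mul_zero]

instance : (verticalIdeal V).IsTwoSided := ⟨fun {a} b ha => by
  have h : contactForm V * (a : RawForms V) = 0 := ha
  show contactForm V * ((a * b : trForms V) : RawForms V) = 0
  rw [Subalgebra.coe_mul, ← mul_assoc, h, zero_mul]⟩

/-- `Ω_h^{*,*}(SV)^{tr} = Ω^{*,*}(SV)^{tr} / Ω_v^{*,*}(SV)^{tr}`, the algebra of horizontal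
translation invariant forms. -/
def HForms : Type _ := trForms V ⧸ verticalIdeal V

instance : Ring (HForms V) := inferInstanceAs (Ring (trForms V ⧸ verticalIdeal V))

instance : Algebra ℂ (HForms V) := inferInstanceAs (Algebra ℂ (trForms V ⧸ verticalIdeal V))

/-- The quotient map `Ω^{*,*}(SV)^{tr} → Ω_h^{*,*}(SV)^{tr}`. -/
def toHForms : trForms V →ₐ[ℂ] HForms V := Ideal.Quotient.mkₐ ℂ (verticalIdeal V)

/-- `Ω_h^{k,l}(SV)^{tr}`, the image of `Ω^{k,l}(SV)^{tr}` in `Ω_h^{*,*}(SV)^{tr}`. -/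
def hFormsBideg (k l : ℕ) : Submodule ℂ (HForms V) :=
  (trFormsBideg V k l).map (toHForms V).toLinearMap

theorem one_mem_hFormsBideg : (1 : HForms V) ∈ hFormsBideg V 0 0 :=
  ⟨1, fun _ => one_mem_bideg, map_one (toHForms V)⟩

theorem mul_mem_hFormsBideg {k l k' l' : ℕ} {x y : HForms V}
    (hx : x ∈ hFormsBideg V k l) (hy : y ∈ hFormsBideg V k' l') :
    x * y ∈ hFormsBideg V (k + k') (l + l') := by
  obtain ⟨a, ha, rfl⟩ := hx
  obtain ⟨b, hb, rfl⟩ := hy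
  exact ⟨a * b, fun p => mul_mem_bideg (ha p) (hb p),
    map_mul (toHForms V) a b⟩

/-! ### Pull-back along linear isometries -/

variable {V W X}

/-- The map `SV → SW` induced by a linear isometry. -/
def sphereBundleMap (f : V →ₗᵢ[ℝ] W) (p : SphereBundle V) : SphereBundle W :=
  (f p.1, ⟨f (p.2 : V), by simp⟩)

/-- The differential of `sphereBundleMap f`. -/
def tanMap (f : V →ₗᵢ[ℝ] W) (v : V) : Tan v →ₗ[ℝ] Tan (f v) :=
  LinearMap.prodMap f.toLinearMap (f.toLinearMap.restrict fun w hw => by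
    rw [Submodule.mem_orthogonal_singleton_iff_inner_right] at *
    simpa using hw)

/-- Pull-back of forms along the map `SV → SW` induced by a linear isometry. -/
def rawPullback (f : V →ₗᵢ[ℝ] W) : RawForms W →ₐ[ℂ] RawForms V :=
  AlgHom.pi fun p => (extComap (tanMap f (p.2 : V))).comp
    (Pi.evalAlgHom ℂ (fun q : SphereBundle W => Ext (Tan (q.2 : W))) (sphereBundleMap f p))

/-- Pull-back of forms on the ambient vector spaces. -/
def ambientPullback (f : V →ₗᵢ[ℝ] W) : (W × W → Ext (W × W)) →ₐ[ℂ] (V × V → Ext (V × V)) :=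
  AlgHom.pi fun p => (extComap (LinearMap.prodMap f.toLinearMap f.toLinearMap)).comp
    (Pi.evalAlgHom ℂ (fun _ : W × W => Ext (W × W)) (f p.1, f p.2))

theorem ambientPullback_mem (f : V →ₗᵢ[ℝ] W) {F : W × W → Ext (W × W)}
    (hF : F ∈ ambientForms (W × W)) : ambientPullback f F ∈ ambientForms (V × V) := by
  have h : ambientForms (W × W) ≤ (ambientForms (V × V)).comap (ambientPullback f) := by
    refine Algebra.adjoin_le ?_
    rintro _ (⟨g, hg, rfl⟩ | ⟨e, rfl⟩)
    · refine Algebra.subset_adjoin (Or.inl ⟨fun p => g (f p.1, f p.2), ?_, ?_⟩)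
      · exact hg.comp ((f.contDiff.comp contDiff_fst).prodMk (f.contDiff.comp contDiff_snd))
      · funext p
        exact AlgHom.commutes _ _
    · exact Algebra.subset_adjoin (Or.inr ⟨extComap _ e, rfl⟩)
  exact h hF

theorem rawPullback_restrict (f : V →ₗᵢ[ℝ] W) (F : W × W → Ext (W × W)) :
    rawPullback f (restrictToSphereBundle W F)
      = restrictToSphereBundle V (ambientPullback f F) := by
  funext p
  refine (extComap_comp (tanMap f (p.2 : V)) (tanIncl (f (p.2 : V))) (F (f p.1, f (p.2 : V)))).trans
    (Eq.trans ?_ (extComap_comp (tanIncl (p.2 : V))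
      (LinearMap.prodMap f.toLinearMap f.toLinearMap) (F (f p.1, f (p.2 : V)))).symm)
  rfl

theorem rawPullback_mem (f : V →ₗᵢ[ℝ] W) {τ : RawForms W} (hτ : τ ∈ trForms W) :
    rawPullback f τ ∈ trForms V := by
  obtain ⟨⟨F, hF, rfl⟩, h2⟩ := hτ
  refine ⟨⟨ambientPullback f F, ambientPullback_mem f hF, (rawPullback_restrict f F).symm⟩, ?_⟩
  intro t x v
  have h3 := h2 (f t) (f x) ⟨f (v : V), by simp⟩
  show extComap (tanMap f (v : V)) (_) = extComap (tanMap f (v : V)) (_)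
  congr 1
  refine Eq.trans ?_ h3
  show extComap (tanIncl (f (v : V))) (F (f (x + t), f (v : V)))
    = extComap (tanIncl (f (v : V))) (F (f x + f t, f (v : V)))
  rw [map_add]

theorem rawPullback_contactForm (f : V →ₗᵢ[ℝ] W) :
    rawPullback f (contactForm W) = contactForm V := by
  funext p
  refine (ExteriorAlgebra.map_apply_ι _ _).trans ?_
  refine congrArg (ExteriorAlgebra.ι ℂ) ?_
  refine LinearMap.ext fun w => ?_
  exact congrArg (fun r : ℝ => (r : ℂ)) (f.inner_map_map (p.2 : V) w.1)

/-- Pull-back of smooth translation invariant forms. -/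
def trPullback (f : V →ₗᵢ[ℝ] W) : trForms W →ₐ[ℂ] trForms V :=
  ((rawPullback f).comp (trForms W).val).codRestrict (trForms V)
    fun τ => rawPullback_mem f τ.2

/-- Pull-back of horizontal translation invariant forms. -/
def hPullback (f : V →ₗᵢ[ℝ] W) : HForms W →ₐ[ℂ] HForms V :=
  Ideal.quotientMapₐ (verticalIdeal V) (trPullback f) fun τ hτ => by
    have h : contactForm W * (τ : RawForms W) = 0 := hτ
    show contactForm V * rawPullback f (τ : RawForms W) = 0
    rw [← rawPullback_contactForm f, ← map_mul, h, map_zero]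

theorem hPullback_comp (f : V →ₗᵢ[ℝ] W) (g : W →ₗᵢ[ℝ] X) (τ : HForms X) :
    hPullback f (hPullback g τ) = hPullback (g.comp f) τ := by
  obtain ⟨a, rfl⟩ := Ideal.Quotient.mk_surjective τ
  refine congrArg (toHForms V) (Subtype.ext (funext fun p => ?_))
  exact extComap_comp (tanMap f (p.2 : V)) (tanMap g (f (p.2 : V))) _

theorem hPullback_id (τ : HForms V) : hPullback (LinearIsometry.id : V →ₗᵢ[ℝ] V) τ = τ := by
  obtain ⟨a, rfl⟩ := Ideal.Quotient.mk_surjective τ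
  refine congrArg (toHForms V) (Subtype.ext (funext fun p => ?_))
  exact extComap_id _

theorem hPullback_mem_hFormsBideg (f : V →ₗᵢ[ℝ] W) {k l : ℕ} {τ : HForms W}
    (hτ : τ ∈ hFormsBideg W k l) : hPullback f τ ∈ hFormsBideg V k l := by
  obtain ⟨a, ha, rfl⟩ := hτ
  exact ⟨trPullback f a, fun p => extComap_mem_bideg _ _ (ha (sphereBundleMap f p)), rfl⟩

end SphereBundle

/-! ### Quaternionic spaces -/

/-- The right quaternionic vector space `ℍ^n` with its Euclidean structure. -/
abbrev Hn (n : ℕ) : Type := PiLp 2 (fun _ : Fin n => ℍ[ℝ])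

/-- The quaternionic Hermitian form `K(v, w) = ∑ i, v̄_i w_i`. -/
def qForm {n : ℕ} (v w : Hn n) : ℍ[ℝ] := ∑ i, star (v i) * w i

theorem qForm_self_re {n : ℕ} (v : Hn n) : (qForm v v).re = ‖v‖ ^ 2 := by
  have h : ∀ i, (star (v i) * v i) = ((‖v i‖ ^ 2 : ℝ) : ℍ[ℝ]) := fun i => by
    rw [Quaternion.star_mul_self, Quaternion.normSq_eq_norm_mul_self, sq]
  have h2 : qForm v v = ((∑ i, ‖v i‖ ^ 2 : ℝ) : ℍ[ℝ]) :=
    (Finset.sum_congr rfl fun i _ => h i).trans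
      (map_sum (algebraMap ℝ ℍ[ℝ]) (fun i => ‖v i‖ ^ 2) Finset.univ).symm
  rw [h2, PiLp.norm_sq_eq_of_L2]
  exact Quaternion.re_coe _

/-- A quaternionic isometric embedding `ℍ^n → ℍ^m`: a right `ℍ`-linear map preserving the
quaternionic Hermitian forms. -/
structure QuatIsometry (n m : ℕ) where
  toLin : Hn n →ₗ[ℍ[ℝ]ᵐᵒᵖ] Hn m
  map_qForm : ∀ v w, qForm (toLin v) (toLin w) = qForm v w

theorem real_smul_eq {n : ℕ} (r : ℝ) (v : Hn n) : r • v = MulOpposite.op (r : ℍ[ℝ]) • v := by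
  ext i : 1
  simp [Quaternion.mul_coe_eq_smul]

/-- The underlying real-linear isometry. -/
def QuatIsometry.toIsometry {n m : ℕ} (f : QuatIsometry n m) : Hn n →ₗᵢ[ℝ] Hn m where
  toFun := f.toLin
  map_add' := map_add f.toLin
  map_smul' r v := by rw [real_smul_eq, map_smul, RingHom.id_apply, real_smul_eq]
  norm_map' v := by
    have h := congrArg QuaternionAlgebra.re (f.map_qForm v v)
    rw [qForm_self_re, qForm_self_re] at h
    exact (sq_eq_sq₀ (norm_nonneg _) (norm_nonneg _)).mp h

/-- The compact symplectic group `Sp(n)`: the right `ℍ`-linear automorphisms of `ℍ^n` preserving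
the quaternionic Hermitian form. -/
def Sp (n : ℕ) : Subgroup (Hn n ≃ₗ[ℍ[ℝ]ᵐᵒᵖ] Hn n) where
  carrier := {A | ∀ v w, qForm (A v) (A w) = qForm v w}
  mul_mem' {A B} hA hB v w := (hA (B v) (B w)).trans (hB v w)
  one_mem' _ _ := rfl
  inv_mem' {A} hA v w := by
    have h := hA (A.symm v) (A.symm w)
    rw [A.apply_symm_apply, A.apply_symm_apply] at h
    exact h.symm

/-- An element of `Sp(n)` as a quaternionic isometric embedding. -/
def Sp.toQuatIsometry {n : ℕ} (A : Sp n) : QuatIsometry n n where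
  toLin := (A : Hn n ≃ₗ[ℍ[ℝ]ᵐᵒᵖ] Hn n).toLinearMap
  map_qForm := A.2

/-- `Ω_h^{k,l}(Sℍ^n)^{Sp(n)}`: the horizontal translation invariant forms of bidegree `(k, l)`
that are invariant under `Sp(n)`. -/
def invForms (n k l : ℕ) : Submodule ℂ (HForms (Hn n)) where
  carrier := {τ | τ ∈ hFormsBideg (Hn n) k l ∧
    ∀ A : Sp n, hPullback (Sp.toQuatIsometry A).toIsometry τ = τ}
  add_mem' ha hb := ⟨Submodule.add_mem _ ha.1 hb.1, fun A => by rw [map_add, ha.2, hb.2]⟩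
  zero_mem' := ⟨Submodule.zero_mem _, fun A => map_zero _⟩
  smul_mem' c _ ha := ⟨Submodule.smul_mem _ c ha.1, fun A => by rw [map_smul, ha.2]⟩

/-! ### The inverse limit -/

/-- Sequences of horizontal forms, one on each `Sℍ^n`, with componentwise operations. (`Sℍ^0` is
empty, so the component for `n = 0` is zero and carries no information.) -/
abbrev FormSeq : Type := (n : ℕ) → HForms (Hn n)

/-- `Ω_h^{k,l}(Sℍ^∞)^{Sp(∞)}`: the inverse limit of the spaces `Ω_h^{k,l}(Sℍ^n)^{Sp(n)}` along the
restriction maps given by a sequence `ℍ^1 → ℍ^2 → ⋯` of quaternionic isometric embeddings. -/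
def limForms (j : (n : ℕ) → QuatIsometry n (n + 1)) (k l : ℕ) : Submodule ℂ FormSeq where
  carrier := {τ | (∀ n, τ n ∈ invForms n k l) ∧
    ∀ n, hPullback (j n).toIsometry (τ (n + 1)) = τ n}
  add_mem' ha hb := ⟨fun n => Submodule.add_mem _ (ha.1 n) (hb.1 n), fun n => by
    rw [Pi.add_apply, map_add, ha.2, hb.2, Pi.add_apply]⟩
  zero_mem' := ⟨fun n => Submodule.zero_mem _, fun n => map_zero _⟩
  smul_mem' c _ ha := ⟨fun n => Submodule.smul_mem _ c (ha.1 n), fun n => by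
    rw [Pi.smul_apply, map_smul, ha.2, Pi.smul_apply]⟩

instance (j : (n : ℕ) → QuatIsometry n (n + 1)) :
    SetLike.GradedMonoid fun d : ℕ × ℕ => limForms j d.1 d.2 where
  one_mem := ⟨fun _ => ⟨one_mem_hFormsBideg _, fun _ => map_one _⟩, fun _ => map_one _⟩
  mul_mem _ _ _ _ ha hb :=
    ⟨fun n => ⟨mul_mem_hFormsBideg _ (ha.1 n).1 (hb.1 n).1, fun A => by
      rw [Pi.mul_apply, map_mul, (ha.1 n).2, (hb.1 n).2]⟩, fun n => by
      rw [Pi.mul_apply, map_mul, ha.2, hb.2, Pi.mul_apply]⟩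

/-- The bigraded algebra `Ω_h^{*,*}(Sℍ^∞)^{Sp(∞)}`, the sum of the spaces
`Ω_h^{k,l}(Sℍ^∞)^{Sp(∞)}`. -/
def limAlgebra (j : (n : ℕ) → QuatIsometry n (n + 1)) : Subalgebra ℂ FormSeq :=
  (⨆ d : ℕ × ℕ, limForms j d.1 d.2).toSubalgebra
    (Submodule.mem_iSup_of_mem (0 : ℕ × ℕ)
      (SetLike.GradedOne.one_mem (A := fun d : ℕ × ℕ => limForms j d.1 d.2)))
    (by
      intro x y hx hy
      have h : (⨆ d : ℕ × ℕ, limForms j d.1 d.2) * (⨆ d : ℕ × ℕ, limForms j d.1 d.2)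
          ≤ ⨆ d : ℕ × ℕ, limForms j d.1 d.2 := by
        simp only [Submodule.iSup_mul, Submodule.mul_iSup]
        refine iSup_le fun d => iSup_le fun d' => ?_
        refine le_trans ?_ (le_iSup (fun d : ℕ × ℕ => limForms j d.1 d.2) (d' + d))
        rw [Submodule.mul_le]
        intro a ha b hb
        exact SetLike.GradedMul.mul_mem (A := fun d : ℕ × ℕ => limForms j d.1 d.2) ha hb
      exact h (Submodule.mul_mem_mul hx hy))

/-- The restriction map `Ω_h^{k,l}(Sℍ^∞)^{Sp(∞)} → Ω_h^{k,l}(Sℍ^n)^{Sp(n)}`. -/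
def restrictionMap (j : (n : ℕ) → QuatIsometry n (n + 1)) (k l n : ℕ) :
    limForms j k l →ₗ[ℂ] invForms n k l :=
  ((LinearMap.proj n : FormSeq →ₗ[ℂ] HForms (Hn n)).comp
    (limForms j k l).subtype).codRestrict (invForms n k l) fun τ => τ.2.1 n

/-! ### The action of `SU(2) = Sp(1)` -/

/-- Right multiplication by a quaternion of norm `1` on `ℍ^n`. -/
def rightMul (n : ℕ) (q : Metric.sphere (0 : ℍ[ℝ]) 1) : Hn n →ₗᵢ[ℝ] Hn n where
  toFun v := MulOpposite.op (q : ℍ[ℝ]) • v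
  map_add' := smul_add _
  map_smul' r v := by ext i : 1; simp
  norm_map' v := by
    have hq : ‖(q : ℍ[ℝ])‖ = 1 := by simp
    refine (sq_eq_sq₀ (norm_nonneg _) (norm_nonneg _)).mp ?_
    simp [PiLp.norm_sq_eq_of_L2, hq]

/-- The group `Sp(1)` of quaternions of norm `1`. -/
abbrev Sp1 : Type := Metric.sphere (0 : ℍ[ℝ]) 1

/-- The action of `Sp(1)` on sequences of forms by algebra homomorphisms: `q` acts on the forms on
each `Sℍ^n` by pull-back along right multiplication by `q`. -/
def sp1Act : Sp1 →* (FormSeq →ₐ[ℂ] FormSeq) where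
  toFun q := AlgHom.pi fun n => (hPullback (rightMul n q)).comp
    (Pi.evalAlgHom ℂ (fun n => HForms (Hn n)) n)
  map_one' := by
    refine AlgHom.ext fun τ => funext fun n => ?_
    have h : rightMul n (1 : Sp1) = LinearIsometry.id := by
      ext v : 1
      show MulOpposite.op (1 : ℍ[ℝ]) • v = v
      rw [MulOpposite.op_one, one_smul]
    show hPullback (rightMul n 1) (τ n) = τ n
    rw [h, hPullback_id]
  map_mul' q r := by
    refine AlgHom.ext fun τ => funext fun n => ?_
    have h : rightMul n (q * r) = (rightMul n r).comp (rightMul n q) := by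
      ext v : 1
      show MulOpposite.op ((q : ℍ[ℝ]) * (r : ℍ[ℝ])) • v
        = MulOpposite.op (r : ℍ[ℝ]) • MulOpposite.op (q : ℍ[ℝ]) • v
      rw [MulOpposite.op_mul, mul_smul]
    show hPullback (rightMul n (q * r)) (τ n)
      = hPullback (rightMul n q) (hPullback (rightMul n r) (τ n))
    rw [h, hPullback_comp]

theorem rightMul_comp {n m : ℕ} (f : QuatIsometry n m) (q : Sp1) :
    (rightMul m q).comp f.toIsometry = f.toIsometry.comp (rightMul n q) := by
  ext v : 1
  exact (map_smul f.toLin (MulOpposite.op (q : ℍ[ℝ])) v).symm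

/-- The action of `Sp(1)` respects the bigraded pieces, so that `limAlgebra j` is a bigraded
`SU(2)`-algebra. -/
theorem sp1Act_mem (j : (n : ℕ) → QuatIsometry n (n + 1)) {k l : ℕ} (q : Sp1) {τ : FormSeq}
    (hτ : τ ∈ limForms j k l) : sp1Act q τ ∈ limForms j k l := by
  refine ⟨fun n => ⟨hPullback_mem_hFormsBideg _ (hτ.1 n).1, fun A => ?_⟩, fun n => ?_⟩
  · show hPullback _ (hPullback (rightMul n q) (τ n)) = hPullback (rightMul n q) (τ n)
    rw [hPullback_comp, rightMul_comp, ← hPullback_comp, (hτ.1 n).2]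
  · show hPullback _ (hPullback (rightMul (n + 1) q) (τ (n + 1))) = hPullback (rightMul n q) (τ n)
    rw [hPullback_comp, rightMul_comp, ← hPullback_comp, hτ.2]

/-- The `2 × 2` matrix of left multiplication by a quaternion on `ℍ = ℂ ⊕ jℂ`: the quaternion
`z₁ + j z₂` is sent to `!![z₁, -z̄₂; z₂, z̄₁]`. For `q = a + b i + c j + d k` one has `z₁ = a + b i`
and `z₂ = c - d i`. -/
def quatMatrix (q : ℍ[ℝ]) : Matrix (Fin 2) (Fin 2) ℂ :=
  !![⟨q.re, q.imI⟩, -⟨q.imJ, q.imK⟩; ⟨q.imJ, -q.imK⟩, ⟨q.re, -q.imI⟩]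

theorem quatMatrix_mul (q r : ℍ[ℝ]) : quatMatrix (q * r) = quatMatrix q * quatMatrix r := by
  ext a b
  fin_cases a <;> fin_cases b <;>
    (simp [quatMatrix, Matrix.mul_apply, Fin.sum_univ_two, Complex.ext_iff] <;>
      constructor <;> ring)

theorem quatMatrix_one : quatMatrix 1 = 1 := by
  ext a b
  fin_cases a <;> fin_cases b <;> simp [quatMatrix, Complex.ext_iff]

theorem sum_sq_of_sp1 (q : Sp1) : (q : ℍ[ℝ]).re ^ 2 + (q : ℍ[ℝ]).imI ^ 2 + (q : ℍ[ℝ]).imJ ^ 2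
    + (q : ℍ[ℝ]).imK ^ 2 = 1 := by
  rw [← Quaternion.normSq_def', Quaternion.normSq_eq_norm_mul_self]
  simp

theorem quatMatrix_mem (q : Sp1) :
    quatMatrix (q : ℍ[ℝ]) ∈ Matrix.specialUnitaryGroup (Fin 2) ℂ := by
  have h := sum_sq_of_sp1 q
  rw [Matrix.mem_specialUnitaryGroup_iff, Matrix.mem_unitaryGroup_iff]
  constructor
  · ext a b
    fin_cases a <;> fin_cases b <;>
      (simp [quatMatrix, Matrix.mul_apply, Fin.sum_univ_two, Complex.ext_iff,
        Matrix.star_apply] <;> constructor <;> linarith)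
  · simp only [quatMatrix, Matrix.det_fin_two_of, Complex.ext_iff]
    simp
    constructor <;> linarith

/-- The standard identification of `Sp(1)` with `SU(2)`. -/
def sp1ToSU2 : Sp1 →* Matrix.specialUnitaryGroup (Fin 2) ℂ where
  toFun q := ⟨quatMatrix (q : ℍ[ℝ]), quatMatrix_mem q⟩
  map_one' := Subtype.ext quatMatrix_one
  map_mul' q r := Subtype.ext (quatMatrix_mul q r)

/-- The action of a `2 × 2` matrix on `Sym^* ℂ² = ℂ[X₀, X₁]`, where `X₀, X₁` is the standard basis
of `ℂ²`. -/
def symAct (g : Matrix (Fin 2) (Fin 2) ℂ) : MvPolynomial (Fin 2) ℂ →ₐ[ℂ] MvPolynomial (Fin 2) ℂ :=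
  MvPolynomial.aeval fun i => ∑ r, MvPolynomial.C (g r i) * MvPolynomial.X r

theorem symAct_mem (g : Matrix (Fin 2) (Fin 2) ℂ) (s : ℕ) {p : MvPolynomial (Fin 2) ℂ}
    (hp : p ∈ MvPolynomial.homogeneousSubmodule (Fin 2) ℂ s) :
    symAct g p ∈ MvPolynomial.homogeneousSubmodule (Fin 2) ℂ s := by
  rw [MvPolynomial.mem_homogeneousSubmodule] at *
  have h := hp.aeval (n := 1) (fun i => ∑ r, MvPolynomial.C (g r i) * MvPolynomial.X r)
    (fun i => MvPolynomial.IsHomogeneous.sum _ _ _ fun r _ => by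
      simpa using (MvPolynomial.isHomogeneous_C (Fin 2) (g r i)).mul
        (MvPolynomial.isHomogeneous_X ℂ r))
  simpa [symAct] using h

theorem symAct_one : symAct 1 = AlgHom.id ℂ _ := by
  ext i : 1
  simp [symAct, Matrix.one_apply]

theorem symAct_mul (g h : Matrix (Fin 2) (Fin 2) ℂ) :
    symAct (g * h) = (symAct g).comp (symAct h) := by
  ext i : 1
  simp [symAct, Matrix.mul_apply, Fin.sum_univ_two]
  ring

/-- The representation `V_s = Sym^s ℂ²` of `SU(2)`, on the space of homogeneous elements of degree
`s` of `Sym^* ℂ² = ℂ[X₀, X₁]`. -/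
def symRep (s : ℕ) : Representation ℂ (Matrix.specialUnitaryGroup (Fin 2) ℂ)
    (MvPolynomial.homogeneousSubmodule (Fin 2) ℂ s) where
  toFun g := (symAct (g : Matrix (Fin 2) (Fin 2) ℂ)).toLinearMap.restrict
    fun _ hp => symAct_mem _ s hp
  map_one' := LinearMap.ext fun x => Subtype.ext <| by
    show symAct 1 (x : MvPolynomial (Fin 2) ℂ) = x
    rw [symAct_one, AlgHom.id_apply]
  map_mul' g h := LinearMap.ext fun x => Subtype.ext <| by
    show symAct ((g : Matrix (Fin 2) (Fin 2) ℂ) * (h : Matrix (Fin 2) (Fin 2) ℂ))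
      (x : MvPolynomial (Fin 2) ℂ) = symAct g (symAct h (x : MvPolynomial (Fin 2) ℂ))
    rw [symAct_mul, AlgHom.comp_apply]

/-- The subspace `S` of `FormSeq` is a copy of the `SU(2)`-representation `V_s`: there is an
`SU(2)`-equivariant linear isomorphism from `V_s` onto `S`. -/
def IsCopyOf (s : ℕ) (S : Submodule ℂ FormSeq) : Prop :=
  ∃ φ : MvPolynomial.homogeneousSubmodule (Fin 2) ℂ s ≃ₗ[ℂ] S,
    ∀ (q : Sp1) (x : MvPolynomial.homogeneousSubmodule (Fin 2) ℂ s),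
      (φ (symRep s (sp1ToSU2 q) x) : FormSeq) = sp1Act q (φ x : FormSeq)

end SphereForms

end

/-! A horizontal translation-invariant form is determined by its restrictions to the contact
hyperplanes `v^⊥ × v^⊥`, one for each unit vector `v`. Since `Sp(n)` is transitive on the unit
sphere, an invariant form is determined by its value at one basis vector `e`. That value is an
exterior form on the contact hyperplane which is invariant under the stabilizer of `e`, a copy of
`Sp(n-1)`.

As a representation of the stabilizer, `e^⊥` is the sum of three fixed lines `e i, e j, e k` and the
standard space `ℍ^(n-1)`. The first fundamental theorem for `Sp(n-1)` in the exterior algebra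
(`lieInv_mem`) then says that the invariants are generated by the coordinate one-forms of the fixed
lines and by the two-forms `∑ ⟪e_i, w_t⟫ ∧ ⟪e_i q, w_t'⟫`, where `q` is a quaternion and `t, t'`
select one of the two factors of `V × V`. These forms are the values at `e` of forms defined on all
spheres at once and compatible with restriction, `linSeq t q` and `quadSeq t t' q`. Hence every
invariant form on `Sℍ^n` lifts to the limit and the lift is a polynomial in these generators
(`exists_genAlgebra`). A unit quaternion `r` acts by `q ↦ r q r̄`, so imaginary `q` give copies of
`V_2` and `q = 1` gives a copy of `V_0`. The relations `linSeq t 1 = 0`, `quadSeq t t 1 = 0` and the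
antisymmetry under exchange of `t` and `t'` leave exactly the six listed subspaces.

The first fundamental theorem is proved by a Casimir argument. The exterior algebra carries a
positive definite Hermitian form `ip` for which wedging with a basis covector and contracting with
the dual vector are adjoint. With `L` running over the derivations given by quaternionic matrix
units, the identity `sum_lop_sq` expresses `∑ L²` through a number operator and `∑ Θ Δ`, where `Θ`
multiplies by an invariant two-form and `Δ` is, up to sign and order of the indices, its adjoint. On
invariants `L = L*`, so twice the degree plus `∑ L L*`, which is positive definite in positive
degree, equals an operator built from `Θ Δ` and from wedge after contraction in the fixed
directions. That operator is therefore invertible on the invariants of each bidegree of positive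
total degree, so each such invariant is a combination of products of generators with invariants of
lower degree. Passing from the group to its Lie algebra is done by differentiating explicit
reflections (`mem_lieInv_of_invariant`).

For injectivity (`eq_zero_of_restriction_eq_zero`), a form of degree `k + l` is tested on `k + l`
vectors at a base point. These `k + l + 1` vectors lie in a quaternionic isometric image of `ℍ^n`
once `k + l + 1 ≤ n`, so an invariant form that vanishes on `ℍ^n` vanishes. Lifting from level `k +
l + 1` and applying injectivity shows that the limit is generated by the six subspaces. -/

noncomputable section

namespace SphereForms

/-! ### Creation and annihilation operators on an exterior algebra -/

section Fock

open Module

variable {I M : Type*} [AddCommGroup M] [Module ℂ M]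

/-- Multiplication by a one-form. -/
def wedge (m : M) : End ℂ (ExteriorAlgebra ℂ M) :=
  LinearMap.mulLeft ℂ (ExteriorAlgebra.ι ℂ m)

/-- Contraction with a functional. -/
def contr (d : Dual ℂ M) : End ℂ (ExteriorAlgebra ℂ M) :=
  CliffordAlgebra.contractLeft d

theorem wedge_apply (m : M) (x : ExteriorAlgebra ℂ M) :
    wedge m x = ExteriorAlgebra.ι ℂ m * x := rfl

theorem contr_ι_mul (d : Dual ℂ M) (m : M) (x : ExteriorAlgebra ℂ M) :
    contr d (ExteriorAlgebra.ι ℂ m * x) = d m • x - ExteriorAlgebra.ι ℂ m * contr d x :=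
  CliffordAlgebra.contractLeft_ι_mul (Q := (0 : QuadraticForm ℂ M)) d m x

theorem contr_wedge (d : Dual ℂ M) (m : M) (x : ExteriorAlgebra ℂ M) :
    contr d (wedge m x) = d m • x - wedge m (contr d x) :=
  contr_ι_mul d m x

theorem contr_one (d : Dual ℂ M) : contr d (1 : ExteriorAlgebra ℂ M) = 0 :=
  CliffordAlgebra.contractLeft_one (Q := (0 : QuadraticForm ℂ M)) d

theorem contr_algebraMap (d : Dual ℂ M) (r : ℂ) :
    contr d (algebraMap ℂ (ExteriorAlgebra ℂ M) r) = 0 :=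
  CliffordAlgebra.contractLeft_algebraMap (Q := (0 : QuadraticForm ℂ M)) d r

theorem contr_contr_self (d : Dual ℂ M) (x : ExteriorAlgebra ℂ M) : contr d (contr d x) = 0 :=
  CliffordAlgebra.contractLeft_contractLeft (Q := (0 : QuadraticForm ℂ M)) d x

theorem contr_comm (d d' : Dual ℂ M) (x : ExteriorAlgebra ℂ M) :
    contr d (contr d' x) = -contr d' (contr d x) :=
  CliffordAlgebra.contractLeft_comm (Q := (0 : QuadraticForm ℂ M)) d d' x

theorem wedge_comm (m m' : M) (x : ExteriorAlgebra ℂ M) :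
    wedge m (wedge m' x) = -wedge m' (wedge m x) := by
  simp only [wedge_apply, ← mul_assoc]
  rw [eq_neg_of_add_eq_zero_left (ExteriorAlgebra.ι_add_mul_swap m m'), neg_mul]

theorem wedge_wedge_self (m : M) (x : ExteriorAlgebra ℂ M) : wedge m (wedge m x) = 0 := by
  simp only [wedge_apply, ← mul_assoc, ExteriorAlgebra.ι_sq_zero, zero_mul]

theorem wedge_add (m m' : M) : wedge (m + m') = wedge m + wedge m' := by
  refine LinearMap.ext fun x => ?_
  simp [wedge_apply, add_mul]

theorem wedge_smul (c : ℂ) (m : M) : wedge (c • m) = c • wedge m := by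
  refine LinearMap.ext fun x => ?_
  simp [wedge_apply]

theorem wedge_sum {J : Type*} (s : Finset J) (m : J → M) :
    wedge (∑ j ∈ s, m j) = ∑ j ∈ s, wedge (m j) := by
  refine LinearMap.ext fun x => ?_
  simp [wedge_apply, Finset.sum_mul]

/-- Induction on exterior algebra elements by left multiplication with one-forms. -/
theorem ext_left_induction {P : ExteriorAlgebra ℂ M → Prop}
    (scalar : ∀ r : ℂ, P (algebraMap _ _ r)) (add : ∀ x y, P x → P y → P (x + y))
    (ι_mul : ∀ x m, P x → P (ExteriorAlgebra.ι ℂ m * x)) : ∀ x, P x :=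
  CliffordAlgebra.left_induction (Q := 0) scalar add ι_mul

/-- The endomorphisms of `A`, with opposite multiplication and conjugate scalars. -/
def ConjEnd (A : Type*) [AddCommGroup A] [Module ℂ A] : Type _ := (End ℂ A)ᵐᵒᵖ

instance (A : Type*) [AddCommGroup A] [Module ℂ A] : Ring (ConjEnd A) :=
  inferInstanceAs (Ring (End ℂ A)ᵐᵒᵖ)

section ConjEnd

variable {A : Type*} [AddCommGroup A] [Module ℂ A]

/-- The endomorphism underlying an element of `ConjEnd A`. -/
def ConjEnd.toEnd (x : ConjEnd A) : End ℂ A := MulOpposite.unop (x : (End ℂ A)ᵐᵒᵖ)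

/-- An endomorphism as an element of `ConjEnd A`. -/
def ConjEnd.ofEnd (x : End ℂ A) : ConjEnd A := (MulOpposite.op x : (End ℂ A)ᵐᵒᵖ)

theorem ConjEnd.toEnd_mul (x y : ConjEnd A) : (x * y).toEnd = y.toEnd * x.toEnd := rfl

theorem ConjEnd.toEnd_add (x y : ConjEnd A) : (x + y).toEnd = x.toEnd + y.toEnd := rfl

theorem ConjEnd.toEnd_ofEnd (x : End ℂ A) : (ofEnd x).toEnd = x := rfl

theorem ConjEnd.toEnd_injective : Function.Injective (toEnd : ConjEnd A → End ℂ A) :=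
  MulOpposite.unop_injective

/-- Taking adjoints is conjugate-linear and reverses products. With conjugate scalars and opposite
multiplication it becomes a homomorphism of `ℂ`-algebras, so it can be defined by the universal
property of the exterior algebra. -/
instance : Algebra ℂ (ConjEnd A) where
  smul c x := ConjEnd.ofEnd (starRingEnd ℂ c • x.toEnd)
  algebraMap :=
    { toFun := fun c => ConjEnd.ofEnd (starRingEnd ℂ c • (1 : End ℂ A))
      map_one' := by rw [map_one, one_smul]; rfl
      map_zero' := by rw [map_zero, zero_smul]; rfl
      map_mul' := fun a b => ConjEnd.toEnd_injective <| by
        rw [ConjEnd.toEnd_mul]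
        simp only [ConjEnd.toEnd_ofEnd, map_mul, smul_mul_smul, one_mul, mul_comm]
      map_add' := fun a b => ConjEnd.toEnd_injective <| by
        rw [ConjEnd.toEnd_add]
        simp only [ConjEnd.toEnd_ofEnd, map_add, add_smul] }
  commutes' c x := ConjEnd.toEnd_injective <| LinearMap.ext fun v => by
    change x.toEnd (starRingEnd ℂ c • v) = starRingEnd ℂ c • x.toEnd v
    rw [map_smul]
  smul_def' c x := ConjEnd.toEnd_injective <| LinearMap.ext fun v => by
    change starRingEnd ℂ c • x.toEnd v = x.toEnd (starRingEnd ℂ c • v)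
    rw [map_smul]

theorem ConjEnd.toEnd_smul (c : ℂ) (x : ConjEnd A) :
    (c • x).toEnd = starRingEnd ℂ c • x.toEnd := rfl

theorem ConjEnd.toEnd_algebraMap (c : ℂ) :
    (algebraMap ℂ (ConjEnd A) c).toEnd = starRingEnd ℂ c • (1 : End ℂ A) := rfl

end ConjEnd

/-- The scalar part of an element of the exterior algebra. -/
def scalarPart : ExteriorAlgebra ℂ M →ₐ[ℂ] ℂ := ExteriorAlgebra.algebraMapInv

theorem scalarPart_ι_mul (m : M) (x : ExteriorAlgebra ℂ M) :
    scalarPart (ExteriorAlgebra.ι ℂ m * x) = 0 := by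
  rw [map_mul]
  simp [scalarPart, ExteriorAlgebra.algebraMapInv]

variable (b : Basis I ℂ M)

/-- Multiplication by a basis one-form. -/
def wd (i : I) : End ℂ (ExteriorAlgebra ℂ M) := wedge (b i)

/-- Contraction with a dual basis vector. -/
def ct (i : I) : End ℂ (ExteriorAlgebra ℂ M) := contr (b.coord i)

theorem ct_wd [DecidableEq I] (i j : I) (x : ExteriorAlgebra ℂ M) :
    ct b i (wd b j x) = (if i = j then x else 0) - wd b j (ct b i x) := by
  rw [ct, wd, contr_wedge, Basis.coord_apply, Basis.repr_self, Finsupp.single_apply]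
  by_cases h : i = j
  · simp [h]
  · simp [h, Ne.symm h]

variable [Fintype I]

/-- The functional dual to `m` with respect to the Hermitian form with orthonormal basis `b`. -/
def conjDual (m : M) : Dual ℂ M := ∑ i, starRingEnd ℂ (b.repr m i) • b.coord i

theorem contr_conjDual (m : M) :
    contr (conjDual b m) = ∑ i, starRingEnd ℂ (b.repr m i) • ct b i := by
  simp only [contr, conjDual, map_sum, map_smul, ct]

/-- The algebra homomorphism taking the multiplication by a one-form to its formal adjoint. -/
def dagger : ExteriorAlgebra ℂ M →ₐ[ℂ] ConjEnd (ExteriorAlgebra ℂ M) :=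
  ExteriorAlgebra.lift ℂ
    ⟨{ toFun := fun m => ConjEnd.ofEnd (contr (conjDual b m))
       map_add' := fun m m' => ConjEnd.toEnd_injective <| by
        rw [ConjEnd.toEnd_add]
        simp only [ConjEnd.toEnd_ofEnd, contr_conjDual, map_add, Finsupp.add_apply, add_smul,
          Finset.sum_add_distrib]
       map_smul' := fun c m => ConjEnd.toEnd_injective <| by
        rw [RingHom.id_apply, ConjEnd.toEnd_smul]
        simp only [ConjEnd.toEnd_ofEnd, contr_conjDual, map_smul, Finsupp.smul_apply, smul_eq_mul,
          map_mul, mul_smul, Finset.smul_sum] },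
     fun m => ConjEnd.toEnd_injective <| LinearMap.ext fun x => contr_contr_self _ x⟩

theorem dagger_ι (m : M) :
    (dagger b (ExteriorAlgebra.ι ℂ m)).toEnd = contr (conjDual b m) := by
  rw [dagger, ExteriorAlgebra.lift_ι_apply]
  rfl

/-- The Hermitian form on the exterior algebra for which the monomials in the elements of the basis
`b` are orthonormal. -/
def ip (x y : ExteriorAlgebra ℂ M) : ℂ := scalarPart ((dagger b x).toEnd y)

theorem ip_add_right (x y z : ExteriorAlgebra ℂ M) : ip b x (y + z) = ip b x y + ip b x z := by
  simp [ip]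

theorem ip_sub_right (x y z : ExteriorAlgebra ℂ M) : ip b x (y - z) = ip b x y - ip b x z := by
  simp [ip]

theorem ip_smul_right (c : ℂ) (x y : ExteriorAlgebra ℂ M) : ip b x (c • y) = c * ip b x y := by
  simp [ip]

theorem ip_zero_right (x : ExteriorAlgebra ℂ M) : ip b x 0 = 0 := by
  simp [ip]

theorem ip_sum_right {J : Type*} (s : Finset J) (x : ExteriorAlgebra ℂ M)
    (y : J → ExteriorAlgebra ℂ M) : ip b x (∑ j ∈ s, y j) = ∑ j ∈ s, ip b x (y j) := by
  simp [ip]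

theorem ip_add_left (x y z : ExteriorAlgebra ℂ M) : ip b (x + y) z = ip b x z + ip b y z := by
  simp only [ip, map_add, ConjEnd.toEnd_add, LinearMap.add_apply]

theorem ip_smul_left (c : ℂ) (x y : ExteriorAlgebra ℂ M) :
    ip b (c • x) y = starRingEnd ℂ c * ip b x y := by
  simp only [ip, map_smul, ConjEnd.toEnd_smul, LinearMap.smul_apply, smul_eq_mul]

theorem ip_zero_left (x : ExteriorAlgebra ℂ M) : ip b 0 x = 0 := by
  simpa using ip_smul_left b 0 0 x

theorem ip_neg_left (x y : ExteriorAlgebra ℂ M) : ip b (-x) y = -ip b x y := by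
  simpa using ip_smul_left b (-1) x y

theorem ip_sub_left (x y z : ExteriorAlgebra ℂ M) : ip b (x - y) z = ip b x z - ip b y z := by
  rw [sub_eq_add_neg, ip_add_left, ip_neg_left, sub_eq_add_neg]

theorem ip_sum_left {J : Type*} (s : Finset J) (x : J → ExteriorAlgebra ℂ M)
    (y : ExteriorAlgebra ℂ M) : ip b (∑ j ∈ s, x j) y = ∑ j ∈ s, ip b (x j) y := by
  classical
  induction s using Finset.induction_on with
  | empty => simp [ip_zero_left]
  | insert a s ha ih => rw [Finset.sum_insert ha, Finset.sum_insert ha, ip_add_left, ih]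

theorem ip_algebraMap_left (c : ℂ) (x : ExteriorAlgebra ℂ M) :
    ip b (algebraMap ℂ _ c) x = starRingEnd ℂ c * scalarPart x := by
  rw [ip, AlgHom.commutes, ConjEnd.toEnd_algebraMap]
  simp

theorem ip_ι_mul_left (m : M) (x y : ExteriorAlgebra ℂ M) :
    ip b (ExteriorAlgebra.ι ℂ m * x) y = ip b x (contr (conjDual b m) y) := by
  rw [ip, map_mul, ConjEnd.toEnd_mul, dagger_ι]
  rfl

theorem conjDual_basis (i : I) : conjDual b (b i) = b.coord i := by
  classical
  simp [conjDual, Finsupp.single_apply]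

theorem ip_wd_left (i : I) (x y : ExteriorAlgebra ℂ M) :
    ip b (wd b i x) y = ip b x (ct b i y) := by
  rw [wd, wedge_apply, ip_ι_mul_left, conjDual_basis, ct]

/-- This is not deduced from `ip_wd_left` by Hermitian symmetry of `ip`, which is never needed. The
anticommutation relation of wedge and contraction moves `ct b i` past each one-form factor of `x`,
and on scalars both sides vanish. -/
theorem ip_ct_left (i : I) (x y : ExteriorAlgebra ℂ M) :
    ip b (ct b i x) y = ip b x (wd b i y) := by
  induction x using ext_left_induction generalizing y with
  | scalar r =>
    rw [ct, contr_algebraMap, ip_zero_left, ip_algebraMap_left, wd, wedge_apply, scalarPart_ι_mul,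
      mul_zero]
  | add x x' hx hx' => rw [map_add, ip_add_left, ip_add_left, hx, hx']
  | ι_mul x m hx =>
    rw [ip_ι_mul_left, ct, contr_ι_mul, ip_sub_left, ip_smul_left, ip_ι_mul_left, ← ct, hx, wd,
      contr_wedge, ip_sub_right, ip_smul_right]
    congr 2
    classical
    simp [conjDual, Finsupp.single_apply]

/-- An element killed by all contractions is a scalar. -/
theorem eq_scalar_of_ct_eq_zero {x : ExteriorAlgebra ℂ M} (hx : ∀ i, ct b i x = 0) :
    x = algebraMap ℂ _ (scalarPart x) := by
  classical
  -- `wd b i * ct b i` projects onto the monomials containing `b i`, and substituting `0` for `b i`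
  -- is the complementary projection. An element killed by all contractions is thus unchanged when
  -- the basis vectors are replaced by `0` one after another, and what survives is the scalar part.
  have h1 : ∀ i, ∀ y : ExteriorAlgebra ℂ M,
      y - ExteriorAlgebra.map (b.constr ℂ (Function.update b i 0)) y = wd b i (ct b i y) := by
    intro i y
    induction y using ext_left_induction with
    | scalar r => simp [ct, contr_algebraMap]
    | add x y hx hy => rw [map_add, map_add, map_add, ← hx, ← hy]; abel
    | ι_mul x m hx =>
      rw [ct, contr_ι_mul, map_sub, map_smul, ← ct, ← wedge_apply m (ct b i x), wd, wedge_comm,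
        ← wd, ← hx, map_mul, ExteriorAlgebra.map_apply_ι]
      have h2 : b.constr ℂ (Function.update b i 0) m = m - b.coord i m • b i := by
        have : b.constr ℂ (Function.update (⇑b) i 0)
            = LinearMap.id - (b.coord i).smulRight (b i) := by
          refine b.ext fun j => ?_
          by_cases h : j = i
          · subst h; simp
          · simp [h]
        rw [this]; simp
      rw [h2, wedge_apply, map_sub, map_smul, wd, wedge_apply, mul_sub, sub_mul, smul_mul_assoc]
      have h3 : ExteriorAlgebra.ι ℂ (b i) * ExteriorAlgebra.map (b.constr ℂ (Function.update b i 0)) x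
          = ExteriorAlgebra.ι ℂ (b i) * x := by
        have h4 := congrArg (wd b i) hx
        rw [wd, wedge_wedge_self, map_sub, sub_eq_zero] at h4
        exact h4.symm
      rw [h3]
      abel
  have h2 : ∀ s : Finset I, ExteriorAlgebra.map
      (b.constr ℂ fun j => if j ∈ s then 0 else b j) x = x := by
    intro s
    induction s using Finset.induction_on with
    | empty =>
      have : (b.constr ℂ fun j => if j ∈ (∅ : Finset I) then 0 else b j) = LinearMap.id :=
        b.ext fun j => by rw [Basis.constr_basis]; simp
      rw [this]; simp
    | insert i s hi ih =>
      have h3 := h1 i x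
      rw [hx, map_zero, sub_eq_zero] at h3
      have h4 : (b.constr ℂ fun j => if j ∈ insert i s then 0 else b j)
          = (b.constr ℂ fun j => if j ∈ s then 0 else b j)
            ∘ₗ (b.constr ℂ (Function.update b i 0)) := by
        refine b.ext fun j => ?_
        rw [LinearMap.comp_apply, Basis.constr_basis, Basis.constr_basis]
        by_cases h : j = i
        · subst h; simp
        · rw [Function.update_of_ne h, Basis.constr_basis]; simp [h]
      rw [h4, ← ExteriorAlgebra.map_comp_map, AlgHom.comp_apply, ← h3, ih]
  have h3 := h2 Finset.univ
  have h4 : (b.constr ℂ fun j => if j ∈ (Finset.univ : Finset I) then 0 else b j)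
      = (0 : M →ₗ[ℂ] M) := b.ext fun j => by simp
  rw [h4] at h3
  have h5 : ∀ y : ExteriorAlgebra ℂ M, ExteriorAlgebra.map (0 : M →ₗ[ℂ] M) y
      = algebraMap ℂ _ (scalarPart y) := by
    intro y
    induction y using ext_left_induction with
    | scalar r => simp
    | add x y hx hy => simp only [map_add, hx, hy]
    | ι_mul x m hx => rw [map_mul, ExteriorAlgebra.map_apply_ι, scalarPart_ι_mul]; simp
  rw [← h5, h3]

/-- The Hermitian form `ip` is positive definite. -/
theorem ip_self_pos (x : ExteriorAlgebra ℂ M) (hx : x ≠ 0) : 0 < (ip b x x).re := by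
  classical
  -- Induction on the set of basis vectors that may occur in `y`. Writing `y = z + b i ∧ u` with `z`
  -- and `u` free of `b i`, the two summands are orthogonal and `ip y y = ip z z + ip u u`.
  have key : ∀ s : Finset I, ∀ y : ExteriorAlgebra ℂ M, (∀ i ∉ s, ct b i y = 0) → y ≠ 0 →
      0 < (ip b y y).re := by
    intro s
    induction s using Finset.induction_on with
    | empty =>
      intro y hy hy0
      have h := eq_scalar_of_ct_eq_zero b fun i => hy i (by simp)
      generalize scalarPart y = c at h
      subst h
      rw [ip_algebraMap_left]
      have hc : c ≠ 0 := fun h => hy0 (by simp [h])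
      simpa [Complex.mul_re, ← Complex.normSq_apply, Complex.normSq_pos] using hc
    | insert i s hi ih =>
      intro y hy hy0
      set u := ct b i y with hu
      have hiu : ct b i u = 0 := contr_contr_self _ _
      set z := y - wd b i u with hz
      have hiz : ct b i z = 0 := by
        rw [hz, map_sub, ct_wd, hiu, if_pos rfl, map_zero, sub_zero, ← hu, sub_self]
      have hyz : y = z + wd b i u := by rw [hz]; abel
      have hsu : ∀ j ∉ s, ct b j u = 0 := by
        intro j hj
        by_cases hji : j = i
        · rw [hji, hiu]
        · rw [hu, ct, ct, contr_comm, ← ct, ← ct, hy j (by simp [hj, hji]), map_zero, neg_zero]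
      have hsz : ∀ j ∉ s, ct b j z = 0 := by
        intro j hj
        by_cases hji : j = i
        · rw [hji, hiz]
        · rw [hz, map_sub, ct_wd, if_neg hji, hsu j hj, hy j (by simp [hj, hji])]
          simp
      have hip : ip b y y = ip b z z + ip b u u := by
        rw [hyz, ip_add_left, ip_add_right, ip_add_right, ip_wd_left, ip_wd_left, hiz, ct_wd, hiu,
          ← ip_ct_left, hiz]
        simp [ip_zero_left, ip_zero_right]
      have nonneg : ∀ w, (∀ j ∉ s, ct b j w = 0) → 0 ≤ (ip b w w).re := by
        intro w hw
        by_cases h0 : w = 0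
        · simp [h0, ip_zero_left]
        · exact (ih w hw h0).le
      rw [hip, Complex.add_re]
      by_cases hu0 : u = 0
      · have hz0 : z ≠ 0 := fun h => hy0 (by rw [hyz, h, hu0]; simp)
        exact add_pos_of_pos_of_nonneg (ih z hsz hz0) (nonneg u hsu)
      · exact add_pos_of_nonneg_of_pos (nonneg z hsz) (ih u hsu hu0)
  exact key Finset.univ x (fun i hi => absurd (Finset.mem_univ i) hi) hx

theorem ip_self_nonneg (x : ExteriorAlgebra ℂ M) : 0 ≤ (ip b x x).re := by
  by_cases h : x = 0
  · simp [h, ip_zero_left]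
  · exact (ip_self_pos b x h).le

end Fock

/-! ### Adjoint operators, number operators and positivity -/

section Fock

open Module

variable {I M : Type*} [AddCommGroup M] [Module ℂ M] [Fintype I] (b : Basis I ℂ M)

theorem eq_zero_of_ip_left_eq_zero {x : ExteriorAlgebra ℂ M} (h : ∀ y, ip b y x = 0) : x = 0 := by
  by_contra hx
  have := ip_self_pos b x hx
  rw [h x] at this
  simp at this

/-- `Q` is the adjoint of `P` with respect to `ip b`. -/
def Adj (P Q : End ℂ (ExteriorAlgebra ℂ M)) : Prop := ∀ x y, ip b (P x) y = ip b x (Q y)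

variable {b}

theorem Adj.mul {P Q P' Q' : End ℂ (ExteriorAlgebra ℂ M)} (h : Adj b P Q) (h' : Adj b P' Q') :
    Adj b (P * P') (Q' * Q) := fun x y => by
  rw [End.mul_apply, End.mul_apply, h, h']

theorem Adj.int_smul {P Q : End ℂ (ExteriorAlgebra ℂ M)} (h : Adj b P Q) (n : ℤ) :
    Adj b ((n : ℂ) • P) ((n : ℂ) • Q) := fun x y => by
  rw [LinearMap.smul_apply, LinearMap.smul_apply, ip_smul_left, ip_smul_right, h]
  simp

theorem Adj.sum {J : Type*} {s : Finset J} {P Q : J → End ℂ (ExteriorAlgebra ℂ M)}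
    (h : ∀ j ∈ s, Adj b (P j) (Q j)) : Adj b (∑ j ∈ s, P j) (∑ j ∈ s, Q j) := fun x y => by
  rw [LinearMap.sum_apply, LinearMap.sum_apply, ip_sum_left, ip_sum_right]
  exact Finset.sum_congr rfl fun j hj => h j hj x y

theorem Adj.sub {P Q P' Q' : End ℂ (ExteriorAlgebra ℂ M)} (h : Adj b P Q) (h' : Adj b P' Q') :
    Adj b (P - P') (Q - Q') := fun x y => by
  rw [LinearMap.sub_apply, LinearMap.sub_apply, ip_sub_left, ip_sub_right, h, h']

variable (b)

theorem adj_wd (i : I) : Adj b (wd b i) (ct b i) := ip_wd_left b i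

theorem adj_ct (i : I) : Adj b (ct b i) (wd b i) := ip_ct_left b i

/-- If `G` commutes with `Z` and `-Z` is the adjoint of `Z`, then the adjoint of `G` preserves the
kernel of `Z`. -/
theorem Adj.map_ker {G G' Z Z' : End ℂ (ExteriorAlgebra ℂ M)} (hG : Adj b G G') (hZ : Adj b Z' Z)
    (hZ' : Z' = -Z) (h : Z * G = G * Z) {x : ExteriorAlgebra ℂ M} (hx : Z x = 0) :
    Z (G' x) = 0 := by
  refine eq_zero_of_ip_left_eq_zero b fun y => ?_
  have h1 : G (Z' y) = Z' (G y) := by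
    rw [hZ']
    simpa using (congrArg (fun P => P y) h).symm
  rw [← hZ, ← hG, h1, hZ, hx, ip_zero_right]

theorem ct_mul_wd [DecidableEq I] (i j : I) :
    ct b i * wd b j = (if i = j then 1 else 0) - wd b j * ct b i := by
  refine LinearMap.ext fun x => ?_
  rw [End.mul_apply, ct_wd]
  split_ifs <;> simp

/-- `wd b i * ct b j` is the derivation that sends `b j` to `b i` and kills the other basis vectors.
-/
theorem wd_mul_ct_mul_wd [DecidableEq I] (i j k : I) :
    wd b i * ct b j * wd b k = wd b k * (wd b i * ct b j) + if j = k then wd b i else 0 := by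
  refine LinearMap.ext fun x => ?_
  have h : wd b i (wd b k (ct b j x)) = -wd b k (wd b i (ct b j x)) := wedge_comm _ _ _
  rw [End.mul_apply, End.mul_apply, ct_wd, map_sub, h, LinearMap.add_apply]
  split_ifs <;> simp [add_comm]

/-- The number operator with weights `w`. -/
def num (w : I → ℂ) : End ℂ (ExteriorAlgebra ℂ M) := ∑ i, w i • (wd b i * ct b i)

theorem num_apply (w : I → ℂ) (x : ExteriorAlgebra ℂ M) :
    num b w x = ∑ i, w i • wd b i (ct b i x) := by
  simp [num]

theorem num_one (w : I → ℂ) : num b w 1 = 0 := by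
  simp [num_apply, ct, contr_one]

theorem num_ι_mul (w : I → ℂ) (m : M) (x : ExteriorAlgebra ℂ M) :
    num b w (ExteriorAlgebra.ι ℂ m * x)
      = ExteriorAlgebra.ι ℂ m * num b w x
        + ExteriorAlgebra.ι ℂ (∑ i, (w i * b.repr m i) • b i) * x := by
  rw [num_apply, num_apply, Finset.mul_sum, map_sum, Finset.sum_mul, ← Finset.sum_add_distrib]
  refine Finset.sum_congr rfl fun i _ => ?_
  rw [ct, contr_ι_mul, map_sub, map_smul, ← wedge_apply m, wd, wedge_comm, ← wedge_apply m,
    map_smul, smul_sub, smul_neg, sub_neg_eq_add, add_comm, map_smul]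
  congr 1
  rw [smul_mul_assoc, mul_smul, ← wedge_apply, Basis.coord_apply]

theorem num_wd (w : I → ℂ) (j : I) (x : ExteriorAlgebra ℂ M) :
    num b w (wd b j x) = wd b j (num b w x) + w j • wd b j x := by
  classical
  rw [wd, wedge_apply, num_ι_mul, wedge_apply]
  congr 1
  simp [Finsupp.single_apply]

theorem num_ct (w : I → ℂ) (j : I) (x : ExteriorAlgebra ℂ M) :
    num b w (ct b j x) = ct b j (num b w x) - w j • ct b j x := by
  classical
  have h : ∀ i, ct b j (wd b i (ct b i x)) = (if j = i then ct b j x else 0)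
      + wd b i (ct b i (ct b j x)) := by
    intro i
    rw [ct_wd, ct, ct, contr_comm, map_neg, sub_neg_eq_add]
    congr 1
    split_ifs with h
    · rw [h]
    · rfl
  rw [num_apply, num_apply, map_sum, eq_sub_iff_add_eq]
  simp only [map_smul, h, smul_add, Finset.sum_add_distrib]
  rw [add_comm]
  simp

/-- The degree operator is `∑ ct* ct`. Hence it has no negative eigenvalue, and its kernel is killed
by every contraction. -/
theorem ip_num_one (x : ExteriorAlgebra ℂ M) :
    0 ≤ (ip b x (num b 1 x)).re := by
  rw [num_apply, ip_sum_right, Complex.re_sum]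
  refine Finset.sum_nonneg fun i _ => ?_
  rw [Pi.one_apply, one_smul, ← ip_ct_left]
  exact ip_self_nonneg b _

theorem eq_zero_of_num_neg {x : ExteriorAlgebra ℂ M} {d : ℤ} (hd : d < 0)
    (hx : num b 1 x = (d : ℂ) • x) : x = 0 := by
  by_contra h0
  have h1 := ip_num_one b x
  rw [hx, ip_smul_right] at h1
  have h2 := ip_self_pos b x h0
  have h3 : (((d : ℂ)) * ip b x x).re = d * (ip b x x).re := by simp
  rw [h3] at h1
  have h4 : (d : ℝ) < 0 := by exact_mod_cast hd
  nlinarith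

theorem ct_eq_zero_of_num_eq_zero {x : ExteriorAlgebra ℂ M} (hx : num b 1 x = 0) (i : I) :
    ct b i x = 0 := by
  by_contra h0
  -- The left side is zero by `hx`, so every term of this sum of nonnegative numbers has to vanish.
  have h1 : (ip b x (num b 1 x)).re = ∑ i, (ip b (ct b i x) (ct b i x)).re := by
    rw [num_apply, ip_sum_right, Complex.re_sum]
    refine Finset.sum_congr rfl fun i _ => ?_
    rw [Pi.one_apply, one_smul, ← ip_ct_left]
  rw [hx, ip_zero_right] at h1
  have h2 : (ip b (ct b i x) (ct b i x)).re ≤ ∑ i, (ip b (ct b i x) (ct b i x)).re :=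
    Finset.single_le_sum (f := fun i => (ip b (ct b i x) (ct b i x)).re)
      (fun i _ => ip_self_nonneg b _) (Finset.mem_univ i)
  have h3 := ip_self_pos b _ h0
  simp only [Complex.zero_re] at h1
  linarith

/-- A form of degree `r` all of whose `r`-fold contractions with basis vectors vanish is zero. -/
theorem eq_zero_of_contractions (r : ℕ) {x : ExteriorAlgebra ℂ M} (hx : num b 1 x = (r : ℂ) • x)
    (h : ∀ l : List I, l.length = r → scalarPart ((l.map (ct b)).prod x) = 0) : x = 0 := by
  induction r generalizing x with
  | zero =>
    have h1 := ct_eq_zero_of_num_eq_zero b (x := x) (by simpa using hx)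
    rw [eq_scalar_of_ct_eq_zero b h1]
    have := h [] rfl
    simp only [List.map_nil, List.prod_nil, End.one_apply] at this
    rw [this, map_zero]
  | succ r ih =>
    have h1 : ∀ i, ct b i x = 0 := by
      intro i
      refine ih ?_ fun l hl => ?_
      · rw [num_ct, hx, map_smul, Pi.one_apply, ← sub_smul]
        congr 1
        push_cast; ring
      · have := h (l ++ [i]) (by simp [hl])
        simpa using this
    have h2 : num b 1 x = 0 := by simp [num_apply, h1]
    rw [h2] at hx
    have h3 : ((r + 1 : ℕ) : ℂ) ≠ 0 := by exact_mod_cast Nat.succ_ne_zero r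
    exact (smul_eq_zero.mp hx.symm).resolve_left h3

end Fock

/-! ### The multiplication table of the quaternions -/

/-- The index of the product of two standard basis quaternions. -/
def quatIdx (a b : Fin 4) : Fin 4 :=
  ![![0, 1, 2, 3], ![1, 0, 3, 2], ![2, 3, 0, 1], ![3, 2, 1, 0]] a b

/-- The sign of the product of two standard basis quaternions. -/
def quatSgn (a b : Fin 4) : ℤ :=
  ![![1, 1, 1, 1], ![1, -1, 1, -1], ![1, -1, -1, 1], ![1, 1, -1, -1]] a b

/-- The coefficient of `e_c` in `e_a * e_b`, for the standard basis `e` of the quaternions. -/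
def quatCoef (a c b : Fin 4) : ℤ := if c = quatIdx a b then quatSgn a b else 0

-- `quatCoef h c d` is `Re (ē_c e_h e_d)`. Both sides equal `Re (e_d ē_c e_c' ē_d')`, expanded over
-- an orthonormal basis in two ways: as the inner product of `e_c ē_d` with `e_c' ē_d'`, and as that
-- of `ē_c e_c'` with `ē_d e_d'`. This exchange turns products of derivations into products `Θ Δ`.
set_option maxRecDepth 100000 in
theorem sum_quatCoef_mul (c d c' d' : Fin 4) :
    ∑ h, quatCoef h c d * quatCoef h c' d' = ∑ q, quatCoef c c' q * quatCoef d d' q := by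
  revert c d c' d'; decide

-- The sum is the coefficient of `e_c'` in `(∑ e_h²) e_d`, and `∑ e_h² = 1 - 3 = -2`.
set_option maxRecDepth 100000 in
theorem sum_quatCoef_sq (d c' : Fin 4) :
    ∑ h, ∑ c, quatCoef h c d * quatCoef h c' c = if d = c' then -2 else 0 := by
  revert d c'; decide

-- Associativity: both sides are the coefficient of `e_d'` in `e_h e_e e_q`. The variant
-- `quatCoef_assoc_adj` is the same statement for `ē_h e_e e_q`.
set_option maxRecDepth 100000 in
theorem quatCoef_assoc (h e q d' : Fin 4) :
    ∑ d, quatCoef d d' q * quatCoef h d e = ∑ f, quatCoef e f q * quatCoef h d' f := by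
  revert h e q d'; decide

set_option maxRecDepth 100000 in
theorem quatCoef_assoc_adj (h e q d' : Fin 4) :
    ∑ d, quatCoef d d' q * quatCoef h e d = ∑ f, quatCoef e f q * quatCoef h f d' := by
  revert h e q d'; decide

/-! ### The Lie algebra of the symplectic group and its Casimir identity -/

section FirstFundamentalTheorem

open Module

/-- The indices of the real coordinates of pairs of vectors in `ℍ^n`. -/
abbrev CoordIdx (n : ℕ) : Type := Fin n × Fin 4 × Fin 2

/-- Fubini for nine finite sums. With `sum_reorder'` it brings the two quartic expressions in
`sum_lop_sq` to a common order of summation, with the index to be exchanged innermost. -/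
theorem sum_reorder {A₁ A₂ A₃ A₄ A₅ A₆ A₇ A₈ A₉ E : Type*} [Fintype A₁] [Fintype A₂] [Fintype A₃]
    [Fintype A₄] [Fintype A₅] [Fintype A₆] [Fintype A₇] [Fintype A₈] [Fintype A₉]
    [AddCommMonoid E] (f : A₁ → A₂ → A₃ → A₄ → A₅ → A₆ → A₇ → A₈ → A₉ → E) :
    ∑ a₁, ∑ a₂, ∑ a₃, ∑ a₄, ∑ a₅, ∑ a₆, ∑ a₇, ∑ a₈, ∑ a₉, f a₁ a₂ a₃ a₄ a₅ a₆ a₇ a₈ a₉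
      = ∑ a₂, ∑ a₃, ∑ a₆, ∑ a₉, ∑ a₄, ∑ a₅, ∑ a₇, ∑ a₈, ∑ a₁, f a₁ a₂ a₃ a₄ a₅ a₆ a₇ a₈ a₉ := by
  calc _ = ∑ x : A₁ × A₂ × A₃ × A₄ × A₅ × A₆ × A₇ × A₈ × A₉, f x.1 x.2.1 x.2.2.1 x.2.2.2.1
        x.2.2.2.2.1 x.2.2.2.2.2.1 x.2.2.2.2.2.2.1 x.2.2.2.2.2.2.2.1 x.2.2.2.2.2.2.2.2 := by
        simp only [Fintype.sum_prod_type]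
    _ = ∑ x : A₂ × A₃ × A₆ × A₉ × A₄ × A₅ × A₇ × A₈ × A₁, f x.2.2.2.2.2.2.2.2 x.1 x.2.1
        x.2.2.2.2.1 x.2.2.2.2.2.1 x.2.2.1 x.2.2.2.2.2.2.1 x.2.2.2.2.2.2.2.1 x.2.2.2.1 :=
        Fintype.sum_equiv
          ⟨fun x => (x.2.1, x.2.2.1, x.2.2.2.2.2.1, x.2.2.2.2.2.2.2.2, x.2.2.2.1, x.2.2.2.2.1,
            x.2.2.2.2.2.2.1, x.2.2.2.2.2.2.2.1, x.1),
           fun x => (x.2.2.2.2.2.2.2.2, x.1, x.2.1, x.2.2.2.2.1, x.2.2.2.2.2.1, x.2.2.1,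
            x.2.2.2.2.2.2.1, x.2.2.2.2.2.2.2.1, x.2.2.2.1), fun _ => rfl, fun _ => rfl⟩
          _ _ fun _ => rfl
    _ = _ := by simp only [Fintype.sum_prod_type]

theorem sum_reorder' {A₁ A₂ A₃ A₄ A₅ A₆ A₇ A₈ A₉ E : Type*} [Fintype A₁] [Fintype A₂] [Fintype A₃]
    [Fintype A₄] [Fintype A₅] [Fintype A₆] [Fintype A₇] [Fintype A₈] [Fintype A₉]
    [AddCommMonoid E] (f : A₁ → A₂ → A₃ → A₄ → A₅ → A₆ → A₇ → A₈ → A₉ → E) :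
    ∑ a₁, ∑ a₂, ∑ a₃, ∑ a₄, ∑ a₅, ∑ a₆, ∑ a₇, ∑ a₈, ∑ a₉, f a₁ a₂ a₃ a₄ a₅ a₆ a₇ a₈ a₉
      = ∑ a₄, ∑ a₇, ∑ a₃, ∑ a₂, ∑ a₆, ∑ a₉, ∑ a₅, ∑ a₈, ∑ a₁, f a₁ a₂ a₃ a₄ a₅ a₆ a₇ a₈ a₉ := by
  calc _ = ∑ x : A₁ × A₂ × A₃ × A₄ × A₅ × A₆ × A₇ × A₈ × A₉, f x.1 x.2.1 x.2.2.1 x.2.2.2.1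
        x.2.2.2.2.1 x.2.2.2.2.2.1 x.2.2.2.2.2.2.1 x.2.2.2.2.2.2.2.1 x.2.2.2.2.2.2.2.2 := by
        simp only [Fintype.sum_prod_type]
    _ = ∑ x : A₄ × A₇ × A₃ × A₂ × A₆ × A₉ × A₅ × A₈ × A₁, f x.2.2.2.2.2.2.2.2 x.2.2.2.1 x.2.2.1
        x.1 x.2.2.2.2.2.2.1 x.2.2.2.2.1 x.2.1 x.2.2.2.2.2.2.2.1 x.2.2.2.2.2.1 :=
        Fintype.sum_equiv
          ⟨fun x => (x.2.2.2.1, x.2.2.2.2.2.2.1, x.2.2.1, x.2.1, x.2.2.2.2.2.1, x.2.2.2.2.2.2.2.2,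
            x.2.2.2.2.1, x.2.2.2.2.2.2.2.1, x.1),
           fun x => (x.2.2.2.2.2.2.2.2, x.2.2.2.1, x.2.2.1, x.1, x.2.2.2.2.2.2.1, x.2.2.2.2.1,
            x.2.1, x.2.2.2.2.2.2.2.1, x.2.2.2.2.2.1), fun _ => rfl, fun _ => rfl⟩
          _ _ fun _ => rfl
    _ = _ := by simp only [Fintype.sum_prod_type]

variable {M : Type*} [AddCommGroup M] [Module ℂ M]

variable {n : ℕ} (b : Basis (CoordIdx n) ℂ M)

/-- The derivation of the exterior algebra induced by the matrix with entry `e_h` in the place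
`(s, s')`. -/
def lop (h : Fin 4) (s s' : Fin n) : End ℂ (ExteriorAlgebra ℂ M) :=
  ∑ c, ∑ d, ∑ t, (quatCoef h c d : ℂ) • (wd b (s', d, t) * ct b (s, c, t))

/-- The adjoint of `lop b h s s'`. -/
def lopAdj (h : Fin 4) (s s' : Fin n) : End ℂ (ExteriorAlgebra ℂ M) :=
  ∑ c, ∑ d, ∑ t, (quatCoef h c d : ℂ) • (wd b (s, c, t) * ct b (s', d, t))

theorem adj_lop (h : Fin 4) (s s' : Fin n) : Adj b (lop b h s s') (lopAdj b h s s') :=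
  Adj.sum fun _ _ => Adj.sum fun _ _ => Adj.sum fun _ _ =>
    ((adj_wd b _).mul (adj_ct b _)).int_smul _

theorem adj_lopAdj (h : Fin 4) (s s' : Fin n) : Adj b (lopAdj b h s s') (lop b h s s') :=
  Adj.sum fun _ _ => Adj.sum fun _ _ => Adj.sum fun _ _ =>
    ((adj_wd b _).mul (adj_ct b _)).int_smul _

/-- Multiplication by the two-form attached to `e_q`. -/
def thetaAt (q : Fin 4) (t t' : Fin 2) (s : Fin n) : End ℂ (ExteriorAlgebra ℂ M) :=
  ∑ d, ∑ d', (quatCoef d d' q : ℂ) • (wd b (s, d, t) * wd b (s, d', t'))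

/-- The adjoint of `thetaAt`. -/
def deltaAt (q : Fin 4) (t t' : Fin 2) (s : Fin n) : End ℂ (ExteriorAlgebra ℂ M) :=
  ∑ c, ∑ c', (quatCoef c c' q : ℂ) • (ct b (s, c, t) * ct b (s, c', t'))

theorem lop_mul_wd (h : Fin 4) (s s' σ : Fin n) (e : Fin 4) (t : Fin 2) :
    lop b h s s' * wd b (σ, e, t) = wd b (σ, e, t) * lop b h s s'
      + if s = σ then ∑ d, (quatCoef h e d : ℂ) • wd b (s', d, t) else 0 := by
  have h1 : ∀ (c d : Fin 4) (u : Fin 2), wd b (s', d, u) * ct b (s, c, u) * wd b (σ, e, t)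
      = wd b (σ, e, t) * (wd b (s', d, u) * ct b (s, c, u))
        + if s = σ ∧ c = e ∧ u = t then wd b (s', d, u) else 0 := by
    intro c d u
    rw [wd_mul_ct_mul_wd]
    simp only [Prod.mk.injEq]
  simp only [lop, Finset.sum_mul, Finset.mul_sum, smul_mul_assoc, mul_smul_comm, h1, smul_add,
    Finset.sum_add_distrib]
  congr 1
  by_cases hs : s = σ
  · simp only [hs, true_and, if_true]
    rw [Finset.sum_eq_single e]
    · refine Finset.sum_congr rfl fun d _ => ?_
      simp
    · intro c _ hc; simp [hc]
    · simp
  · simp [hs]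

theorem lopAdj_mul_wd (h : Fin 4) (s s' σ : Fin n) (e : Fin 4) (t : Fin 2) :
    lopAdj b h s s' * wd b (σ, e, t) = wd b (σ, e, t) * lopAdj b h s s'
      + if s' = σ then ∑ c, (quatCoef h c e : ℂ) • wd b (s, c, t) else 0 := by
  have h1 : ∀ (c d : Fin 4) (u : Fin 2), wd b (s, c, u) * ct b (s', d, u) * wd b (σ, e, t)
      = wd b (σ, e, t) * (wd b (s, c, u) * ct b (s', d, u))
        + if s' = σ ∧ d = e ∧ u = t then wd b (s, c, u) else 0 := by
    intro c d u
    rw [wd_mul_ct_mul_wd]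
    simp only [Prod.mk.injEq]
  simp only [lopAdj, Finset.sum_mul, Finset.mul_sum, smul_mul_assoc, mul_smul_comm, h1, smul_add,
    Finset.sum_add_distrib]
  congr 1
  by_cases hs : s' = σ
  · simp only [hs, true_and, if_true]
    refine Finset.sum_congr rfl fun c _ => ?_
    rw [Finset.sum_eq_single e]
    · simp
    · intro c _ hc; simp [hc]
    · simp
  · simp [hs]

/-- The skew-adjoint derivation attached to an element of the Lie algebra of `Sp(n)`. -/
def zop (h : Fin 4) (s s' : Fin n) : End ℂ (ExteriorAlgebra ℂ M) := lop b h s s' - lopAdj b h s s'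

theorem zop_mul_wd (h : Fin 4) (s s' σ : Fin n) (e : Fin 4) (t : Fin 2) :
    zop b h s s' * wd b (σ, e, t) = wd b (σ, e, t) * zop b h s s'
      + ((if s = σ then ∑ d, (quatCoef h e d : ℂ) • wd b (s', d, t) else 0)
        - if s' = σ then ∑ c, (quatCoef h c e : ℂ) • wd b (s, c, t) else 0) := by
  rw [zop, sub_mul, lop_mul_wd, lopAdj_mul_wd, mul_sub]
  abel

/-- The two-form pairs a vector with its right multiple by `e_q`, and right multiplication commutes
with matrices acting from the left. Concretely, `lop` acting on the first factor cancels against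
`lopAdj` acting on the second by `quatCoef_assoc`, and the other two terms cancel by
`quatCoef_assoc_adj`. -/
theorem zop_mul_theta (S : Finset (Fin n)) (h q : Fin 4) (t t' : Fin 2) {s s' : Fin n}
    (hs : s ∈ S) (hs' : s' ∈ S) :
    zop b h s s' * (∑ σ ∈ S, thetaAt b q t t' σ) = (∑ σ ∈ S, thetaAt b q t t' σ) * zop b h s s' := by
  have h1 : ∀ (σ : Fin n) (d d' : Fin 4),
      zop b h s s' * (wd b (σ, d, t) * wd b (σ, d', t'))
        = wd b (σ, d, t) * wd b (σ, d', t') * zop b h s s'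
          + ((if s = σ then ∑ e, (quatCoef h d e : ℂ) • (wd b (s', e, t) * wd b (σ, d', t')) else 0)
          - (if s' = σ then ∑ e, (quatCoef h e d : ℂ) • (wd b (s, e, t) * wd b (σ, d', t')) else 0)
          + ((if s = σ then ∑ e, (quatCoef h d' e : ℂ) • (wd b (σ, d, t) * wd b (s', e, t')) else 0)
          - (if s' = σ then ∑ e, (quatCoef h e d' : ℂ) • (wd b (σ, d, t) * wd b (s, e, t'))
              else 0))) := by
    intro σ d d'
    rw [← mul_assoc, zop_mul_wd, add_mul, mul_assoc, zop_mul_wd, mul_add, sub_mul, mul_sub,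
      ← mul_assoc]
    split_ifs <;> simp only [Finset.sum_mul, Finset.mul_sum, smul_mul_assoc, mul_smul_comm, mul_zero,
      zero_mul] <;> abel
  simp only [thetaAt, Finset.mul_sum, Finset.sum_mul, mul_smul_comm, smul_mul_assoc, h1, smul_add,
    smul_sub, Finset.sum_add_distrib, Finset.sum_sub_distrib]
  rw [add_eq_left]
  have e1 : ∀ f : Fin n → Fin 4 → Fin 4 → Fin 4 → End ℂ (ExteriorAlgebra ℂ M), ∀ r ∈ S,
      ∑ σ ∈ S, ∑ d, ∑ d', (quatCoef d d' q : ℂ) • (if r = σ then ∑ e, f σ d d' e else 0)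
        = ∑ d, ∑ d', (quatCoef d d' q : ℂ) • ∑ e, f r d d' e := by
    intro f r hr
    rw [Finset.sum_eq_single r]
    · simp
    · intro σ _ hσ; simp [Ne.symm hσ]
    · exact fun h => absurd hr h
  rw [e1 (fun σ d d' e => (quatCoef h d e : ℂ) • (wd b (s', e, t) * wd b (σ, d', t'))) s hs,
    e1 (fun σ d d' e => (quatCoef h e d : ℂ) • (wd b (s, e, t) * wd b (σ, d', t'))) s' hs',
    e1 (fun σ d d' e => (quatCoef h d' e : ℂ) • (wd b (σ, d, t) * wd b (s', e, t'))) s hs,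
    e1 (fun σ d d' e => (quatCoef h e d' : ℂ) • (wd b (σ, d, t) * wd b (s, e, t'))) s' hs']
  have e2 : ∀ (x y : Fin 4 → Fin 4 → ℂ) (s s' : Fin n),
      (∀ e d', ∑ d, (quatCoef d d' q : ℂ) * x d e = ∑ f, (quatCoef e f q : ℂ) * y d' f) →
      ∑ d, ∑ d', (quatCoef d d' q : ℂ) • ∑ e, x d e • (wd b (s', e, t) * wd b (s, d', t'))
      = ∑ d, ∑ d', (quatCoef d d' q : ℂ) • ∑ e, y e d' •
        (wd b (s', d, t) * wd b (s, e, t')) := by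
    intro x y s s' hxy
    simp only [Finset.smul_sum, smul_smul]
    have : ∀ e d', ∑ d, ((quatCoef d d' q : ℂ) * x d e) • (wd b (s', e, t) * wd b (s, d', t'))
        = ∑ f, ((quatCoef e f q : ℂ) * y d' f) • (wd b (s', e, t) * wd b (s, d', t')) := by
      intro e d'
      rw [← Finset.sum_smul, ← Finset.sum_smul, hxy]
    calc _ = ∑ e, ∑ d', ∑ d, ((quatCoef d d' q : ℂ) * x d e) •
          (wd b (s', e, t) * wd b (s, d', t')) := by
          rw [Finset.sum_comm]
          conv_lhs => enter [2, d']; rw [Finset.sum_comm]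
          rw [Finset.sum_comm]
      _ = ∑ e, ∑ d', ∑ f, ((quatCoef e f q : ℂ) * y d' f) •
          (wd b (s', e, t) * wd b (s, d', t')) := by simp only [this]
      _ = _ := Finset.sum_congr rfl fun e _ => Finset.sum_comm
  rw [e2 (fun d e => quatCoef h d e) (fun d e => quatCoef h d e) s s'
      fun e d' => by exact_mod_cast quatCoef_assoc h e q d',
    e2 (fun d e => quatCoef h e d) (fun d e => quatCoef h e d) s' s
      fun e d' => by exact_mod_cast quatCoef_assoc_adj h e q d']
  abel

/-- The Casimir identity. -/
theorem sum_lop_sq (S : Finset (Fin n)) :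
    ∑ h, ∑ s ∈ S, ∑ s' ∈ S, lop b h s s' * lop b h s s'
      = -(2 : ℂ) • ∑ s ∈ S, ∑ c, ∑ t, wd b (s, c, t) * ct b (s, c, t)
        - ∑ q, ∑ t, ∑ t', (∑ s ∈ S, thetaAt b q t t' s) * ∑ s ∈ S, deltaAt b q t t' s := by
  simp only [← Finset.sum_coe_sort S]
  -- Normal ordering: moving the inner annihilator past the inner creator leaves a contracted term,
  -- which is nonzero only for `s = s'` and yields the number operator, and a quartic term, which
  -- yields `Θ Δ`.
  have h1 : ∀ (s s' : S) (c d c' d' : Fin 4) (t t' : Fin 2),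
      wd b (s'.1, d, t) * ct b (s.1, c, t) * (wd b (s'.1, d', t') * ct b (s.1, c', t'))
        = (if s = s' ∧ c = d' ∧ t = t' then wd b (s'.1, d, t) * ct b (s.1, c', t') else 0)
          - wd b (s'.1, d, t) * wd b (s'.1, d', t') * (ct b (s.1, c, t) * ct b (s.1, c', t')) := by
    intro s s' c d c' d' t t'
    have : ∀ A B C D : End ℂ (ExteriorAlgebra ℂ M), A * B * (C * D) = A * (B * C) * D := by
      intros; simp only [mul_assoc]
    rw [this, ct_mul_wd, mul_sub, sub_mul]
    simp only [Prod.mk.injEq, Subtype.ext_iff, mul_assoc]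
    split_ifs <;> simp
  simp only [lop, thetaAt, deltaAt, Finset.sum_mul, Finset.mul_sum, smul_mul_assoc, mul_smul_comm,
    h1, smul_sub, Finset.sum_sub_distrib]
  simp only [Finset.smul_sum, smul_smul]
  congr 1
  -- The contracted terms. Summing the coefficients over `h` and the contracted index gives `∑ e_h²
  -- = -2` on the diagonal and zero elsewhere.
  · have h2 : ∀ (c' d : Fin 4), ∑ h, ∑ d', (quatCoef h c' d' : ℂ) * quatCoef h d' d
        = if c' = d then -2 else 0 := by
      intro c' d
      have := sum_quatCoef_sq d c'
      rw [Finset.sum_congr rfl fun h _ => Finset.sum_congr rfl fun c _ => mul_comm _ _] at this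
      simp only [eq_comm (a := d)] at this
      exact_mod_cast this
    have h3 : ∀ (h : Fin 4) (s : S) (c' d' : Fin 4) (t' : Fin 2),
        ∑ s' : S, ∑ c, ∑ d, ∑ t, ((quatCoef h c' d' : ℂ) * quatCoef h c d) •
          (if s = s' ∧ c = d' ∧ t = t' then wd b (s'.1, d, t) * ct b (s.1, c', t') else 0)
        = ∑ d, ((quatCoef h c' d' : ℂ) * quatCoef h d' d) •
          (wd b (s.1, d, t') * ct b (s.1, c', t')) := by
      intro h s c' d' t'
      rw [Finset.sum_eq_single s (fun s' _ hs => by simp [Ne.symm hs]) (by simp),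
        Finset.sum_eq_single d' (fun c _ hc => by simp [hc]) (by simp)]
      refine Finset.sum_congr rfl fun d _ => ?_
      rw [Finset.sum_eq_single t' (fun t _ ht => by simp [ht]) (by simp)]
      simp
    calc _ = ∑ h, ∑ s : S, ∑ c', ∑ d', ∑ t', ∑ d, ((quatCoef h c' d' : ℂ) * quatCoef h d' d) •
          (wd b (s.1, d, t') * ct b (s.1, c', t')) := by
          refine Finset.sum_congr rfl fun h _ => Finset.sum_congr rfl fun s _ => ?_
          rw [Finset.sum_comm]
          refine Finset.sum_congr rfl fun c' _ => ?_
          rw [Finset.sum_comm]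
          refine Finset.sum_congr rfl fun d' _ => ?_
          rw [Finset.sum_comm]
          refine Finset.sum_congr rfl fun t' _ => ?_
          rw [← h3]
      _ = ∑ s : S, ∑ c', ∑ t', ∑ d, (∑ h, ∑ d', (quatCoef h c' d' : ℂ) * quatCoef h d' d) •
          (wd b (s.1, d, t') * ct b (s.1, c', t')) := by
          simp only [Finset.sum_smul]
          rw [Finset.sum_comm]
          refine Finset.sum_congr rfl fun s _ => ?_
          rw [Finset.sum_comm]
          refine Finset.sum_congr rfl fun c' _ => ?_
          calc _ = ∑ h, ∑ t', ∑ d', ∑ d, ((quatCoef h c' d' : ℂ) * quatCoef h d' d) •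
                (wd b (s.1, d, t') * ct b (s.1, c', t')) :=
                Finset.sum_congr rfl fun h _ => Finset.sum_comm
            _ = _ := by
                rw [Finset.sum_comm]
                refine Finset.sum_congr rfl fun t' _ => ?_
                rw [Finset.sum_comm (s := Finset.univ (α := Fin 4)) (t := Finset.univ (α := Fin 4))
                  (f := fun d h => ∑ d', ((quatCoef h c' d' : ℂ) * quatCoef h d' d) •
                (wd b (s.1, d, t') * ct b (s.1, c', t')))]
                exact Finset.sum_congr rfl fun h _ => Finset.sum_comm
      _ = _ := by
          simp only [h2]
          refine Finset.sum_congr rfl fun s _ => Finset.sum_congr rfl fun c' _ =>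
            Finset.sum_congr rfl fun t' _ => ?_
          rw [Finset.sum_eq_single c' (fun d _ hd => by simp [Ne.symm hd]) (by simp), if_pos rfl]
  -- The quartic terms. The sum over `h` couples each creator to an annihilator; after the exchange
  -- the sum over `q` couples the two creators to each other and the two annihilators to each other.
  · have h2 : ∀ (c' d' c d : Fin 4), ∑ h, (quatCoef h c' d' : ℂ) * quatCoef h c d
        = ∑ q, (quatCoef c c' q : ℂ) * quatCoef d d' q := by
      intro c' d' c d
      have := sum_quatCoef_mul c d c' d'
      rw [Finset.sum_congr rfl fun h _ => mul_comm _ _] at this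
      exact_mod_cast this
    refine (sum_reorder _).trans (Eq.trans ?_ (sum_reorder' _).symm)
    simp only [← Finset.sum_smul, h2]

end FirstFundamentalTheorem

/-! ### The first fundamental theorem in the exterior algebra -/

section FirstFundamentalTheorem

open Module

variable {M : Type*} [AddCommGroup M] [Module ℂ M] {n : ℕ} (b : Basis (CoordIdx n) ℂ M)

/-- The forms of bidegree `d`, as an eigenspace of number operators. -/
def eigBideg (d : Fin 2 → ℤ) : Submodule ℂ (ExteriorAlgebra ℂ M) where
  carrier := {x | ∀ t, num b (fun i => if i.2.2 = t then 1 else 0) x = (d t : ℂ) • x}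
  add_mem' hx hy t := by rw [map_add, hx t, hy t, smul_add]
  zero_mem' t := by simp
  smul_mem' c x hx t := by rw [map_smul, hx t, smul_comm]

theorem wd_mem_eigBideg {d : Fin 2 → ℤ} {x : ExteriorAlgebra ℂ M} (hx : x ∈ eigBideg b d)
    (i : CoordIdx n) : wd b i x ∈ eigBideg b (d + Pi.single i.2.2 1) := fun t => by
  rw [num_wd, hx t, map_smul, ← add_smul]
  congr 1
  by_cases h : i.2.2 = t
  · subst h; simp
  · simp [h, Ne.symm h]

theorem ct_mem_eigBideg {d : Fin 2 → ℤ} {x : ExteriorAlgebra ℂ M} (hx : x ∈ eigBideg b d)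
    (i : CoordIdx n) : ct b i x ∈ eigBideg b (d - Pi.single i.2.2 1) := fun t => by
  rw [num_ct, hx t, map_smul, ← sub_smul]
  congr 1
  by_cases h : i.2.2 = t
  · subst h; simp
  · simp [h, Ne.symm h]

theorem num_one_of_mem_eigBideg {d : Fin 2 → ℤ} {x : ExteriorAlgebra ℂ M}
    (hx : x ∈ eigBideg b d) : num b 1 x = ((d 0 + d 1 : ℤ) : ℂ) • x := by
  have h : num b 1 = num b (fun i => if i.2.2 = 0 then 1 else 0)
      + num b (fun i => if i.2.2 = 1 then 1 else 0) := by
    simp only [num, ← Finset.sum_add_distrib, ← add_smul]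
    refine Finset.sum_congr rfl fun i _ => ?_
    obtain ⟨s, c, t⟩ := i
    fin_cases t <;> simp
  rw [h, LinearMap.add_apply, hx 0, hx 1, ← add_smul]
  push_cast; rfl

theorem thetaAt_mem_eigBideg {d : Fin 2 → ℤ} {x : ExteriorAlgebra ℂ M} (hx : x ∈ eigBideg b d)
    (q : Fin 4) (t t' : Fin 2) (s : Fin n) :
    thetaAt b q t t' s x ∈ eigBideg b (d + Pi.single t 1 + Pi.single t' 1) := by
  simp only [thetaAt, LinearMap.sum_apply, LinearMap.smul_apply, End.mul_apply]
  refine Submodule.sum_mem _ fun c _ => Submodule.sum_mem _ fun c' _ => Submodule.smul_mem _ _ ?_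
  have := wd_mem_eigBideg b (wd_mem_eigBideg b hx (s, c', t')) (s, c, t)
  rwa [add_right_comm] at this

theorem deltaAt_mem_eigBideg {d : Fin 2 → ℤ} {x : ExteriorAlgebra ℂ M} (hx : x ∈ eigBideg b d)
    (q : Fin 4) (t t' : Fin 2) (s : Fin n) :
    deltaAt b q t t' s x ∈ eigBideg b (d - Pi.single t 1 - Pi.single t' 1) := by
  simp only [deltaAt, LinearMap.sum_apply, LinearMap.smul_apply, End.mul_apply]
  refine Submodule.sum_mem _ fun c _ => Submodule.sum_mem _ fun c' _ => Submodule.smul_mem _ _ ?_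
  have := ct_mem_eigBideg b (ct_mem_eigBideg b hx (s, c', t')) (s, c, t)
  rwa [sub_right_comm] at this

variable (S : Finset (Fin n))

/-- The elements invariant under the Lie algebra of the group `Sp` of the coordinates in `S`. -/
def lieInv : Submodule ℂ (ExteriorAlgebra ℂ M) where
  carrier := {x | ∀ h, ∀ s ∈ S, ∀ s' ∈ S, zop b h s s' x = 0}
  add_mem' hx hy h s hs s' hs' := by rw [map_add, hx h s hs s' hs', hy h s hs s' hs', add_zero]
  zero_mem' h s _ s' _ := map_zero _
  smul_mem' c x hx h s hs s' hs' := by rw [map_smul, hx h s hs s' hs', smul_zero]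

theorem adj_zop (h : Fin 4) (s s' : Fin n) : Adj b (lopAdj b h s s' - lop b h s s') (zop b h s s') :=
  (adj_lopAdj b h s s').sub (adj_lop b h s s')

variable {S}

theorem mem_lieInv_of_commute {G : End ℂ (ExteriorAlgebra ℂ M)}
    (hG : ∀ h, ∀ s ∈ S, ∀ s' ∈ S, zop b h s s' * G = G * zop b h s s')
    {x : ExteriorAlgebra ℂ M} (hx : x ∈ lieInv b S) : G x ∈ lieInv b S := by
  intro h s hs s' hs'
  have := congrArg (fun P => P x) (hG h s hs s' hs')
  simp only [End.mul_apply] at this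
  rw [this, hx h s hs s' hs', map_zero]

/-- The Lie algebra acts by skew-adjoint operators, so the adjoint of an operator commuting with it
preserves the invariants. Contractions in fixed directions and the operators `Δ` are thereby handled
without computing their commutators. -/
theorem mem_lieInv_of_adj {G G' : End ℂ (ExteriorAlgebra ℂ M)} (hGG : Adj b G G')
    (hG : ∀ h, ∀ s ∈ S, ∀ s' ∈ S, zop b h s s' * G = G * zop b h s s')
    {x : ExteriorAlgebra ℂ M} (hx : x ∈ lieInv b S) : G' x ∈ lieInv b S := by
  intro h s hs s' hs'
  refine hGG.map_ker b (adj_zop b h s s') ?_ (hG h s hs s' hs') (hx h s hs s' hs')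
  rw [zop]
  exact (neg_sub _ _).symm

theorem zop_mul_wd_of_notMem {σ : Fin n} (hσ : σ ∉ S) (e : Fin 4) (t : Fin 2) (h : Fin 4)
    (s : Fin n) (hs : s ∈ S) (s' : Fin n) (hs' : s' ∈ S) :
    zop b h s s' * wd b (σ, e, t) = wd b (σ, e, t) * zop b h s s' := by
  have h1 : s ≠ σ := fun h => hσ (h ▸ hs)
  have h2 : s' ≠ σ := fun h => hσ (h ▸ hs')
  rw [zop_mul_wd, if_neg h1, if_neg h2]
  simp

theorem adj_theta (q : Fin 4) (t t' : Fin 2) :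
    Adj b (∑ s ∈ S, thetaAt b q t' t s)
      (∑ s ∈ S, ∑ d, ∑ d', (quatCoef d d' q : ℂ) • (ct b (s, d', t) * ct b (s, d, t'))) :=
  Adj.sum fun _ _ => Adj.sum fun _ _ => Adj.sum fun _ _ =>
    ((adj_wd b _).mul (adj_wd b _)).int_smul _

theorem delta_mem_lieInv {x : ExteriorAlgebra ℂ M} (hx : x ∈ lieInv b S) (q : Fin 4)
    (t t' : Fin 2) : (∑ s ∈ S, deltaAt b q t t' s) x ∈ lieInv b S := by
  have h1 : ∑ s ∈ S, ∑ d, ∑ d', (quatCoef d d' q : ℂ) • (ct b (s, d', t') * ct b (s, d, t))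
      = (-1 : ℂ) • ∑ s ∈ S, deltaAt b q t t' s := by
    have h2 : ∀ i j, ct b i * ct b j = (-1 : ℂ) • (ct b j * ct b i) := fun i j =>
      LinearMap.ext fun x => by simpa [ct] using contr_comm (b.coord i) (b.coord j) x
    simp only [deltaAt, Finset.smul_sum]
    refine Finset.sum_congr rfl fun s _ => Finset.sum_congr rfl fun d _ =>
      Finset.sum_congr rfl fun d' _ => ?_
    rw [h2, smul_comm]
  have h3 := mem_lieInv_of_adj b (adj_theta b q t' t)
    (fun h s hs s' hs' => zop_mul_theta b S h q t t' hs hs') hx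
  rw [h1] at h3
  simpa using h3

/-- The operator through which the first fundamental theorem is proved. -/
def casimir (S : Finset (Fin n)) : End ℂ (ExteriorAlgebra ℂ M) :=
  (2 : ℂ) • (∑ s ∈ Sᶜ, ∑ c, ∑ t, wd b (s, c, t) * ct b (s, c, t))
    - ∑ q, ∑ t, ∑ t', (∑ s ∈ S, thetaAt b q t t' s) * ∑ s ∈ S, deltaAt b q t t' s

theorem casimir_apply (x : ExteriorAlgebra ℂ M) :
    casimir b S x = (2 : ℂ) • (∑ s ∈ Sᶜ, ∑ c, ∑ t, wd b (s, c, t) (ct b (s, c, t) x))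
      - ∑ q, ∑ t, ∑ t', (∑ s ∈ S, thetaAt b q t t' s) ((∑ s ∈ S, deltaAt b q t t' s) x) := by
  simp only [casimir, LinearMap.sub_apply, LinearMap.smul_apply, LinearMap.sum_apply,
    End.mul_apply]

/-- On invariants `lop` and `lopAdj` agree, so `∑ lop lopAdj` may be replaced by `∑ lop²`. By
`sum_lop_sq` this is `-2` times the number operator of `S` minus `∑ Θ Δ`; adding twice the full
degree leaves twice the number operator of the complement of `S`. -/
theorem casimir_eq {x : ExteriorAlgebra ℂ M} (hx : x ∈ lieInv b S) :
    casimir b S x = (2 : ℂ) • num b 1 x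
      + ∑ h, ∑ s ∈ S, ∑ s' ∈ S, lop b h s s' (lopAdj b h s s' x) := by
  have h1 : ∀ h, ∀ s ∈ S, ∀ s' ∈ S, lopAdj b h s s' x = lop b h s s' x := by
    intro h s hs s' hs'
    have := hx h s hs s' hs'
    rw [zop, LinearMap.sub_apply, sub_eq_zero] at this
    exact this.symm
  have h2 : ∑ h, ∑ s ∈ S, ∑ s' ∈ S, lop b h s s' (lopAdj b h s s' x)
      = (∑ h, ∑ s ∈ S, ∑ s' ∈ S, lop b h s s' * lop b h s s') x := by
    simp only [LinearMap.sum_apply, End.mul_apply]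
    refine Finset.sum_congr rfl fun h _ => Finset.sum_congr rfl fun s hs =>
      Finset.sum_congr rfl fun s' hs' => by rw [h1 h s hs s' hs']
  have h3 : num b 1 = (∑ s ∈ S, ∑ c, ∑ t, wd b (s, c, t) * ct b (s, c, t))
      + ∑ s ∈ Sᶜ, ∑ c, ∑ t, wd b (s, c, t) * ct b (s, c, t) := by
    rw [Finset.sum_add_sum_compl]
    simp [num, Fintype.sum_prod_type]
  rw [h2, sum_lop_sq, h3, casimir]
  simp only [LinearMap.sub_apply, LinearMap.smul_apply, LinearMap.add_apply, smul_add, neg_smul]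
  abel

/-- By `casimir_eq` the operator is `2d + ∑ L L*` on such `x`, so pairing with `x` gives at least
`2d` times the squared norm. -/
theorem eq_zero_of_casimir_eq_zero {x : ExteriorAlgebra ℂ M} (hx : x ∈ lieInv b S) {d : ℤ}
    (hd : 0 < d) (hxd : num b 1 x = (d : ℂ) • x) (h : casimir b S x = 0) : x = 0 := by
  by_contra h0
  rw [casimir_eq b hx, hxd] at h
  have h1 := congrArg (fun y => (ip b x y).re) h
  simp only [ip_add_right, ip_smul_right, ip_sum_right, ip_zero_right, Complex.add_re,
    Complex.re_sum, Complex.zero_re] at h1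
  have h2 : ((2 : ℂ) * ((d : ℂ) * ip b x x)).re = 2 * (d * (ip b x x).re) := by
    simp
  have h3 : 0 ≤ ∑ h, ∑ s ∈ S, ∑ s' ∈ S, (ip b x (lop b h s s' (lopAdj b h s s' x))).re := by
    refine Finset.sum_nonneg fun h _ => Finset.sum_nonneg fun s _ => Finset.sum_nonneg
      fun s' _ => ?_
    rw [← adj_lopAdj b h s s']
    exact ip_self_nonneg b _
  have h4 := ip_self_pos b x h0
  rw [h2] at h1
  have h5 : (0 : ℝ) < d := by exact_mod_cast hd
  have := mul_pos h5 h4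
  linarith

/-- The first fundamental theorem of invariant theory for the symplectic group, in the exterior
algebra: the invariants of each bidegree lie in any family of subspaces that contains the scalars
and is closed under multiplication with the one-forms of the fixed coordinates and with the
invariant two-forms. -/
theorem lieInv_mem (B : (Fin 2 → ℤ) → Submodule ℂ (ExteriorAlgebra ℂ M)) (hone : 1 ∈ B 0)
    (hwd : ∀ d, ∀ s ∉ S, ∀ c t, ∀ x ∈ B d, wd b (s, c, t) x ∈ B (d + Pi.single t 1))
    (htheta : ∀ d q t t', ∀ x ∈ B d,
      (∑ s ∈ S, thetaAt b q t t' s) x ∈ B (d + Pi.single t 1 + Pi.single t' 1))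
    (d : Fin 2 → ℤ) {x : ExteriorAlgebra ℂ M} (hx : x ∈ lieInv b S) (hxd : x ∈ eigBideg b d) :
    x ∈ B d := by
  -- Induction on a strict bound for the total degree. Bidegrees are integral so that subtracting
  -- never truncates; spaces of negative total degree are zero by positivity of the degree operator.
  suffices key : ∀ r : ℕ, ∀ d : Fin 2 → ℤ, d 0 + d 1 < r → ∀ x ∈ lieInv b S, x ∈ eigBideg b d →
      x ∈ B d by
    exact key (d 0 + d 1 + 1).toNat d (by omega) x hx hxd
  clear hx hxd x d
  intro r
  induction r with
  | zero =>
    intro d hd x _ hxd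
    rw [eq_zero_of_num_neg b (by simpa using hd) (num_one_of_mem_eigBideg b hxd)]
    exact Submodule.zero_mem _
  | succ r ih =>
    intro d hd x hx hxd
    have hsingle : ∀ t : Fin 2, (Pi.single t (1 : ℤ) : Fin 2 → ℤ) 0
        + (Pi.single t (1 : ℤ) : Fin 2 → ℤ) 1 = 1 := by
      intro t; fin_cases t <;> simp
    rcases lt_trichotomy (d 0 + d 1) 0 with hneg | hzero | hpos
    · rw [eq_zero_of_num_neg b hneg (num_one_of_mem_eigBideg b hxd)]
      exact Submodule.zero_mem _
    · have h1 := num_one_of_mem_eigBideg b hxd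
      rw [hzero, Int.cast_zero, zero_smul] at h1
      have h2 := eq_scalar_of_ct_eq_zero b (ct_eq_zero_of_num_eq_zero b h1)
      by_cases h0 : x = 0
      · rw [h0]; exact Submodule.zero_mem _
      -- Total degree zero alone does not exclude bidegrees such as `(1, -1)`. A nonzero scalar has
      -- both weights equal to zero.
      · have hd0 : d = 0 := by
          funext t
          have h3 := hxd t
          rw [h2, Algebra.algebraMap_eq_smul_one, map_smul, num_one, smul_zero,
            ← Algebra.algebraMap_eq_smul_one, ← h2] at h3
          have := (smul_eq_zero.mp h3.symm).resolve_right h0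
          exact_mod_cast this
        rw [hd0, h2, Algebra.algebraMap_eq_smul_one]
        exact Submodule.smul_mem _ _ hone
    -- The operator `casimir b S` maps the finite-dimensional space `J` injectively to itself, hence
    -- onto. Writing `x = casimir b S y` exhibits `x` as a combination of one-forms in fixed
    -- directions and invariant two-forms times contractions of `y`, which are invariants of lower
    -- degree.
    · let J : Submodule ℂ (ExteriorAlgebra ℂ M) := lieInv b S ⊓ eigBideg b d
      have hct : ∀ y ∈ J, ∀ s ∉ S, ∀ c t, ct b (s, c, t) y ∈ lieInv b S :=
        fun y hy s hs c t => mem_lieInv_of_adj b (adj_wd b _)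
          (zop_mul_wd_of_notMem b hs c t) hy.1
      have hct' : ∀ y ∈ J, ∀ s c t, ct b (s, c, t) y ∈ eigBideg b (d - Pi.single t 1) :=
        fun y hy s c t => ct_mem_eigBideg b hy.2 (s, c, t)
      have hdel : ∀ y ∈ J, ∀ q t t', (∑ s ∈ S, deltaAt b q t t' s) y
          ∈ eigBideg b (d - Pi.single t 1 - Pi.single t' 1) := by
        intro y hy q t t'
        rw [LinearMap.sum_apply]
        exact Submodule.sum_mem _ fun s _ => deltaAt_mem_eigBideg b hy.2 q t t' s
      have hcancel : ∀ t t' : Fin 2, d - Pi.single t 1 - Pi.single t' 1 + Pi.single t 1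
          + Pi.single t' 1 = d := fun t t' => by abel
      have hwct : ∀ y ∈ J, ∀ s ∉ S, ∀ c t,
          wd b (s, c, t) (ct b (s, c, t) y) ∈ lieInv b S := fun y hy s hs c t =>
        mem_lieInv_of_commute b (fun h s' hs' s'' hs'' =>
          zop_mul_wd_of_notMem b hs c t h s' hs' s'' hs'') (hct y hy s hs c t)
      have hthd : ∀ y ∈ J, ∀ q t t', (∑ s ∈ S, thetaAt b q t t' s)
          ((∑ s ∈ S, deltaAt b q t t' s) y) ∈ lieInv b S := fun y hy q t t' =>
        mem_lieInv_of_commute b (fun h s hs s' hs' => zop_mul_theta b S h q t t' hs hs')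
          (delta_mem_lieInv b hy.1 q t t')
      have hJ : ∀ y ∈ J, casimir b S y ∈ J := by
        intro y hy
        rw [casimir_apply]
        refine Submodule.sub_mem _ (Submodule.smul_mem _ _ (Submodule.sum_mem _ fun s hs =>
          Submodule.sum_mem _ fun c _ => Submodule.sum_mem _ fun t _ => ⟨?_, ?_⟩))
          (Submodule.sum_mem _ fun q _ => Submodule.sum_mem _ fun t _ => Submodule.sum_mem _
            fun t' _ => ⟨?_, ?_⟩)
        · rw [Finset.mem_compl] at hs
          exact hwct y hy s hs c t
        · have := wd_mem_eigBideg b (hct' y hy s c t) (s, c, t)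
          rwa [sub_add_cancel] at this
        · exact hthd y hy q t t'
        · have : (∑ s ∈ S, thetaAt b q t t' s) ((∑ s ∈ S, deltaAt b q t t' s) y)
              ∈ eigBideg b (d - Pi.single t 1 - Pi.single t' 1 + Pi.single t 1
                + Pi.single t' 1) := by
            rw [LinearMap.sum_apply]
            exact Submodule.sum_mem _ fun s _ =>
              thetaAt_mem_eigBideg b (hdel y hy q t t') q t t' s
          rwa [hcancel] at this
      have : Module.Finite ℂ (ExteriorAlgebra ℂ M) := by
        have : LinearOrder (CoordIdx n) := LinearOrder.lift' (Fintype.equivFin _)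
          (Fintype.equivFin _).injective
        exact Module.Finite.of_basis b.ExteriorAlgebra
      have hinj : Function.Injective ((casimir b S).restrict hJ) := by
        rw [← LinearMap.ker_eq_bot, LinearMap.ker_eq_bot']
        intro y hy
        exact Subtype.ext (eq_zero_of_casimir_eq_zero b y.2.1 hpos
          (num_one_of_mem_eigBideg b y.2.2) (congrArg Subtype.val hy))
      obtain ⟨y, hy⟩ := (LinearMap.injective_iff_surjective.mp hinj) ⟨x, hx, hxd⟩
      have hy' : casimir b S y.1 = x := congrArg Subtype.val hy
      rw [← hy', casimir_apply]
      refine Submodule.sub_mem _ (Submodule.smul_mem _ _ (Submodule.sum_mem _ fun s hs =>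
          Submodule.sum_mem _ fun c _ => Submodule.sum_mem _ fun t _ => ?_))
          (Submodule.sum_mem _ fun q _ => Submodule.sum_mem _ fun t _ => Submodule.sum_mem _
            fun t' _ => ?_)
      · rw [Finset.mem_compl] at hs
        have h1 := hwd (d - Pi.single t 1) s hs c t _ (ih (d - Pi.single t 1) (by
          have := hsingle t
          simp only [Pi.sub_apply]; push_cast at hd; linarith) _ (hct y.1 y.2 s hs c t)
          (hct' y.1 y.2 s c t))
        rwa [sub_add_cancel] at h1
      · have h1 := htheta (d - Pi.single t 1 - Pi.single t' 1) q t t' _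
          (ih (d - Pi.single t 1 - Pi.single t' 1) (by
          have h1 := hsingle t
          have h2 := hsingle t'
          simp only [Pi.sub_apply]; push_cast at hd; linarith) _ (delta_mem_lieInv b y.2.1 q t t')
          (hdel y.1 y.2 q t t'))
        rwa [hcancel] at h1

end FirstFundamentalTheorem

/-! ### Quaternionic isometries -/

section QuatIsometries

variable {n m k : ℕ}

theorem qForm_add_right (v w w' : Hn n) : qForm v (w + w') = qForm v w + qForm v w' := by
  simp [qForm, mul_add, Finset.sum_add_distrib]

theorem qForm_smul_right (v w : Hn n) (q : ℍ[ℝ]) :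
    qForm v (MulOpposite.op q • w) = qForm v w * q := by
  simp [qForm, Finset.sum_mul, mul_assoc]

theorem star_qForm (v w : Hn n) : star (qForm v w) = qForm w v := by
  simp [qForm, star_sum]

theorem qForm_add_left (v v' w : Hn n) : qForm (v + v') w = qForm v w + qForm v' w := by
  rw [← star_qForm, qForm_add_right, star_add, star_qForm, star_qForm]

theorem qForm_smul_left (v w : Hn n) (q : ℍ[ℝ]) :
    qForm (MulOpposite.op q • v) w = star q * qForm v w := by
  rw [← star_qForm, qForm_smul_right, star_mul, star_qForm]

theorem qForm_neg_right (v w : Hn n) : qForm v (-w) = -qForm v w := by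
  simp [qForm]

theorem qForm_neg_left (v w : Hn n) : qForm (-v) w = -qForm v w := by
  simp [qForm]

theorem qForm_sub_right (v w w' : Hn n) : qForm v (w - w') = qForm v w - qForm v w' := by
  rw [sub_eq_add_neg, qForm_add_right, qForm_neg_right, sub_eq_add_neg]

theorem qForm_sub_left (v v' w : Hn n) : qForm (v - v') w = qForm v w - qForm v' w := by
  rw [sub_eq_add_neg, qForm_add_left, qForm_neg_left, sub_eq_add_neg]

theorem qForm_self (v : Hn n) : qForm v v = ((‖v‖ ^ 2 : ℝ) : ℍ[ℝ]) := by
  have h : star (qForm v v) = qForm v v := star_qForm v v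
  rw [← qForm_self_re]
  exact Quaternion.star_eq_self.mp h

theorem qForm_self_eq_zero {v : Hn n} (h : qForm v v = 0) : v = 0 := by
  have h1 := qForm_self_re v
  rw [h] at h1
  simpa using h1.symm

theorem qForm_single_left (i : Fin n) (w : Hn n) (q : ℍ[ℝ]) :
    qForm (PiLp.single 2 i q) w = star q * w i := by
  rw [qForm, Finset.sum_eq_single i] <;> simp +contextual

/-- Composition of quaternionic isometries. -/
def QuatIsometry.comp (g : QuatIsometry m k) (f : QuatIsometry n m) : QuatIsometry n k where
  toLin := g.toLin ∘ₗ f.toLin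
  map_qForm v w := (g.map_qForm _ _).trans (f.map_qForm v w)

/-- The identity as a quaternionic isometry. -/
def QuatIsometry.id (n : ℕ) : QuatIsometry n n where
  toLin := LinearMap.id
  map_qForm _ _ := rfl

theorem QuatIsometry.bijective (f : QuatIsometry n n) : Function.Bijective f.toLin := by
  have h : Function.Injective f.toIsometry.toLinearMap := f.toIsometry.injective
  exact ⟨h, (LinearMap.injective_iff_surjective (f := f.toIsometry.toLinearMap)).mp h⟩

theorem hPullback_eq_of_mem_invForms {a b : ℕ} {τ : HForms (Hn n)} (hτ : τ ∈ invForms n a b)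
    (f : QuatIsometry n n) : hPullback f.toIsometry τ = τ :=
  hτ.2 ⟨LinearEquiv.ofBijective f.toLin f.bijective, f.map_qForm⟩

/-- The quaternionic reflection `x ↦ x + y l K(y, x)`. -/
def quatReflection (y : Hn n) (l : ℍ[ℝ]) (hl : l + star l + star l * qForm y y * l = 0) :
    QuatIsometry n n where
  toLin :=
    { toFun := fun x => x + MulOpposite.op (l * qForm y x) • y
      map_add' := fun x x' => by
        rw [qForm_add_right, mul_add, MulOpposite.op_add, add_smul]; abel
      map_smul' := fun q x => by
        induction q using MulOpposite.rec' with | _ q =>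
        rw [qForm_smul_right, RingHom.id_apply, smul_add, smul_smul, ← MulOpposite.op_mul,
          mul_assoc] }
  map_qForm v w := by
    change qForm (v + MulOpposite.op (l * qForm y v) • y) (w + MulOpposite.op (l * qForm y w) • y)
      = qForm v w
    rw [qForm_add_left, qForm_add_right, qForm_add_right, qForm_smul_left, qForm_smul_left,
      qForm_smul_right, qForm_smul_right, star_mul, star_qForm]
    -- The three correction terms to `K(v, w)` combine to exactly this product.
    have h : qForm v y * (l + star l + star l * qForm y y * l) * qForm y w = 0 := by
      rw [hl, mul_zero, zero_mul]
    rw [add_assoc, add_eq_left, ← h]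
    noncomm_ring

theorem quatReflection_apply (y : Hn n) (l : ℍ[ℝ]) (hl : l + star l + star l * qForm y y * l = 0)
    (x : Hn n) : (quatReflection y l hl).toLin x = x + MulOpposite.op (l * qForm y x) • y := rfl

/-- Two vectors of the same length are related by a quaternionic isometry fixing everything
orthogonal to both. -/
theorem exists_quatIsometry_apply_eq {u w : Hn n} (h : qForm u u = qForm w w) :
    ∃ A : QuatIsometry n n, A.toLin u = w ∧
      ∀ x, qForm u x = 0 → qForm w x = 0 → A.toLin x = x := by
  by_cases huw : u = w
  · exact ⟨QuatIsometry.id n, huw, fun _ _ _ => rfl⟩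
  · set y := u - w with hy
    -- The parameter is `l = -a⁻¹`, chosen so that `u + y l K(y, u) = u - y = w`. Equality of the
    -- lengths of `u` and `w` gives `K(y, y) = a + ā`, which is precisely what makes this reflection
    -- an isometry.
    set a := qForm y u with ha
    have h1 : qForm y y = a + star a := by
      rw [ha, star_qForm, hy, qForm_sub_left, qForm_sub_right, qForm_sub_right, qForm_sub_left,
        ← h]
      abel
    have ha0 : a ≠ 0 := by
      intro h0
      rw [h0, star_zero, add_zero] at h1
      exact huw (sub_eq_zero.mp (qForm_self_eq_zero h1))
    have ha1 : star a ≠ 0 := by simpa using ha0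
    have hl : -a⁻¹ + star (-a⁻¹) + star (-a⁻¹) * qForm y y * (-a⁻¹) = 0 := by
      rw [h1, star_neg, star_inv₀, mul_add, add_mul, neg_mul, neg_mul_neg, mul_assoc,
        mul_inv_cancel₀ ha0, mul_one, neg_mul, neg_mul_neg, inv_mul_cancel₀ ha1, one_mul]
      abel
    refine ⟨quatReflection y (-a⁻¹) hl, ?_, fun x hx hx' => ?_⟩
    · rw [quatReflection_apply, ← ha, neg_mul, inv_mul_cancel₀ ha0, MulOpposite.op_neg,
        MulOpposite.op_one, neg_smul, one_smul, hy]
      abel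
    · rw [quatReflection_apply, hy, qForm_sub_left, hx, hx', sub_zero, mul_zero,
        MulOpposite.op_zero, zero_smul, add_zero]

theorem eq_sum_single (x : Hn n) :
    x = ∑ i, MulOpposite.op (x i) • (PiLp.single 2 i (1 : ℍ[ℝ]) : Hn n) := by
  ext i : 1
  simp [Pi.single_apply]

theorem qForm_sum_right {J : Type*} (s : Finset J) (v : Hn n) (w : J → Hn n) :
    qForm v (∑ j ∈ s, w j) = ∑ j ∈ s, qForm v (w j) := by
  classical
  induction s using Finset.induction_on with
  | empty => simp [qForm]
  | insert a s ha ih => rw [Finset.sum_insert ha, Finset.sum_insert ha, qForm_add_right, ih]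

/-- Any `r ≤ n` vectors of `ℍ^m` lie in a quaternionic isometric image of the subspace spanned by
the first `r` coordinate vectors of `ℍ^n`. -/
theorem exists_quatIsometry_range (f : QuatIsometry n m) (r : ℕ) (hr : r ≤ n) (w : ℕ → Hn m) :
    ∃ A : QuatIsometry m m, ∀ i < r, ∃ x : Hn n, (∀ j : Fin n, r ≤ j → x j = 0) ∧
      w i = A.toLin (f.toLin x) := by
  induction r with
  | zero => exact ⟨QuatIsometry.id m, fun i hi => absurd hi (Nat.not_lt_zero i)⟩
  | succ r ih =>
    obtain ⟨A, hA⟩ := ih (by omega)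
    have hAf : ∀ x x', qForm (A.toLin (f.toLin x)) (A.toLin (f.toLin x')) = qForm x x' :=
      fun x x' => (A.map_qForm _ _).trans (f.map_qForm _ _)
    let g : Hn n → Hn m := fun x => A.toLin (f.toLin x)
    let e : Fin n → Hn n := fun j => PiLp.single 2 j 1
    have he : ∀ j x, qForm (e j) x = x j := fun j x => by
      rw [qForm_single_left, star_one, one_mul]
    -- A Gram-Schmidt step: `g p` is the projection of `w r` to the span of `g (e j)` for `j < r`,
    -- and the residue `w'` is orthogonal to these vectors.
    let p : Hn n := WithLp.toLp 2 fun j => if (j : ℕ) < r then qForm (g (e j)) (w r) else 0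
    have hp : ∀ j : Fin n, p j = if (j : ℕ) < r then qForm (g (e j)) (w r) else 0 := fun _ => rfl
    set w' := w r - g p with hw'
    have hort : ∀ j : Fin n, (j : ℕ) < r → qForm (g (e j)) w' = 0 := by
      intro j hj
      rw [hw', qForm_sub_right, hAf, he, hp, if_pos hj, sub_self]
    let i₀ : Fin n := ⟨r, by omega⟩
    by_cases hw0 : w' = 0
    · refine ⟨A, fun i hi => ?_⟩
      rcases Nat.lt_succ_iff_lt_or_eq.mp hi with hi | rfl
      · obtain ⟨x, hx, hx'⟩ := hA i hi
        exact ⟨x, fun j hj => hx j (by omega), hx'⟩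
      · exact ⟨p, fun j hj => by rw [hp, if_neg (by omega)], sub_eq_zero.mp hw0⟩
    · have hnorm : ‖w'‖ ≠ 0 := norm_ne_zero_iff.mpr hw0
      have h1 : qForm (g (e i₀)) (g (e i₀))
          = qForm (MulOpposite.op ((‖w'‖⁻¹ : ℝ) : ℍ[ℝ]) • w')
            (MulOpposite.op ((‖w'‖⁻¹ : ℝ) : ℍ[ℝ]) • w') := by
        rw [hAf, he, qForm_smul_left, qForm_smul_right, qForm_self, Quaternion.star_coe,
          ← Quaternion.coe_mul, ← Quaternion.coe_mul]
        have : ‖w'‖⁻¹ * (‖w'‖ ^ 2 * ‖w'‖⁻¹) = 1 := by field_simp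
        rw [this]
        simp [e]
      -- `B` turns the next free direction `g (e i₀)` into the normalized residue. It fixes the span
      -- of `g (e j)` for `j < r`, which is orthogonal to both, so the vectors already placed are
      -- not disturbed. The bound `r + 1 ≤ n` is what provides `i₀`.
      obtain ⟨B, hB, hB'⟩ := exists_quatIsometry_apply_eq h1
      have hfix : ∀ x : Hn n, (∀ j : Fin n, r ≤ j → x j = 0) → B.toLin (g x) = g x := by
        intro x hx
        refine hB' _ ?_ ?_
        · rw [hAf, he]
          exact hx i₀ le_rfl
        · rw [qForm_smul_left]
          have : g x = ∑ j, MulOpposite.op (x j) • g (e j) := by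
            conv_lhs => rw [eq_sum_single x]
            simp only [g, e, map_sum, map_smul]
          rw [this, qForm_sum_right, Finset.sum_eq_zero, mul_zero]
          intro j _
          rw [qForm_smul_right]
          by_cases hj : (j : ℕ) < r
          · rw [← star_qForm, hort j hj, star_zero, zero_mul]
          · rw [hx j (by omega), mul_zero]
      refine ⟨B.comp A, fun i hi => ?_⟩
      rcases Nat.lt_succ_iff_lt_or_eq.mp hi with hi | rfl
      · obtain ⟨x, hx, hx'⟩ := hA i hi
        exact ⟨x, fun j hj => hx j (by omega), hx'.trans (hfix x hx).symm⟩
      · refine ⟨p + MulOpposite.op ((‖w'‖ : ℝ) : ℍ[ℝ]) • e i₀, fun j hj => ?_, ?_⟩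
        · have : j ≠ i₀ := by rintro rfl; simp [i₀] at hj
          rw [PiLp.add_apply, hp, if_neg (by omega), PiLp.smul_apply]
          simp [e, this]
        · change w i = B.toLin (A.toLin (f.toLin _))
          rw [map_add, map_add, map_add, map_smul, map_smul, map_smul]
          change w i = B.toLin (g p) + _ • B.toLin (g (e i₀))
          rw [hB, hfix p fun j hj => by rw [hp, if_neg (by omega)], smul_smul,
            ← MulOpposite.op_mul, ← Quaternion.coe_mul, inv_mul_cancel₀ hnorm, Quaternion.coe_one,
            MulOpposite.op_one, one_smul, hw']
          abel

end QuatIsometries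

/-! ### Horizontal forms at a point of the sphere -/

section Fibres

variable {V W : Type*} [NormedAddCommGroup V] [InnerProductSpace ℝ V]
  [NormedAddCommGroup W] [InnerProductSpace ℝ W]

open scoped RealInnerProductSpace

/-- The orthogonal projection to `v^⊥`, as a map into `V`. -/
def perpMap (v : V) : V →ₗ[ℝ] V :=
  LinearMap.id - (innerₛₗ ℝ v).smulRight v

theorem perpMap_apply (v w : V) : perpMap v w = w - ⟪v, w⟫ • v := by
  simp [perpMap]

/-- The orthogonal projection to `v^⊥`. -/
def perpProj (v : Metric.sphere (0 : V) 1) : V →ₗ[ℝ] (ℝ ∙ (v : V))ᗮ :=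
  (perpMap (v : V)).codRestrict _ fun w => by
    have hv : ⟪(v : V), (v : V)⟫ = 1 := by simp
    rw [Submodule.mem_orthogonal_singleton_iff_inner_right, perpMap_apply, inner_sub_right,
      inner_smul_right, hv, mul_one, sub_self]

/-- The projection of `V × V` to the contact hyperplane at `v`. -/
def fibProj (v : Metric.sphere (0 : V) 1) : V × V →ₗ[ℝ] Tan (v : V) :=
  LinearMap.prodMap (perpMap (v : V)) (perpProj v)

/-- The restriction of a form at `(0, v)` to the contact hyperplane, as a form on `V × V`. -/
def rawFib (v : Metric.sphere (0 : V) 1) : RawForms V →ₐ[ℂ] Ext (V × V) :=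
  (extComap (fibProj v)).comp
    (Pi.evalAlgHom ℂ (fun p : SphereBundle V => Ext (Tan (p.2 : V))) (0, v))

theorem rawFib_apply (v : Metric.sphere (0 : V) 1) (τ : RawForms V) :
    rawFib v τ = extComap (fibProj v) (τ (0, v)) := rfl

theorem extComap_ι {S T : Type*} [AddCommGroup S] [Module ℝ S] [AddCommGroup T] [Module ℝ T]
    (f : S →ₗ[ℝ] T) (φ : T →ₗ[ℝ] ℂ) :
    extComap f (ExteriorAlgebra.ι ℂ φ) = ExteriorAlgebra.ι ℂ (φ ∘ₗ f) :=
  ExteriorAlgebra.map_apply_ι _ _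

theorem contactFunctional_comp_fibProj (v : Metric.sphere (0 : V) 1) :
    contactFunctional V (v : V) ∘ₗ fibProj v = 0 := by
  refine LinearMap.ext fun w => ?_
  have hv : ⟪(v : V), (v : V)⟫ = 1 := by simp
  change ((⟪(v : V), perpMap (v : V) w.1⟫ : ℝ) : ℂ) = 0
  rw [perpMap_apply, inner_sub_right, inner_smul_right, hv, mul_one, sub_self, Complex.ofReal_zero]

/-- Contracting `α ∧ τ = 0` with the vector `(v, 0)`, on which `α` is `1`, shows that `τ` is a
multiple of `α`, and `α` vanishes on the contact hyperplane. -/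
theorem rawFib_eq_zero_of_vertical (v : Metric.sphere (0 : V) 1) {τ : RawForms V}
    (h : contactForm V * τ = 0) : rawFib v τ = 0 := by
  have h1 : ExteriorAlgebra.ι ℂ (contactFunctional V (v : V)) * τ (0, v) = 0 := congrFun h (0, v)
  let d : Module.Dual ℂ (Tan (v : V) →ₗ[ℝ] ℂ) :=
    { toFun := fun φ => φ ((v : V), 0)
      map_add' := fun _ _ => rfl
      map_smul' := fun _ _ => rfl }
  have hd : d (contactFunctional V (v : V)) = 1 := by
    change ((⟪(v : V), (v : V)⟫ : ℝ) : ℂ) = 1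
    simp
  have h2 := contr_ι_mul d (contactFunctional V (v : V)) (τ (0, v))
  rw [h1, map_zero, hd, one_smul, eq_comm, sub_eq_zero] at h2
  rw [rawFib_apply, h2, map_mul, extComap_ι, contactFunctional_comp_fibProj, map_zero, zero_mul]

/-- Wedging with the contact form only sees the restriction to the contact hyperplane. -/
theorem contact_mul_eq (v : Metric.sphere (0 : V) 1) (x : Ext (Tan (v : V))) :
    ExteriorAlgebra.ι ℂ (contactFunctional V (v : V)) * x
      = ExteriorAlgebra.ι ℂ (contactFunctional V (v : V))
        * extComap (fibProj v ∘ₗ tanIncl (v : V)) x := by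
  induction x using ext_left_induction with
  | scalar r => rw [AlgHom.commutes]
  | add x y hx hy => rw [map_add, mul_add, mul_add, hx, hy]
  | ι_mul x φ hx =>
    -- Projecting to the contact hyperplane changes a functional only by a multiple of the contact
    -- functional, and this multiple is lost after wedging with it.
    have h1 : φ ∘ₗ (fibProj v ∘ₗ tanIncl (v : V))
        = φ - φ ((v : V), 0) • contactFunctional V (v : V) := by
      refine LinearMap.ext fun w => ?_
      have h2 : fibProj v (tanIncl (v : V) w) = w - ⟪(v : V), w.1⟫ • (((v : V), 0) : Tan (v : V)) := by
        refine Prod.ext ?_ (Subtype.ext ?_)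
        · change perpMap (v : V) w.1 = _
          rw [perpMap_apply]; rfl
        · change perpMap (v : V) (w.2 : V) = _
          have := (Submodule.mem_orthogonal_singleton_iff_inner_right).mp w.2.2
          rw [perpMap_apply, this]
          simp
      rw [LinearMap.comp_apply, LinearMap.comp_apply, h2, map_sub, map_smul]
      change _ = φ w - φ ((v : V), 0) * ((⟪(v : V), w.1⟫ : ℝ) : ℂ)
      rw [mul_comm, Complex.real_smul]
    have hsw : ∀ a b : Tan (v : V) →ₗ[ℝ] ℂ, ∀ y : Ext (Tan (v : V)),
      ExteriorAlgebra.ι ℂ a * (ExteriorAlgebra.ι ℂ b * y)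
        = - (ExteriorAlgebra.ι ℂ b * (ExteriorAlgebra.ι ℂ a * y)) := fun a b y => wedge_comm a b y
    rw [hsw, hx, ← hsw, map_mul, extComap, ExteriorAlgebra.map_apply_ι]
    change _ = _ * (ExteriorAlgebra.ι ℂ (φ ∘ₗ (fibProj v ∘ₗ tanIncl (v : V))) * _)
    have h5 : ∀ y : Ext (Tan (v : V)), ExteriorAlgebra.ι ℂ (contactFunctional V (v : V))
        * (ExteriorAlgebra.ι ℂ (contactFunctional V (v : V)) * y) = 0 :=
      fun y => wedge_wedge_self _ y
    rw [h1, map_sub, map_smul, sub_mul, smul_mul_assoc, mul_sub, mul_smul_comm, h5, smul_zero,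
      sub_zero]

theorem trForms_apply_eq {τ : RawForms V} (hτ : τ ∈ trForms V) (x : V)
    (v : Metric.sphere (0 : V) 1) : τ (x, v) = τ (0, v) := by
  have h := hτ.2 x 0 v
  rwa [zero_add] at h

/-- The restriction of a horizontal form at `v` to the contact hyperplane, as a form on `V × V`. -/
def hFib (v : Metric.sphere (0 : V) 1) : HForms V →ₐ[ℂ] Ext (V × V) :=
  Ideal.Quotient.liftₐ (verticalIdeal V) ((rawFib v).comp (trForms V).val)
    fun _ hτ => rawFib_eq_zero_of_vertical v hτ

theorem hFib_toHForms (v : Metric.sphere (0 : V) 1) (τ : trForms V) :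
    hFib v (toHForms V τ) = rawFib v (τ : RawForms V) := rfl

theorem toHForms_surjective : Function.Surjective (toHForms V) :=
  Ideal.Quotient.mk_surjective

/-- A horizontal form is determined by its restrictions to the contact hyperplanes. -/
theorem eq_zero_of_hFib_eq_zero {τ : HForms V} (h : ∀ v, hFib v τ = 0) : τ = 0 := by
  obtain ⟨τ, rfl⟩ := toHForms_surjective τ
  refine Ideal.Quotient.eq_zero_iff_mem.mpr ?_
  change contactForm V * (τ : RawForms V) = 0
  funext ⟨x, v⟩
  change ExteriorAlgebra.ι ℂ (contactFunctional V (v : V)) * (τ : RawForms V) (x, v) = 0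
  rw [trForms_apply_eq τ.2, contact_mul_eq, ← extComap_comp]
  have h1 : extComap (fibProj v) ((τ : RawForms V) (0, v)) = 0 := h v
  rw [h1, map_zero, mul_zero]

theorem hFib_mem_bideg (v : Metric.sphere (0 : V) 1) {k l : ℕ} {τ : HForms V}
    (hτ : τ ∈ hFormsBideg V k l) : hFib v τ ∈ bideg V V k l := by
  obtain ⟨a, ha, rfl⟩ := hτ
  exact extComap_mem_bideg _ _ (ha (0, v))

/-- The image of a unit vector under a linear isometry. -/
def sphereMap (f : V →ₗᵢ[ℝ] W) (v : Metric.sphere (0 : V) 1) : Metric.sphere (0 : W) 1 :=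
  ⟨f (v : V), by simp⟩

theorem tanMap_comp_fibProj (f : V →ₗᵢ[ℝ] W) (v : Metric.sphere (0 : V) 1) :
    tanMap f (v : V) ∘ₗ fibProj v
      = fibProj (sphereMap f v) ∘ₗ LinearMap.prodMap f.toLinearMap f.toLinearMap := by
  have h : ∀ w, f (perpMap (v : V) w) = perpMap (f (v : V)) (f w) := by
    intro w
    rw [perpMap_apply, perpMap_apply, map_sub, map_smul, f.inner_map_map]
  exact LinearMap.ext fun w => Prod.ext (h w.1) (Subtype.ext (h w.2))

theorem hFib_hPullback (f : V →ₗᵢ[ℝ] W) (v : Metric.sphere (0 : V) 1) (τ : HForms W) :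
    hFib v (hPullback f τ)
      = extComap (LinearMap.prodMap f.toLinearMap f.toLinearMap) (hFib (sphereMap f v) τ) := by
  obtain ⟨τ, rfl⟩ := toHForms_surjective τ
  have h1 : (τ : RawForms W) (f 0, sphereMap f v) = (τ : RawForms W) (0, sphereMap f v) :=
    trForms_apply_eq τ.2 _ _
  exact (congrArg (fun x => extComap (fibProj v) (extComap (tanMap f (v : V)) x)) h1).trans
    ((extComap_comp (fibProj v) (tanMap f (v : V)) _).trans ((congrArg (fun g => extComap g
      ((τ : RawForms W) (0, sphereMap f v))) (tanMap_comp_fibProj f v)).trans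
        (extComap_comp _ (fibProj (sphereMap f v)) _).symm))

/-- The square of `perpMap v`. -/
def perpSq (v : V) : V × V →ₗ[ℝ] V × V := LinearMap.prodMap (perpMap v) (perpMap v)

theorem perpMap_perpMap (v : Metric.sphere (0 : V) 1) (w : V) :
    perpMap (v : V) (perpMap (v : V) w) = perpMap (v : V) w := by
  have hv : ⟪(v : V), (v : V)⟫ = 1 := by simp
  rw [perpMap_apply (v : V) (perpMap (v : V) w), perpMap_apply, inner_sub_right, inner_smul_right,
    hv, mul_one, sub_self, zero_smul, sub_zero]

theorem extComap_perpSq_hFib (v : Metric.sphere (0 : V) 1) (τ : HForms V) :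
    extComap (perpSq (v : V)) (hFib v τ) = hFib v τ := by
  obtain ⟨τ, rfl⟩ := toHForms_surjective τ
  rw [hFib_toHForms, rawFib_apply, extComap_comp]
  have h : fibProj v ∘ₗ perpSq (v : V) = fibProj v :=
    LinearMap.ext fun w => Prod.ext (perpMap_perpMap v w.1) (Subtype.ext (perpMap_perpMap v w.2))
  rw [h]

/-- The horizontal form defined by a smooth ambient form with coefficients depending on the
direction only. -/
def ofAmbient (F : V → Ext (V × V)) (hF : (fun p : V × V => F p.2) ∈ ambientForms (V × V)) :
    HForms V :=
  toHForms V ⟨restrictToSphereBundle V fun p => F p.2, ⟨_, hF, rfl⟩, fun _ _ _ => rfl⟩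

theorem hFib_ofAmbient (F : V → Ext (V × V))
    (hF : (fun p : V × V => F p.2) ∈ ambientForms (V × V)) (v : Metric.sphere (0 : V) 1) :
    hFib v (ofAmbient F hF) = extComap (perpSq (v : V)) (F (v : V)) := by
  rw [ofAmbient, hFib_toHForms, rawFib_apply]
  exact extComap_comp (fibProj v) (tanIncl (v : V)) (F (v : V))

theorem ofAmbient_mem_hFormsBideg {F : V → Ext (V × V)}
    (hF : (fun p : V × V => F p.2) ∈ ambientForms (V × V)) {k l : ℕ}
    (h : ∀ v, F v ∈ bideg V V k l) : ofAmbient F hF ∈ hFormsBideg V k l :=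
  ⟨_, fun p => extComap_mem_bideg _ _ (h (p.2 : V)), rfl⟩

theorem hPullback_ofAmbient (f : V →ₗᵢ[ℝ] W) {F : W → Ext (W × W)} {G : V → Ext (V × V)}
    (hF : (fun p : W × W => F p.2) ∈ ambientForms (W × W))
    (hG : (fun p : V × V => G p.2) ∈ ambientForms (V × V))
    (h : ∀ v, extComap (LinearMap.prodMap f.toLinearMap f.toLinearMap) (F (f v)) = G v) :
    hPullback f (ofAmbient F hF) = ofAmbient G hG := by
  refine congrArg (toHForms V) (Subtype.ext ?_)
  refine (rawPullback_restrict f fun p => F p.2).trans ?_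
  exact congrArg (restrictToSphereBundle V) (funext fun p => h p.2)

end Fibres

/-! ### Coordinates on pairs of quaternionic vectors -/

section Coordinates

open Module
open scoped RealInnerProductSpace

/-- The standard basis quaternions. -/
def quatUnit : Fin 4 → ℍ[ℝ] := ![⟨1, 0, 0, 0⟩, ⟨0, 1, 0, 0⟩, ⟨0, 0, 1, 0⟩, ⟨0, 0, 0, 1⟩]

theorem quatUnit_zero : quatUnit 0 = 1 := rfl

theorem quatUnit_re (c : Fin 4) : (quatUnit c).re = if c = 0 then 1 else 0 := by
  fin_cases c <;> rfl

theorem quatUnit_imI (c : Fin 4) : (quatUnit c).imI = if c = 1 then 1 else 0 := by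
  fin_cases c <;> rfl

theorem quatUnit_imJ (c : Fin 4) : (quatUnit c).imJ = if c = 2 then 1 else 0 := by
  fin_cases c <;> rfl

theorem quatUnit_imK (c : Fin 4) : (quatUnit c).imK = if c = 3 then 1 else 0 := by
  fin_cases c <;> rfl

theorem quatUnit_mul (a b : Fin 4) :
    quatUnit a * quatUnit b = ∑ c, (quatCoef a c b : ℝ) • quatUnit c := by
  rw [Fin.sum_univ_four]
  apply Quaternion.ext <;>
    simp only [Quaternion.re_mul, Quaternion.imI_mul, Quaternion.imJ_mul, Quaternion.imK_mul,
      Quaternion.re_add, Quaternion.imI_add, Quaternion.imJ_add, Quaternion.imK_add,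
      Quaternion.re_smul, Quaternion.imI_smul, Quaternion.imJ_smul, Quaternion.imK_smul,
      quatUnit_re, quatUnit_imI, quatUnit_imJ, quatUnit_imK] <;>
    fin_cases a <;> fin_cases b <;> simp [quatCoef, quatIdx, quatSgn]

/-- The standard orthonormal basis of the quaternions. -/
def quatBasis : OrthonormalBasis (Fin 4) ℝ ℍ[ℝ] :=
  OrthonormalBasis.ofRepr Quaternion.linearIsometryEquivTuple

theorem quatBasis_apply (c : Fin 4) : quatBasis c = quatUnit c := by
  rw [quatBasis, OrthonormalBasis.coe_ofRepr]
  refine (LinearIsometryEquiv.symm_apply_eq _).mpr ?_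
  ext k
  rw [Quaternion.linearIsometryEquivTuple_apply]
  fin_cases k <;>
    simp [quatUnit_re, quatUnit_imI, quatUnit_imJ, quatUnit_imK, eq_comm]

variable {n m : ℕ}

/-- The standard real basis vectors of `ℍ^n`. -/
def unitVec (i : Fin n × Fin 4) : Hn n := PiLp.single 2 i.1 (quatUnit i.2)

/-- The standard orthonormal basis of `ℍ^n`. -/
def hnBasis (n : ℕ) : OrthonormalBasis (Fin n × Fin 4) ℝ (Hn n) :=
  (Pi.orthonormalBasis fun _ : Fin n => quatBasis).reindex (Equiv.sigmaEquivProd (Fin n) (Fin 4))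

theorem hnBasis_apply (i : Fin n × Fin 4) : hnBasis n i = unitVec i := by
  rw [hnBasis, OrthonormalBasis.reindex_apply, Pi.orthonormalBasis_apply, quatBasis_apply]
  rfl

theorem inner_unitVec (i j : Fin n × Fin 4) : ⟪unitVec i, unitVec j⟫ = if i = j then 1 else 0 := by
  rw [← hnBasis_apply, ← hnBasis_apply]
  exact (hnBasis n).inner_eq_ite i j

theorem sum_inner_unitVec (x : Hn n) : ∑ i, ⟪unitVec i, x⟫ • unitVec i = x := by
  have := (hnBasis n).sum_repr' x
  simpa only [hnBasis_apply] using this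

theorem sum_inner_mul_inner_unitVec (x y : Hn n) :
    ∑ i, ⟪unitVec i, x⟫ * ⟪unitVec i, y⟫ = ⟪x, y⟫ := by
  rw [← (hnBasis n).sum_inner_mul_inner x y]
  refine Finset.sum_congr rfl fun i _ => ?_
  rw [hnBasis_apply, real_inner_comm x]

theorem inner_eq_re_qForm (x y : Hn n) : ⟪x, y⟫ = (qForm x y).re := by
  rw [PiLp.inner_apply, qForm]
  have : (∑ i, star (x i) * y i).re = ∑ i, (star (x i) * y i).re :=
    map_sum ({ toFun := fun q => q.re, map_add' := fun _ _ => rfl, map_zero' := rfl } :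
      ℍ[ℝ] →+ ℝ) _ _
  rw [this]
  refine Finset.sum_congr rfl fun i _ => ?_
  rw [Quaternion.inner_def]
  simp

theorem inner_op_smul_left (x y : Hn n) (q : ℍ[ℝ]) :
    ⟪MulOpposite.op q • x, y⟫ = ⟪x, MulOpposite.op (star q) • y⟫ := by
  rw [inner_eq_re_qForm, inner_eq_re_qForm, qForm_smul_left, qForm_smul_right]
  simp
  ring

theorem op_smul_real_smul (q : ℍ[ℝ]) (r : ℝ) (x : Hn n) :
    MulOpposite.op q • r • x = r • MulOpposite.op q • x := by
  ext i : 1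
  simp

theorem op_real_smul_smul (q : ℍ[ℝ]) (r : ℝ) (x : Hn n) :
    MulOpposite.op (r • q) • x = r • MulOpposite.op q • x := by
  ext i : 1
  simp

theorem op_smul_unitVec (i : Fin n × Fin 4) (q : Fin 4) :
    MulOpposite.op (quatUnit q) • unitVec i
      = ∑ d, (quatCoef i.2 d q : ℝ) • unitVec (i.1, d) := by
  have h : ∀ p : ℍ[ℝ], (MulOpposite.op p • unitVec i : Hn n) = PiLp.single 2 i.1 (quatUnit i.2 * p) := by
    intro p
    ext j : 1
    by_cases hj : j = i.1
    · subst hj; simp [unitVec]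
    · simp [unitVec, hj]
  rw [h, quatUnit_mul]
  ext j : 1
  by_cases hj : j = i.1
  · subst hj; simp [unitVec]
  · simp [unitVec, hj]

/-- The two projections of `V × V`. -/
def pairProj (V : Type*) [AddCommGroup V] [Module ℝ V] (t : Fin 2) : V × V →ₗ[ℝ] V :=
  if t = 0 then LinearMap.fst ℝ V V else LinearMap.snd ℝ V V

/-- The two inclusions into `V × V`. -/
def pairIncl (V : Type*) [AddCommGroup V] [Module ℝ V] (t : Fin 2) : V →ₗ[ℝ] V × V :=
  if t = 0 then LinearMap.inl ℝ V V else LinearMap.inr ℝ V V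

theorem pairProj_pairIncl {V : Type*} [AddCommGroup V] [Module ℝ V] (t t' : Fin 2) (x : V) :
    pairProj V t (pairIncl V t' x) = if t = t' then x else 0 := by
  fin_cases t <;> fin_cases t' <;> simp [pairProj, pairIncl]

theorem pairProj_prodMap {V W : Type*} [AddCommGroup V] [Module ℝ V] [AddCommGroup W] [Module ℝ W]
    (f : V →ₗ[ℝ] W) (t : Fin 2) (w : V × V) :
    pairProj W t (LinearMap.prodMap f f w) = f (pairProj V t w) := by
  fin_cases t <;> simp [pairProj]

section CoFun

variable {V W : Type*} [NormedAddCommGroup V] [InnerProductSpace ℝ V]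
  [NormedAddCommGroup W] [InnerProductSpace ℝ W]

/-- The functional `w ↦ ⟪x, w_t⟫` on `V × V`. -/
def coFun (t : Fin 2) (x : V) : V × V →ₗ[ℝ] ℂ :=
  Complex.ofRealLI.toLinearMap ∘ₗ innerₛₗ ℝ x ∘ₗ pairProj V t

theorem coFun_apply (t : Fin 2) (x : V) (w : V × V) :
    coFun t x w = ((⟪x, pairProj V t w⟫ : ℝ) : ℂ) := rfl

theorem coFun_smul (t : Fin 2) (r : ℝ) (x : V) : coFun t (r • x) = (r : ℂ) • coFun t x := by
  refine LinearMap.ext fun w => ?_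
  simp [coFun_apply, inner_smul_left]

theorem coFun_add (t : Fin 2) (x y : V) : coFun t (x + y) = coFun t x + coFun t y := by
  refine LinearMap.ext fun w => ?_
  simp [coFun_apply, inner_add_left]

theorem coFun_zero (t : Fin 2) : coFun t (0 : V) = 0 := by
  refine LinearMap.ext fun w => ?_
  simp [coFun_apply]

theorem coFun_sum {J : Type*} (s : Finset J) (t : Fin 2) (x : J → V) :
    coFun t (∑ j ∈ s, x j) = ∑ j ∈ s, coFun t (x j) := by
  classical
  induction s using Finset.induction_on with
  | empty => simp [coFun_zero]
  | insert a s ha ih => rw [Finset.sum_insert ha, Finset.sum_insert ha, coFun_add, ih]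

end CoFun

/-- The standard real basis of `ℍ^n × ℍ^n`. -/
def realBasis (n : ℕ) : Basis (CoordIdx n) ℝ (Hn n × Hn n) :=
  ((hnBasis n).toBasis.prod (hnBasis n).toBasis).reindex
    { toFun := Sum.elim (fun i => (i.1, i.2, 0)) (fun i => (i.1, i.2, 1))
      invFun := fun i => if i.2.2 = 0 then Sum.inl (i.1, i.2.1) else Sum.inr (i.1, i.2.1)
      left_inv := by rintro (i | i) <;> simp
      right_inv := by rintro ⟨s, c, t⟩; fin_cases t <;> simp }

theorem realBasis_apply (i : CoordIdx n) :
    realBasis n i = pairIncl (Hn n) i.2.2 (unitVec (i.1, i.2.1)) := by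
  obtain ⟨s, c, t⟩ := i
  rw [realBasis, Basis.reindex_apply]
  fin_cases t <;> simp [pairIncl, hnBasis_apply]

/-- The coordinate functionals on `ℍ^n × ℍ^n`. -/
def coBasis (n : ℕ) : Basis (CoordIdx n) ℂ (Hn n × Hn n →ₗ[ℝ] ℂ) :=
  Basis.ofEquivFun ((realBasis n).constr ℂ).symm

theorem coBasis_coord (i : CoordIdx n) (φ : Hn n × Hn n →ₗ[ℝ] ℂ) :
    (coBasis n).coord i φ = φ (pairIncl (Hn n) i.2.2 (unitVec (i.1, i.2.1))) := by
  rw [← realBasis_apply]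
  simp [coBasis]

theorem coBasis_repr (i : CoordIdx n) (φ : Hn n × Hn n →ₗ[ℝ] ℂ) :
    (coBasis n).repr φ i = φ (pairIncl (Hn n) i.2.2 (unitVec (i.1, i.2.1))) :=
  coBasis_coord i φ

theorem coBasis_apply (i : CoordIdx n) : coBasis n i = coFun i.2.2 (unitVec (i.1, i.2.1)) := by
  refine (coBasis n).ext_elem fun k => ?_
  rw [Basis.repr_self, coBasis_repr, coFun_apply, pairProj_pairIncl, Finsupp.single_apply]
  obtain ⟨s, c, t⟩ := i
  obtain ⟨s', c', t'⟩ := k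
  by_cases h : t = t'
  · subst h
    rw [if_pos rfl, inner_unitVec]
    by_cases h2 : s = s' ∧ c = c'
    · simp [h2]
    · simp [h2]
  · simp [h]

/-- Evaluation of functionals at a vector. -/
def evalAt {T : Type*} [AddCommGroup T] [Module ℝ T] (w : T) : Dual ℂ (T →ₗ[ℝ] ℂ) where
  toFun φ := φ w
  map_add' _ _ := rfl
  map_smul' _ _ := rfl

theorem ct_coBasis (i : CoordIdx n) :
    ct (coBasis n) i = contr (evalAt (pairIncl (Hn n) i.2.2 (unitVec (i.1, i.2.1)))) := by
  rw [ct]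
  congr 1
  exact LinearMap.ext fun φ => coBasis_coord i φ

theorem contr_extComap {S T : Type*} [AddCommGroup S] [Module ℝ S] [AddCommGroup T] [Module ℝ T]
    (f : S →ₗ[ℝ] T) (w : S) (x : Ext T) :
    contr (evalAt w) (extComap f x) = extComap f (contr (evalAt (f w)) x) := by
  induction x using ext_left_induction with
  | scalar r => rw [AlgHom.commutes, contr_algebraMap, contr_algebraMap, map_zero]
  | add x y hx hy => simp only [map_add, hx, hy]
  | ι_mul x φ hx =>
    rw [map_mul, extComap_ι, contr_ι_mul, hx, contr_ι_mul, map_sub, map_smul, map_mul, extComap_ι]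
    rfl

theorem scalarPart_extComap {S T : Type*} [AddCommGroup S] [Module ℝ S] [AddCommGroup T]
    [Module ℝ T] (f : S →ₗ[ℝ] T) (x : Ext T) : scalarPart (extComap f x) = scalarPart x := by
  induction x using ext_left_induction with
  | scalar r => rw [AlgHom.commutes, AlgHom.commutes, AlgHom.commutes]
  | add x y hx hy => simp only [map_add, hx, hy]
  | ι_mul x φ hx => rw [map_mul, extComap_ι, scalarPart_ι_mul, scalarPart_ι_mul]

/-- Forms of bidegree `(k, l)` are eigenvectors of the number operators. -/
theorem mem_eigBideg_of_mem_bideg {k l : ℕ} {x : Ext (Hn n × Hn n)}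
    (hx : x ∈ bideg (Hn n) (Hn n) k l) : x ∈ eigBideg (coBasis n) ![(k : ℤ), (l : ℤ)] := by
  have key : ∀ (t : Fin 2) (φ : Hn n →ₗ[ℝ] ℂ) (d : Fin 2 → ℤ) (x : Ext (Hn n × Hn n)),
      x ∈ eigBideg (coBasis n) d → ExteriorAlgebra.ι ℂ (φ ∘ₗ pairProj (Hn n) t) * x
        ∈ eigBideg (coBasis n) (d + Pi.single t 1) := by
    intro t φ d x hx t'
    rw [num_ι_mul, hx t', mul_smul_comm]
    have h1 : ∑ i : CoordIdx n, ((if i.2.2 = t' then (1 : ℂ) else 0)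
        * (coBasis n).repr (φ ∘ₗ pairProj (Hn n) t) i) • coBasis n i
        = (if t = t' then (1 : ℂ) else 0) • (φ ∘ₗ pairProj (Hn n) t) := by
      conv_rhs => rw [← (coBasis n).sum_repr (φ ∘ₗ pairProj (Hn n) t)]
      rw [Finset.smul_sum]
      refine Finset.sum_congr rfl fun i _ => ?_
      rw [smul_smul, coBasis_repr, LinearMap.comp_apply, pairProj_pairIncl]
      by_cases h : t = i.2.2
      · rw [h]
      · simp [h]
    rw [h1, map_smul, smul_mul_assoc, ← add_smul]
    congr 1
    by_cases h : t = t'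
    · subst h; simp
    · simp [h, Ne.symm h]
  have h1 : (1 : Ext (Hn n × Hn n)) ∈ eigBideg (coBasis n) 0 := fun t => by
    rw [num_one]; simp
  have h2 : ∀ l : ℕ, oneSnd (Hn n) (Hn n) ^ l ≤ eigBideg (coBasis n) ![0, (l : ℤ)] := by
    intro l
    induction l with
    | zero =>
      rw [pow_zero, Submodule.one_le]
      convert h1 using 2
      funext t; fin_cases t <;> simp
    | succ l ih =>
      rw [pow_succ', Submodule.mul_le]
      rintro _ ⟨φ, rfl⟩ y hy
      have h := key 1 φ _ y (ih hy)
      have h' : ![0, (l : ℤ)] + Pi.single 1 1 = ![0, ((l + 1 : ℕ) : ℤ)] := by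
        funext t; fin_cases t <;> simp
      rwa [h'] at h
  have h3 : ∀ k : ℕ, bideg (Hn n) (Hn n) k l ≤ eigBideg (coBasis n) ![(k : ℤ), (l : ℤ)] := by
    intro k
    induction k with
    | zero => rw [bideg, pow_zero, one_mul]; exact h2 l
    | succ k ih =>
      rw [bideg, pow_succ', mul_assoc, Submodule.mul_le]
      rintro _ ⟨φ, rfl⟩ y hy
      have h := key 0 φ _ y (ih hy)
      have h' : ![(k : ℤ), (l : ℤ)] + Pi.single 0 1 = ![((k + 1 : ℕ) : ℤ), (l : ℤ)] := by
        funext t; fin_cases t <;> simp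
      rwa [h'] at h
  exact h3 k hx

end Coordinates

/-! ### From the group `Sp(n)` to its Lie algebra -/

section LieAlgebra

open Module
open scoped RealInnerProductSpace

variable {n : ℕ}

/-- The diagonal action of a linear map on pairs. -/
def diagMap {V W : Type*} [AddCommGroup V] [Module ℝ V] [AddCommGroup W] [Module ℝ W]
    (f : V →ₗ[ℝ] W) : V × V →ₗ[ℝ] W × W := LinearMap.prodMap f f

/-- The derivation of the exterior algebra induced by an endomorphism of `ℍ^n`. -/
def der (B : Hn n →ₗ[ℝ] Hn n) : End ℂ (Ext (Hn n × Hn n)) :=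
  ∑ i, wedge (coBasis n i ∘ₗ diagMap B) * ct (coBasis n) i

theorem der_add (B B' : Hn n →ₗ[ℝ] Hn n) : der (B + B') = der B + der B' := by
  rw [der, der, der, ← Finset.sum_add_distrib]
  refine Finset.sum_congr rfl fun i _ => ?_
  rw [← add_mul, ← wedge_add]
  congr 2
  refine LinearMap.ext fun w => ?_
  exact map_add (coBasis n i) (diagMap B w) (diagMap B' w)

theorem der_smul (r : ℝ) (B : Hn n →ₗ[ℝ] Hn n) : der (r • B) = (r : ℂ) • der B := by
  rw [der, der, Finset.smul_sum]
  refine Finset.sum_congr rfl fun i _ => ?_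
  rw [← smul_mul_assoc, ← wedge_smul]
  congr 2
  refine LinearMap.ext fun w => ?_
  exact (map_smul (coBasis n i) r (diagMap B w)).trans Complex.real_smul

theorem der_sub (B B' : Hn n →ₗ[ℝ] Hn n) : der (B - B') = der B - der B' := by
  have h : B - B' = B + (-1 : ℝ) • B' := by simp [sub_eq_add_neg]
  rw [h, der_add, der_smul, Complex.ofReal_neg, Complex.ofReal_one, sub_eq_add_neg]
  refine congrArg _ (LinearMap.ext fun x => ?_)
  exact neg_one_smul ℂ (der B' x)

theorem der_scalar (B : Hn n →ₗ[ℝ] Hn n) (r : ℂ) :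
    der B (algebraMap ℂ (Ext (Hn n × Hn n)) r) = 0 := by
  simp [der, ct, contr_algebraMap]

theorem der_ι_mul (B : Hn n →ₗ[ℝ] Hn n) (φ : Hn n × Hn n →ₗ[ℝ] ℂ) (x : Ext (Hn n × Hn n)) :
    der B (ExteriorAlgebra.ι ℂ φ * x)
      = ExteriorAlgebra.ι ℂ (φ ∘ₗ diagMap B) * x + ExteriorAlgebra.ι ℂ φ * der B x := by
  have h : φ ∘ₗ diagMap B = ∑ i, (coBasis n).repr φ i • (coBasis n i ∘ₗ diagMap B) := by
    refine LinearMap.ext fun w => ?_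
    have h1 := DFunLike.congr_fun ((coBasis n).sum_repr φ) (diagMap B w)
    rw [LinearMap.sum_apply] at h1 ⊢
    exact h1.symm
  rw [h, map_sum, Finset.sum_mul, der, LinearMap.sum_apply, LinearMap.sum_apply, Finset.mul_sum,
    ← Finset.sum_add_distrib]
  refine Finset.sum_congr rfl fun i _ => ?_
  rw [End.mul_apply, End.mul_apply, ct, contr_ι_mul, map_sub, map_smul, map_smul, smul_mul_assoc,
    ← wedge_apply, ← wedge_apply, ← wedge_apply, wedge_comm φ, sub_eq_add_neg]
  rfl

/-- The path of linear maps starts at the identity with velocity `C₂`, so pulling back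
differentiates to the derivation `der C₂`. Composing with functionals avoids a topology on the
exterior algebra; letting `ℓ` vary in the induction allows the leading one-form to be absorbed into
it. -/
theorem hasDerivAt_extComap {C₀ C₁ C₂ : Hn n →ₗ[ℝ] Hn n} (hC : C₀ + C₁ = LinearMap.id)
    (x : Ext (Hn n × Hn n)) (ℓ : Ext (Hn n × Hn n) →ₗ[ℂ] ℂ) :
    HasDerivAt (fun u : ℝ =>
      ℓ (extComap (diagMap (C₀ + Real.cos u • C₁ + Real.sin u • C₂)) x)) (ℓ (der C₂ x)) 0 := by
  induction x using ext_left_induction generalizing ℓ with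
  | scalar r =>
    simp only [AlgHom.commutes, der_scalar, map_zero]
    exact hasDerivAt_const _ _
  | add x y hx hy =>
    simp only [map_add]
    exact (hx ℓ).add (hy ℓ)
  | ι_mul x φ hx =>
    let L : (Hn n →ₗ[ℝ] Hn n) → (Ext (Hn n × Hn n) →ₗ[ℂ] ℂ) :=
      fun C => ℓ ∘ₗ wedge (φ ∘ₗ diagMap C)
    have h1 : ∀ u : ℝ, ℓ (extComap (diagMap (C₀ + Real.cos u • C₁ + Real.sin u • C₂))
        (ExteriorAlgebra.ι ℂ φ * x))
        = L C₀ (extComap (diagMap (C₀ + Real.cos u • C₁ + Real.sin u • C₂)) x)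
        + (Real.cos u : ℂ) * L C₁ (extComap (diagMap (C₀ + Real.cos u • C₁ + Real.sin u • C₂)) x)
        + (Real.sin u : ℂ)
          * L C₂ (extComap (diagMap (C₀ + Real.cos u • C₁ + Real.sin u • C₂)) x) := by
      intro u
      have h2 : φ ∘ₗ diagMap (C₀ + Real.cos u • C₁ + Real.sin u • C₂)
          = φ ∘ₗ diagMap C₀ + (Real.cos u : ℂ) • (φ ∘ₗ diagMap C₁)
            + (Real.sin u : ℂ) • (φ ∘ₗ diagMap C₂) := by
        refine LinearMap.ext fun w => ?_
        have h3 : diagMap (C₀ + Real.cos u • C₁ + Real.sin u • C₂) w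
          = diagMap C₀ w + Real.cos u • diagMap C₁ w + Real.sin u • diagMap C₂ w := rfl
        rw [LinearMap.comp_apply, h3, map_add, map_add, map_smul, map_smul, Complex.real_smul,
          Complex.real_smul]
        rfl
      rw [map_mul, extComap_ι, h2, map_add, map_add, map_smul, map_smul, add_mul, add_mul,
        smul_mul_assoc, smul_mul_assoc, map_add, map_add, map_smul, map_smul]
      rfl
    simp only [h1]
    have hc : HasDerivAt (fun u : ℝ => (Real.cos u : ℂ)) 0 0 := by
      simpa using (Real.hasDerivAt_cos 0).ofReal_comp
    have hs : HasDerivAt (fun u : ℝ => (Real.sin u : ℂ)) 1 0 := by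
      simpa using (Real.hasDerivAt_sin 0).ofReal_comp
    have h4 := ((hx (L C₀)).add (hc.mul (hx (L C₁)))).add (hs.mul (hx (L C₂)))
    refine h4.congr_deriv ?_
    have h5 : extComap (diagMap (C₀ + Real.cos 0 • C₁ + Real.sin 0 • C₂)) x = x := by
      rw [Real.cos_zero, Real.sin_zero, one_smul, zero_smul, add_zero, hC]
      exact extComap_id x
    have h6 : φ = φ ∘ₗ diagMap C₀ + φ ∘ₗ diagMap C₁ := by
      refine LinearMap.ext fun w => ?_
      have h7 : w = diagMap C₀ w + diagMap C₁ w := (congrArg (fun C => diagMap C w) hC).symm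
      conv_lhs => rw [h7]
      rw [map_add]
      rfl
    have h8 : ℓ (ExteriorAlgebra.ι ℂ φ * der C₂ x)
        = ℓ (ExteriorAlgebra.ι ℂ (φ ∘ₗ diagMap C₀) * der C₂ x)
          + ℓ (ExteriorAlgebra.ι ℂ (φ ∘ₗ diagMap C₁) * der C₂ x) := by
      conv_lhs => rw [h6]
      rw [map_add, add_mul, map_add]
    rw [h5, der_ι_mul, map_add, h8, Real.cos_zero, Real.sin_zero]
    change _ = _ + _
    simp only [Complex.ofReal_one, Complex.ofReal_zero, zero_mul, one_mul, zero_add, add_zero]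
    change _ + _ + ℓ (ExteriorAlgebra.ι ℂ (φ ∘ₗ diagMap C₂) * x) = _
    rw [add_comm]
    rfl

/-- The rank one map `x ↦ y h K(y', x)`. -/
def rankOne (y y' : Hn n) (h : ℍ[ℝ]) : Hn n →ₗ[ℝ] Hn n where
  toFun x := MulOpposite.op (h * qForm y' x) • y
  map_add' x x' := by rw [qForm_add_right, mul_add, MulOpposite.op_add, add_smul]
  map_smul' r x := by
    rw [real_smul_eq, qForm_smul_right, Quaternion.mul_coe_eq_smul, mul_smul_comm,
      op_real_smul_smul]
    rfl

theorem rankOne_apply (y y' : Hn n) (h : ℍ[ℝ]) (x : Hn n) :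
    rankOne y y' h x = MulOpposite.op (h * qForm y' x) • y := rfl

/-- For nonzero `y`, the maps `x ↦ x + y ρ⁻¹ (exp(u h) - 1) K(y, x)` with `ρ = K(y, y)` are
isometries that multiply by `exp(u h)` along the line of `y`. They fix the stabilized vector because
`y` is orthogonal to it. Pulling `e` back along them is constant in `u`, and the derivative at `u =
0` is `ρ⁻¹ der (rankOne y y h) e`. -/
theorem der_rankOne_eq_zero {i₀ : Fin n} {e : Ext (Hn n × Hn n)}
    (he : ∀ A : QuatIsometry n n, A.toLin (unitVec (i₀, 0)) = unitVec (i₀, 0) →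
      extComap (diagMap A.toIsometry.toLinearMap) e = e)
    {y : Hn n} (hy : y i₀ = 0) {h : ℍ[ℝ]} (hh : star h = -h) (hh' : h * h = -1) :
    der (rankOne y y h) e = 0 := by
  by_cases hy0 : y = 0
  · have : rankOne y y h = 0 := LinearMap.ext fun x => by rw [rankOne_apply, hy0, smul_zero]; rfl
    rw [this]
    simpa using congrArg (fun P => P e) (der_smul 0 (0 : Hn n →ₗ[ℝ] Hn n))
  set ρ : ℝ := ‖y‖ ^ 2 with hρ
  have hρ0 : ρ ≠ 0 := by simp [hρ, hy0]
  let C₁ := ρ⁻¹ • rankOne y y 1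
  let C₂ := ρ⁻¹ • rankOne y y h
  -- For `l = ρ⁻¹ (exp(u h) - 1)` the isometry condition reads `|1 + ρ l| = 1`, which holds since
  -- `exp(u h) = cos u + h sin u` has norm one.
  have hl : ∀ u : ℝ, ρ⁻¹ • (((Real.cos u - 1 : ℝ) : ℍ[ℝ]) + Real.sin u • h)
      + star (ρ⁻¹ • (((Real.cos u - 1 : ℝ) : ℍ[ℝ]) + Real.sin u • h))
      + star (ρ⁻¹ • (((Real.cos u - 1 : ℝ) : ℍ[ℝ]) + Real.sin u • h)) * qForm y y
        * (ρ⁻¹ • (((Real.cos u - 1 : ℝ) : ℍ[ℝ]) + Real.sin u • h)) = 0 := by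
    intro u
    rw [qForm_self, ← hρ, Quaternion.mul_coe_eq_smul]
    simp only [Quaternion.star_smul, star_add, Quaternion.star_coe, hh, smul_neg]
    have h1 : (((Real.cos u - 1 : ℝ) : ℍ[ℝ]) + -(Real.sin u • h))
        * (((Real.cos u - 1 : ℝ) : ℍ[ℝ]) + Real.sin u • h)
        = ((2 - 2 * Real.cos u : ℝ) : ℍ[ℝ]) := by
      have h2 : ∀ a b : ℝ, ((a : ℍ[ℝ]) + -(b • h)) * ((a : ℍ[ℝ]) + b • h)
          = ((a ^ 2 + b ^ 2 : ℝ) : ℍ[ℝ]) := by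
        intro a b
        rw [add_mul, mul_add, mul_add, neg_mul, neg_mul, smul_mul_smul_comm, hh',
          Quaternion.coe_mul_eq_smul, Quaternion.coe_mul_eq_smul, Quaternion.mul_coe_eq_smul,
          smul_smul]
        have : ((a ^ 2 + b ^ 2 : ℝ) : ℍ[ℝ]) = a • (a : ℍ[ℝ]) + (b * b) • 1 := by
          rw [← Quaternion.coe_mul_eq_smul, ← Quaternion.coe_mul_eq_smul]
          push_cast
          rw [mul_one, sq, sq]
        rw [this, smul_neg, neg_neg, mul_smul]
        abel
      rw [h2]
      congr 1
      have := Real.sin_sq_add_cos_sq u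
      nlinarith
    rw [smul_mul_assoc, smul_mul_smul_comm, h1, smul_smul]
    have h3 : ρ * (ρ⁻¹ * ρ⁻¹) = ρ⁻¹ := by field_simp
    rw [h3, ← smul_add, ← smul_add]
    have h4 : ((Real.cos u - 1 : ℝ) : ℍ[ℝ]) + Real.sin u • h
        + (((Real.cos u - 1 : ℝ) : ℍ[ℝ]) + -(Real.sin u • h))
        + ((2 - 2 * Real.cos u : ℝ) : ℍ[ℝ])
        = ((Real.cos u - 1 + (Real.cos u - 1) + (2 - 2 * Real.cos u) : ℝ) : ℍ[ℝ]) := by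
      push_cast; abel
    rw [h4]
    have h5 : (Real.cos u - 1 + (Real.cos u - 1) + (2 - 2 * Real.cos u) : ℝ) = 0 := by ring
    rw [h5, Quaternion.coe_zero, smul_zero]
  have hG : ∀ u : ℝ, (quatReflection y _ (hl u)).toIsometry.toLinearMap
      = (LinearMap.id - C₁) + Real.cos u • C₁ + Real.sin u • C₂ := by
    intro u
    refine LinearMap.ext fun x => ?_
    change x + MulOpposite.op ((ρ⁻¹ • (((Real.cos u - 1 : ℝ) : ℍ[ℝ]) + Real.sin u • h))
      * qForm y x) • y = (x - ρ⁻¹ • MulOpposite.op (1 * qForm y x) • y)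
      + Real.cos u • ρ⁻¹ • MulOpposite.op (1 * qForm y x) • y
      + Real.sin u • ρ⁻¹ • MulOpposite.op (h * qForm y x) • y
    have h6 : (ρ⁻¹ • (((Real.cos u - 1 : ℝ) : ℍ[ℝ]) + Real.sin u • h)) * qForm y x
        = ρ⁻¹ • ((Real.cos u - 1) • (1 * qForm y x) + Real.sin u • (h * qForm y x)) := by
      rw [smul_mul_assoc, add_mul, Quaternion.coe_mul_eq_smul, one_mul, smul_mul_assoc]
    rw [h6, op_real_smul_smul, MulOpposite.op_add, add_smul, op_real_smul_smul, op_real_smul_smul,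
      sub_smul, one_smul, smul_add, smul_sub, smul_comm ρ⁻¹ (Real.cos u), smul_comm ρ⁻¹ (Real.sin u)]
    abel
  have key : ∀ ℓ : Ext (Hn n × Hn n) →ₗ[ℂ] ℂ, ℓ (der C₂ e) = 0 := by
    intro ℓ
    have h1 := hasDerivAt_extComap (C₀ := LinearMap.id - C₁) (C₁ := C₁) (C₂ := C₂)
      (sub_add_cancel _ _) e ℓ
    have h2 : ∀ u : ℝ, extComap (diagMap ((LinearMap.id - C₁) + Real.cos u • C₁ + Real.sin u • C₂)) e
        = e := by
      intro u
      rw [← hG]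
      refine he _ ?_
      rw [quatReflection_apply, ← star_qForm]
      have : qForm (unitVec (i₀, 0)) y = 0 := by
        rw [unitVec, qForm_single_left, hy, mul_zero]
      rw [this, star_zero, mul_zero, MulOpposite.op_zero, zero_smul, add_zero]
    simp only [h2] at h1
    exact h1.unique (hasDerivAt_const _ _)
  have h1 := (Module.forall_dual_apply_eq_zero_iff ℂ (der C₂ e)).mp key
  rw [der_smul, LinearMap.smul_apply] at h1
  exact (smul_eq_zero.mp h1).resolve_left (by simpa using hρ0)

end LieAlgebra

/-! ### Invariance under all matrix units of the Lie algebra -/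

section LieInvariance

open Module
open scoped RealInnerProductSpace

variable {n : ℕ}

theorem rankOne_add_add (y y' : Hn n) (h : ℍ[ℝ]) : rankOne (y + y') (y + y') h
    = rankOne y y h + (rankOne y y' h + rankOne y' y h) + rankOne y' y' h := by
  refine LinearMap.ext fun x => ?_
  simp only [LinearMap.add_apply, rankOne_apply, qForm_add_left, mul_add, MulOpposite.op_add,
    add_smul, smul_add]
  abel

/-- Polarization of `der_rankOne_eq_zero` in `y`. -/
theorem der_rankOne_add_rankOne_eq_zero {i₀ : Fin n} {e : Ext (Hn n × Hn n)}
    (he : ∀ A : QuatIsometry n n, A.toLin (unitVec (i₀, 0)) = unitVec (i₀, 0) →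
      extComap (diagMap A.toIsometry.toLinearMap) e = e)
    {y y' : Hn n} (hy : y i₀ = 0) (hy' : y' i₀ = 0) {h : ℍ[ℝ]} (hh : star h = -h)
    (hh' : h * h = -1) : der (rankOne y y' h + rankOne y' y h) e = 0 := by
  have h1 := der_rankOne_eq_zero he (y := y + y') (by simp [hy, hy']) hh hh'
  rw [rankOne_add_add, der_add, der_add, LinearMap.add_apply, LinearMap.add_apply,
    der_rankOne_eq_zero he hy hh hh', der_rankOne_eq_zero he hy' hh hh', zero_add, add_zero] at h1
  exact h1

theorem op_smul_unitVec_zero (s : Fin n) (p : ℍ[ℝ]) :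
    (MulOpposite.op p • unitVec (s, 0) : Hn n) = PiLp.single 2 s p := by
  ext j : 1
  by_cases hj : j = s
  · subst hj; simp [unitVec, quatUnit_zero]
  · simp [unitVec, hj]

theorem rankOne_unitVec (h : Fin 4) (s s' σ : Fin n) (d : Fin 4) :
    rankOne (unitVec (s, 0)) (unitVec (s', 0)) (quatUnit h) (unitVec (σ, d))
      = if s' = σ then ∑ c, (quatCoef h c d : ℝ) • unitVec (s, c) else 0 := by
  rw [rankOne_apply, unitVec, qForm_single_left, quatUnit_zero, star_one, one_mul]
  by_cases hσ : s' = σ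
  · subst hσ
    rw [if_pos rfl]
    have h1 : (unitVec (s', d) : Hn n) s' = quatUnit d := by simp [unitVec]
    have h2 := op_smul_unitVec_zero s (quatUnit h * quatUnit d)
    rw [h1]
    refine h2.trans ?_
    rw [quatUnit_mul]
    ext j : 1
    by_cases hj : j = s
    · subst hj; simp [unitVec]
    · simp [unitVec, hj]
  · have h1 : (unitVec (σ, d) : Hn n) s' = 0 := by simp [unitVec, hσ]
    rw [h1, mul_zero, MulOpposite.op_zero, zero_smul, if_neg hσ]

theorem coBasis_comp_rankOne (h : Fin 4) (s s' : Fin n) (i : CoordIdx n) :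
    coBasis n i ∘ₗ diagMap (rankOne (unitVec (s, 0)) (unitVec (s', 0)) (quatUnit h))
      = if i.1 = s then ∑ d, (quatCoef h i.2.1 d : ℂ) • coBasis n (s', d, i.2.2) else 0 := by
  refine (coBasis n).ext_elem fun k => ?_
  rw [coBasis_repr, coBasis_repr, LinearMap.comp_apply, coBasis_apply, coFun_apply, diagMap,
    pairProj_prodMap, pairProj_pairIncl]
  obtain ⟨σ, c, t⟩ := i
  obtain ⟨σ', d, t'⟩ := k
  have hR : ∀ d', coBasis n (s', d', t) (pairIncl (Hn n) t' (unitVec (σ', d)))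
      = if t = t' ∧ s' = σ' ∧ d' = d then 1 else 0 := by
    intro d'
    rw [coBasis_apply, coFun_apply, pairProj_pairIncl]
    by_cases ht : t = t'
    · simp only [ht, inner_unitVec, Prod.mk.injEq, true_and, if_true]
      split_ifs <;> simp
    · simp [ht]
  by_cases ht : t = t'
  · subst ht
    simp only [if_pos]
    rw [rankOne_unitVec]
    by_cases hσ' : s' = σ'
    · subst hσ'
      by_cases hσ : σ = s
      · subst hσ
        simp only [if_true, inner_sum, inner_smul_right, inner_unitVec, LinearMap.sum_apply,
          LinearMap.smul_apply, hR]
        simp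
      · simp [hσ, inner_sum, inner_smul_right, inner_unitVec]
    · by_cases hσ : σ = s
      · subst hσ
        simp only [if_true, LinearMap.sum_apply, LinearMap.smul_apply, hR]
        simp [hσ']
      · simp [hσ, hσ']
  · by_cases hσ : σ = s
    · simp only [hσ, if_true, LinearMap.sum_apply, LinearMap.smul_apply, hR]
      simp [ht]
    · simp [hσ, ht]

theorem der_rankOne_unitVec (h : Fin 4) (s s' : Fin n) :
    der (rankOne (unitVec (s, 0)) (unitVec (s', 0)) (quatUnit h)) = lop (coBasis n) h s s' := by
  rw [der, lop, Fintype.sum_prod_type, Finset.sum_eq_single s]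
  · rw [Fintype.sum_prod_type]
    refine Finset.sum_congr rfl fun c _ => ?_
    rw [Finset.sum_comm]
    refine Finset.sum_congr rfl fun t _ => ?_
    rw [coBasis_comp_rankOne, if_pos rfl, wedge_sum, Finset.sum_mul]
    refine Finset.sum_congr rfl fun d _ => ?_
    rw [wedge_smul, smul_mul_assoc]
    rfl
  · intro σ _ hσ
    refine Finset.sum_eq_zero fun i _ => ?_
    rw [coBasis_comp_rankOne, if_neg hσ]
    have : wedge (0 : Hn n × Hn n →ₗ[ℝ] ℂ) = 0 := by
      simpa using wedge_smul (0 : ℂ) (0 : Hn n × Hn n →ₗ[ℝ] ℂ)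
    rw [this, zero_mul]
  · simp

/-- Left multiplication by `e_h` has adjoint left multiplication by `ē_h`, which is `e_h` for `h =
0` and `-e_h` otherwise. -/
theorem quatCoef_swap (h c d : Fin 4) :
    quatCoef h c d = (if h = 0 then 1 else -1) * quatCoef h d c := by
  revert h c d; decide

theorem lopAdj_eq (h : Fin 4) (s s' : Fin n) : lopAdj (coBasis n) h s s'
    = (if h = 0 then (1 : ℂ) else -1) • lop (coBasis n) h s' s := by
  rw [lopAdj, lop, Finset.sum_comm, Finset.smul_sum]
  refine Finset.sum_congr rfl fun d _ => ?_
  rw [Finset.smul_sum]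
  refine Finset.sum_congr rfl fun c _ => ?_
  rw [Finset.smul_sum]
  refine Finset.sum_congr rfl fun t _ => ?_
  rw [smul_smul, quatCoef_swap h c d]
  push_cast
  rfl

theorem star_quatUnit {h : Fin 4} (hh : h ≠ 0) : star (quatUnit h) = -quatUnit h := by
  apply Quaternion.ext <;> simp [quatUnit_re, hh]

theorem quatUnit_mul_self {h : Fin 4} (hh : h ≠ 0) : quatUnit h * quatUnit h = -1 := by
  rw [← quatUnit_zero, quatUnit_mul, Fin.sum_univ_four]
  fin_cases h
  · exact absurd rfl hh
  all_goals simp [quatCoef, quatIdx, quatSgn]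

/-- Forms invariant under the stabilizer of a unit vector in `Sp(n)` are invariant under its
Lie algebra. -/
theorem mem_lieInv_of_invariant {i₀ : Fin n} {e : Ext (Hn n × Hn n)}
    (he : ∀ A : QuatIsometry n n, A.toLin (unitVec (i₀, 0)) = unitVec (i₀, 0) →
      extComap (diagMap A.toIsometry.toLinearMap) e = e) :
    e ∈ lieInv (coBasis n) (Finset.univ.erase i₀) := by
  intro h s hs s' hs'
  have hs0 : ∀ σ ∈ Finset.univ.erase i₀, (unitVec (σ, 0) : Hn n) i₀ = 0 := by
    intro σ hσ
    simp [unitVec, (Finset.ne_of_mem_erase hσ).symm]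
  by_cases hh : h = 0
  · subst hh
    have h1 := star_quatUnit (h := 1) (by decide)
    have h2 := quatUnit_mul_self (h := 1) (by decide)
    have h3 := der_rankOne_add_rankOne_eq_zero he (hs0 s hs)
      (y' := MulOpposite.op (quatUnit 1) • unitVec (s', 0)) (by simp [hs0 s' hs']) h1 h2
    have h4 : rankOne (unitVec (s, 0)) (MulOpposite.op (quatUnit 1) • unitVec (s', 0)) (quatUnit 1)
        + rankOne (MulOpposite.op (quatUnit 1) • unitVec (s', 0)) (unitVec (s, 0)) (quatUnit 1)
        = rankOne (unitVec (s, 0)) (unitVec (s', 0)) (quatUnit 0)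
          - rankOne (unitVec (s', 0)) (unitVec (s, 0) : Hn n) (quatUnit 0) := by
      refine LinearMap.ext fun x => ?_
      simp only [LinearMap.add_apply, LinearMap.sub_apply, rankOne_apply, qForm_smul_left, h1,
        smul_smul, ← MulOpposite.op_mul, ← mul_assoc, mul_neg, h2, neg_neg, quatUnit_zero]
      rw [neg_mul, one_mul, MulOpposite.op_neg, neg_smul, sub_eq_add_neg]
    rw [h4, der_sub, der_rankOne_unitVec, der_rankOne_unitVec] at h3
    rw [zop, lopAdj_eq, if_pos rfl, one_smul]
    exact h3
  · have h3 := der_rankOne_add_rankOne_eq_zero he (hs0 s hs) (hs0 s' hs') (star_quatUnit hh)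
      (quatUnit_mul_self hh)
    rw [der_add, der_rankOne_unitVec, der_rankOne_unitVec] at h3
    rw [zop, lopAdj_eq, if_neg hh, LinearMap.sub_apply, LinearMap.smul_apply, neg_smul, one_smul,
      sub_neg_eq_add]
    exact h3

end LieInvariance

/-! ### The generators -/

section Generators

open Module
open scoped RealInnerProductSpace

variable {n m : ℕ}

/-- Right multiplication by a quaternion, as a real-linear map. -/
def opLin (q : ℍ[ℝ]) : Hn n →ₗ[ℝ] Hn n where
  toFun x := MulOpposite.op q • x
  map_add' := smul_add _
  map_smul' r x := op_smul_real_smul q r x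

theorem opLin_apply (q : ℍ[ℝ]) (x : Hn n) : opLin q x = MulOpposite.op q • x := rfl

theorem inner_opLin_left (q : ℍ[ℝ]) (x y : Hn n) : ⟪opLin q x, y⟫ = ⟪x, opLin (star q) y⟫ :=
  inner_op_smul_left x y q

theorem opLin_opLin (p q : ℍ[ℝ]) (x : Hn n) : opLin p (opLin q x) = opLin (q * p) x := by
  rw [opLin_apply, opLin_apply, opLin_apply, smul_smul, ← MulOpposite.op_mul]

theorem opLin_one (x : Hn n) : opLin 1 x = x := one_smul _ x

theorem opLin_add (p q : ℍ[ℝ]) (x : Hn n) : opLin (p + q) x = opLin p x + opLin q x := by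
  rw [opLin_apply, MulOpposite.op_add, add_smul]; rfl

theorem opLin_smul (r : ℝ) (q : ℍ[ℝ]) (x : Hn n) : opLin (r • q) x = r • opLin q x :=
  op_real_smul_smul q r x

/-- The one-form `w ↦ ⟪x, w_t⟫`. -/
def oneForm (t : Fin 2) (x : Hn n) : Ext (Hn n × Hn n) := ExteriorAlgebra.ι ℂ (coFun t x)

theorem oneForm_add (t : Fin 2) (x y : Hn n) : oneForm t (x + y) = oneForm t x + oneForm t y := by
  rw [oneForm, coFun_add, map_add]; rfl

theorem oneForm_smul (t : Fin 2) (r : ℝ) (x : Hn n) :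
    oneForm t (r • x) = (r : ℂ) • oneForm t x := by
  rw [oneForm, coFun_smul, map_smul]; rfl

theorem oneForm_zero (t : Fin 2) : oneForm t (0 : Hn n) = 0 := by
  rw [oneForm, coFun_zero, map_zero]

theorem oneForm_sum {J : Type*} (s : Finset J) (t : Fin 2) (x : J → Hn n) :
    oneForm t (∑ j ∈ s, x j) = ∑ j ∈ s, oneForm t (x j) := by
  rw [oneForm, coFun_sum, map_sum]; rfl

theorem oneForm_mul_oneForm_swap (t t' : Fin 2) (x y : Hn n) :
    oneForm t x * oneForm t' y = -(oneForm t' y * oneForm t x) :=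
  eq_neg_of_add_eq_zero_left (ExteriorAlgebra.ι_add_mul_swap _ _)

theorem extComap_oneForm {f : Hn n →ₗ[ℝ] Hn m} {y : Hn m} {x : Hn n}
    (h : ∀ w, ⟪y, f w⟫ = ⟪x, w⟫) (t : Fin 2) :
    extComap (diagMap f) (oneForm t y) = oneForm t x := by
  rw [oneForm, extComap_ι, oneForm]
  congr 1
  refine LinearMap.ext fun w => ?_
  rw [LinearMap.comp_apply, coFun_apply, coFun_apply, diagMap, pairProj_prodMap, h]

theorem oneForm_mem_bideg (t : Fin 2) (x : Hn n) : oneForm t x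
    ∈ bideg (Hn n) (Hn n) ((Pi.single t 1 : Fin 2 → ℕ) 0) ((Pi.single t 1 : Fin 2 → ℕ) 1) := by
  fin_cases t
  · have h : bideg (Hn n) (Hn n) 1 0 = oneFst (Hn n) (Hn n) := by
      rw [bideg, pow_one, pow_zero, mul_one]
    change _ ∈ bideg (Hn n) (Hn n) 1 0
    rw [h]
    exact ⟨Complex.ofRealLI.toLinearMap ∘ₗ innerₛₗ ℝ x, rfl⟩
  · have h : bideg (Hn n) (Hn n) 0 1 = oneSnd (Hn n) (Hn n) := by
      rw [bideg, pow_one, pow_zero, one_mul]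
    change _ ∈ bideg (Hn n) (Hn n) 0 1
    rw [h]
    exact ⟨Complex.ofRealLI.toLinearMap ∘ₗ innerₛₗ ℝ x, rfl⟩

theorem oneForm_eq_sum (t : Fin 2) (x : Hn n) :
    oneForm t x = ∑ i, ((⟪unitVec i, x⟫ : ℝ) : ℂ) • oneForm t (unitVec i) := by
  conv_lhs => rw [← sum_inner_unitVec x]
  rw [oneForm_sum]
  exact Finset.sum_congr rfl fun i _ => oneForm_smul t _ _

theorem oneForm_opLin_mem_ambientForms (t : Fin 2) (q : ℍ[ℝ]) :
    (fun p : Hn n × Hn n => oneForm t (opLin q p.2)) ∈ ambientForms (Hn n × Hn n) := by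
  have h : (fun p : Hn n × Hn n => oneForm t (opLin q p.2))
      = ∑ i, (fun p : Hn n × Hn n => algebraMap ℂ (Ext (Hn n × Hn n))
          ((⟪unitVec i, opLin q p.2⟫ : ℝ) : ℂ)) * fun _ => oneForm t (unitVec i) := by
    funext p
    rw [Finset.sum_apply, oneForm_eq_sum]
    exact Finset.sum_congr rfl fun i _ => Algebra.smul_def _ _
  rw [h]
  refine sum_mem fun i _ => mul_mem (Algebra.subset_adjoin (Or.inl ⟨_, ?_, rfl⟩))
    (Algebra.subset_adjoin (Or.inr ⟨_, rfl⟩))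
  exact (LinearMap.toContinuousLinearMap (Complex.ofRealLI.toLinearMap ∘ₗ innerₛₗ ℝ (unitVec i)
    ∘ₗ opLin q ∘ₗ LinearMap.snd ℝ (Hn n) (Hn n))).contDiff

/-- The form `(w ↦ ⟪v q, w_t⟫)` at `v`. -/
def linForm (n : ℕ) (t : Fin 2) (q : ℍ[ℝ]) : HForms (Hn n) :=
  ofAmbient (fun v => oneForm t (opLin q v)) (oneForm_opLin_mem_ambientForms t q)

/-- The constant two-form `∑ i, ⟪e_i, ·_t⟫ ∧ ⟪e_i q, ·_t'⟫`. -/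
def quadAmb (n : ℕ) (t t' : Fin 2) (q : ℍ[ℝ]) : Ext (Hn n × Hn n) :=
  ∑ i, oneForm t (unitVec i) * oneForm t' (opLin q (unitVec i))

/-- The horizontal two-form defined by `quadAmb`. -/
def quadForm (n : ℕ) (t t' : Fin 2) (q : ℍ[ℝ]) : HForms (Hn n) :=
  ofAmbient (fun _ => quadAmb n t t' q) (Algebra.subset_adjoin (Or.inr ⟨_, rfl⟩))

theorem linForm_mem (t : Fin 2) (q : ℍ[ℝ]) : linForm n t q
    ∈ hFormsBideg (Hn n) ((Pi.single t 1 : Fin 2 → ℕ) 0) ((Pi.single t 1 : Fin 2 → ℕ) 1) :=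
  ofAmbient_mem_hFormsBideg _ fun _ => oneForm_mem_bideg _ _

theorem quadForm_mem (t t' : Fin 2) (q : ℍ[ℝ]) : quadForm n t t' q
    ∈ hFormsBideg (Hn n) ((Pi.single t 1 + Pi.single t' 1 : Fin 2 → ℕ) 0)
      ((Pi.single t 1 + Pi.single t' 1 : Fin 2 → ℕ) 1) :=
  ofAmbient_mem_hFormsBideg _ fun _ => Submodule.sum_mem _ fun _ _ =>
    mul_mem_bideg (oneForm_mem_bideg _ _) (oneForm_mem_bideg _ _)

theorem hFib_linForm (v : Metric.sphere (0 : Hn n) 1) (t : Fin 2) (q : ℍ[ℝ]) :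
    hFib v (linForm n t q) = extComap (perpSq (v : Hn n)) (oneForm t (opLin q (v : Hn n))) :=
  hFib_ofAmbient _ _ v

theorem hFib_quadForm (v : Metric.sphere (0 : Hn n) 1) (t t' : Fin 2) (q : ℍ[ℝ]) :
    hFib v (quadForm n t t' q) = extComap (perpSq (v : Hn n)) (quadAmb n t t' q) :=
  hFib_ofAmbient _ _ v

/-- The tensor `∑ T e_i ⊗ S e_i` depends only on `S ∘ T*`. It yields both the pull-back of the
two-forms along isometries and their behaviour when the two factors are exchanged. -/
theorem sum_oneForm_mul_oneForm (T S : Hn m →ₗ[ℝ] Hn n) (T' : Hn n →ₗ[ℝ] Hn m)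
    (hT : ∀ x y, ⟪T x, y⟫ = ⟪x, T' y⟫) (t t' : Fin 2) :
    ∑ i, oneForm t (T (unitVec i)) * oneForm t' (S (unitVec i))
      = ∑ k, oneForm t (unitVec k) * oneForm t' (S (T' (unitVec k))) := by
  have h1 : ∀ i, oneForm t (T (unitVec i)) * oneForm t' (S (unitVec i))
      = ∑ k, oneForm t (unitVec k)
        * ((⟪unitVec i, T' (unitVec k)⟫ : ℝ) : ℂ) • oneForm t' (S (unitVec i)) := by
    intro i
    rw [oneForm_eq_sum t (T (unitVec i)), Finset.sum_mul]
    refine Finset.sum_congr rfl fun k _ => ?_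
    rw [real_inner_comm, hT, smul_mul_assoc, mul_smul_comm]
  simp only [h1]
  rw [Finset.sum_comm]
  refine Finset.sum_congr rfl fun k _ => ?_
  rw [← Finset.mul_sum]
  conv_rhs => rw [← sum_inner_unitVec (T' (unitVec k)), map_sum, oneForm_sum]
  congr 1
  refine Finset.sum_congr rfl fun i _ => ?_
  rw [map_smul, oneForm_smul]

/-- The pull-back replaces the sum over a basis of `ℍ^m` by the adjoint images, and `f* f = 1`
reduces it to a basis of `ℍ^n`. The intertwining hypothesis covers two cases at once: quaternionic
isometries with `q' = q`, and right multiplication by a unit quaternion `r` with `q' = r q r̄`. -/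
theorem extComap_quadAmb (f : Hn n →ₗᵢ[ℝ] Hn m) {q q' : ℍ[ℝ]}
    (h : ∀ a, opLin (star q) (f a) = f (opLin (star q') a)) (t t' : Fin 2) :
    extComap (diagMap f.toLinearMap) (quadAmb m t t' q) = quadAmb n t t' q' := by
  have hadj : ∀ (x : Hn m) (y : Hn n), ⟪LinearMap.adjoint f.toLinearMap x, y⟫ = ⟪x, f y⟫ :=
    fun x y => LinearMap.adjoint_inner_left f.toLinearMap y x
  have h1 : ∀ x : Hn n, LinearMap.adjoint f.toLinearMap (f.toLinearMap x) = x := by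
    intro x
    refine ext_inner_right ℝ fun y => ?_
    rw [hadj]
    exact f.inner_map_map x y
  have h2 := sum_oneForm_mul_oneForm (LinearMap.adjoint f.toLinearMap)
    (opLin q' ∘ₗ LinearMap.adjoint f.toLinearMap) f.toLinearMap hadj t t'
  rw [quadAmb, map_sum]
  refine Eq.trans (Finset.sum_congr rfl fun i _ => ?_) (h2.trans ?_)
  · rw [map_mul, extComap_oneForm (x := LinearMap.adjoint f.toLinearMap (unitVec i)),
      extComap_oneForm (x := opLin q' (LinearMap.adjoint f.toLinearMap (unitVec i)))]
    · rfl
    · intro w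
      rw [inner_opLin_left, inner_opLin_left, hadj]
      exact congrArg _ (h w)
    · exact fun w => (hadj _ w).symm
  · refine Finset.sum_congr rfl fun k _ => ?_
    rw [LinearMap.comp_apply, h1]

theorem hPullback_quadForm (f : Hn n →ₗᵢ[ℝ] Hn m) {q q' : ℍ[ℝ]}
    (h : ∀ a, opLin (star q) (f a) = f (opLin (star q') a)) (t t' : Fin 2) :
    hPullback f (quadForm m t t' q) = quadForm n t t' q' :=
  hPullback_ofAmbient f _ _ fun _ => extComap_quadAmb f h t t'

theorem hPullback_linForm (f : Hn n →ₗᵢ[ℝ] Hn m) {q q' : ℍ[ℝ]}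
    (h : ∀ a, opLin (star q) (f a) = f (opLin (star q') a)) (t : Fin 2) :
    hPullback f (linForm m t q) = linForm n t q' :=
  hPullback_ofAmbient f _ _ fun v => by
    refine extComap_oneForm (fun w => ?_) t
    rw [inner_opLin_left, inner_opLin_left]
    exact (congrArg _ (h w)).trans (f.inner_map_map v _)

theorem opLin_toIsometry (f : QuatIsometry n m) (q : ℍ[ℝ]) (a : Hn n) :
    opLin q (f.toIsometry a) = f.toIsometry (opLin q a) :=
  (map_smul f.toLin (MulOpposite.op q) a).symm

/-- The sequence of the forms `linForm n t q`. -/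
def linSeq (t : Fin 2) (q : ℍ[ℝ]) : FormSeq := fun n => linForm n t q

/-- The sequence of the forms `quadForm n t t' q`. -/
def quadSeq (t t' : Fin 2) (q : ℍ[ℝ]) : FormSeq := fun n => quadForm n t t' q

variable (j : (n : ℕ) → QuatIsometry n (n + 1))

theorem linSeq_mem (t : Fin 2) (q : ℍ[ℝ]) : linSeq t q
    ∈ limForms j ((Pi.single t 1 : Fin 2 → ℕ) 0) ((Pi.single t 1 : Fin 2 → ℕ) 1) :=
  ⟨fun _ => ⟨linForm_mem t q, fun _ => hPullback_linForm _ (opLin_toIsometry _ _) t⟩,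
    fun _ => hPullback_linForm _ (opLin_toIsometry _ _) t⟩

theorem quadSeq_mem (t t' : Fin 2) (q : ℍ[ℝ]) : quadSeq t t' q
    ∈ limForms j ((Pi.single t 1 + Pi.single t' 1 : Fin 2 → ℕ) 0)
      ((Pi.single t 1 + Pi.single t' 1 : Fin 2 → ℕ) 1) :=
  ⟨fun _ => ⟨quadForm_mem t t' q, fun _ => hPullback_quadForm _ (opLin_toIsometry _ _) t t'⟩,
    fun _ => hPullback_quadForm _ (opLin_toIsometry _ _) t t'⟩

theorem opLin_rightMul (r : Sp1) (q : ℍ[ℝ]) (a : Hn n) :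
    opLin (star q) (rightMul n r a)
      = rightMul n r (opLin (star ((r : ℍ[ℝ]) * q * star (r : ℍ[ℝ]))) a) := by
  have hr : star (r : ℍ[ℝ]) * (r : ℍ[ℝ]) = 1 := by
    rw [Quaternion.star_mul_self, Quaternion.normSq_eq_norm_mul_self]
    simp
  change opLin (star q) (opLin (r : ℍ[ℝ]) a) = opLin (r : ℍ[ℝ]) (opLin _ a)
  rw [opLin_opLin, opLin_opLin, star_mul, star_mul, star_star, mul_assoc, mul_assoc, hr, mul_one]

theorem sp1Act_linSeq (r : Sp1) (t : Fin 2) (q : ℍ[ℝ]) :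
    sp1Act r (linSeq t q) = linSeq t ((r : ℍ[ℝ]) * q * star (r : ℍ[ℝ])) :=
  funext fun n => hPullback_linForm (rightMul n r) (opLin_rightMul r q) t

theorem sp1Act_quadSeq (r : Sp1) (t t' : Fin 2) (q : ℍ[ℝ]) :
    sp1Act r (quadSeq t t' q) = quadSeq t t' ((r : ℍ[ℝ]) * q * star (r : ℍ[ℝ])) :=
  funext fun n => hPullback_quadForm (rightMul n r) (opLin_rightMul r q) t t'

/-! ### Relations between the generators -/

theorem ext_of_hFib {V : Type*} [NormedAddCommGroup V] [InnerProductSpace ℝ V] {τ τ' : HForms V}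
    (h : ∀ v, hFib v τ = hFib v τ') : τ = τ' :=
  sub_eq_zero.mp (eq_zero_of_hFib_eq_zero fun v => by rw [map_sub, h, sub_self])

theorem linSeq_add (t : Fin 2) (p q : ℍ[ℝ]) : linSeq t (p + q) = linSeq t p + linSeq t q := by
  refine funext fun n => ext_of_hFib fun v => ?_
  rw [Pi.add_apply, map_add]
  simp only [linSeq, hFib_linForm, opLin_add, oneForm_add, map_add]

theorem linSeq_smul (t : Fin 2) (r : ℝ) (q : ℍ[ℝ]) :
    linSeq t (r • q) = (r : ℂ) • linSeq t q := by
  refine funext fun n => ext_of_hFib fun v => ?_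
  rw [Pi.smul_apply, map_smul]
  simp only [linSeq, hFib_linForm, opLin_smul, oneForm_smul, map_smul]

theorem quadAmb_add (t t' : Fin 2) (p q : ℍ[ℝ]) :
    quadAmb n t t' (p + q) = quadAmb n t t' p + quadAmb n t t' q := by
  simp only [quadAmb, opLin_add, oneForm_add, mul_add, Finset.sum_add_distrib]

theorem quadAmb_smul (t t' : Fin 2) (r : ℝ) (q : ℍ[ℝ]) :
    quadAmb n t t' (r • q) = (r : ℂ) • quadAmb n t t' q := by
  simp only [quadAmb, opLin_smul, oneForm_smul, mul_smul_comm, Finset.smul_sum]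

theorem quadSeq_add (t t' : Fin 2) (p q : ℍ[ℝ]) :
    quadSeq t t' (p + q) = quadSeq t t' p + quadSeq t t' q := by
  refine funext fun n => ext_of_hFib fun v => ?_
  rw [Pi.add_apply, map_add]
  simp only [quadSeq, hFib_quadForm, quadAmb_add, map_add]

theorem quadSeq_smul (t t' : Fin 2) (r : ℝ) (q : ℍ[ℝ]) :
    quadSeq t t' (r • q) = (r : ℂ) • quadSeq t t' q := by
  refine funext fun n => ext_of_hFib fun v => ?_
  rw [Pi.smul_apply, map_smul]
  simp only [quadSeq, hFib_quadForm, quadAmb_smul, map_smul]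

/-- The functional `⟪v, ·⟫` vanishes on `v^⊥`: in the first factor it is the contact form, in the
second a conormal of the sphere. -/
theorem linSeq_one (t : Fin 2) : linSeq t 1 = 0 := by
  refine funext fun n => eq_zero_of_hFib_eq_zero fun v => ?_
  rw [linSeq, hFib_linForm, opLin_one, ← oneForm_zero t]
  refine extComap_oneForm (fun w => ?_) t
  have hv : ⟪(v : Hn n), (v : Hn n)⟫ = 1 := by simp
  rw [perpMap_apply, inner_sub_right, inner_smul_right, hv, mul_one, sub_self, inner_zero_left]

/-- The adjoint of right multiplication by `q` is right multiplication by its conjugate; the sign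
comes from exchanging two one-forms. -/
theorem quadAmb_swap (t t' : Fin 2) (q : ℍ[ℝ]) :
    quadAmb n t' t q = -quadAmb n t t' (star q) := by
  rw [quadAmb, quadAmb, ← Finset.sum_neg_distrib]
  have h := sum_oneForm_mul_oneForm (opLin q) LinearMap.id (opLin (star q))
    (inner_opLin_left (n := n) q) t t'
  rw [Finset.sum_neg_distrib]
  refine Eq.trans ?_ (congrArg Neg.neg h)
  rw [← Finset.sum_neg_distrib]
  exact Finset.sum_congr rfl fun i _ => oneForm_mul_oneForm_swap _ _ _ _

theorem quadSeq_swap (t t' : Fin 2) (q : ℍ[ℝ]) : quadSeq t' t q = -quadSeq t t' (star q) := by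
  refine funext fun n => ext_of_hFib fun v => ?_
  rw [Pi.neg_apply, map_neg]
  simp only [quadSeq, hFib_quadForm, quadAmb_swap t t' q, map_neg]

theorem quadSeq_self_one (t : Fin 2) : quadSeq t t 1 = 0 := by
  have h := quadSeq_swap t t 1
  rw [star_one] at h
  have h2 : (2 : ℂ) • quadSeq t t 1 = 0 := by
    rw [two_smul]
    nth_rewrite 1 [h]
    exact neg_add_cancel _
  exact (smul_eq_zero.mp h2).resolve_left two_ne_zero

end Generators

/-! ### The generators as representations of `SU(2)` -/

section Representations

open Module MvPolynomial
open scoped RealInnerProductSpace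

/-- The binary quadratic form with given coefficients. -/
def quadPoly (a b c : ℂ) : MvPolynomial (Fin 2) ℂ :=
  C a * X 0 ^ 2 + C b * (X 0 * X 1) + C c * X 1 ^ 2

theorem quadPoly_eq (a b c : ℂ) : quadPoly a b c
    = monomial (Finsupp.single 0 2) a + monomial (Finsupp.single 0 1 + Finsupp.single 1 1) b
      + monomial (Finsupp.single 1 2) c := by
  have h : (X 0 * X 1 : MvPolynomial (Fin 2) ℂ)
      = monomial (Finsupp.single 0 1 + Finsupp.single 1 1) 1 := by
    rw [X, X, monomial_mul, one_mul]
  rw [quadPoly, h, X_pow_eq_monomial, X_pow_eq_monomial, C_mul_monomial, C_mul_monomial,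
    C_mul_monomial, mul_one, mul_one, mul_one]

theorem coeff_quadPoly (a b c : ℂ) :
    coeff (Finsupp.single 0 2) (quadPoly a b c) = a
      ∧ coeff (Finsupp.single 0 1 + Finsupp.single 1 1) (quadPoly a b c) = b
      ∧ coeff (Finsupp.single 1 2) (quadPoly a b c) = c := by
  have h1 : (Finsupp.single 0 1 + Finsupp.single 1 1 : Fin 2 →₀ ℕ) ≠ Finsupp.single 0 2 := by
    intro h; simpa using DFunLike.congr_fun h 1
  have h2 : (Finsupp.single 1 2 : Fin 2 →₀ ℕ) ≠ Finsupp.single 0 2 := by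
    intro h; simpa using DFunLike.congr_fun h 1
  have h3 : (Finsupp.single 1 2 : Fin 2 →₀ ℕ) ≠ Finsupp.single 0 1 + Finsupp.single 1 1 := by
    intro h; simpa using DFunLike.congr_fun h 0
  rw [quadPoly_eq]
  simp only [coeff_add, coeff_monomial]
  simp [h1, h2, h3, h1.symm, h2.symm, h3.symm]

theorem eq_quadPoly {p : MvPolynomial (Fin 2) ℂ} (hp : p ∈ homogeneousSubmodule (Fin 2) ℂ 2) :
    p = quadPoly (coeff (Finsupp.single 0 2) p)
      (coeff (Finsupp.single 0 1 + Finsupp.single 1 1) p) (coeff (Finsupp.single 1 2) p) := by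
  rw [mem_homogeneousSubmodule] at hp
  have hq : quadPoly (coeff (Finsupp.single 0 2) p)
      (coeff (Finsupp.single 0 1 + Finsupp.single 1 1) p) (coeff (Finsupp.single 1 2) p)
      |>.IsHomogeneous 2 := by
    rw [quadPoly_eq]
    refine ((isHomogeneous_monomial _ ?_).add (isHomogeneous_monomial _ ?_)).add
      (isHomogeneous_monomial _ ?_) <;> simp [Finsupp.degree_eq_sum]
  obtain ⟨h1, h2, h3⟩ := coeff_quadPoly (coeff (Finsupp.single 0 2) p)
      (coeff (Finsupp.single 0 1 + Finsupp.single 1 1) p) (coeff (Finsupp.single 1 2) p)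
  ext m
  by_cases hm : m.degree = 2
  · rw [Finsupp.degree_eq_sum, Fin.sum_univ_two] at hm
    have h0 : m 0 = 0 ∨ m 0 = 1 ∨ m 0 = 2 := by omega
    rcases h0 with h0 | h0 | h0
    · have : m = Finsupp.single 1 2 := by
        ext i; fin_cases i <;> simp <;> omega
      rw [this, h3]
    · have : m = Finsupp.single 0 1 + Finsupp.single 1 1 := by
        ext i; fin_cases i <;> simp <;> omega
      rw [this, h2]
    · have : m = Finsupp.single 0 2 := by
        ext i; fin_cases i <;> simp <;> omega
      rw [this, h1]
  · rw [hp.coeff_eq_zero hm, hq.coeff_eq_zero hm]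

theorem symAct_quadPoly (g : Matrix (Fin 2) (Fin 2) ℂ) (a b c : ℂ) :
    symAct g (quadPoly a b c) = quadPoly
      (a * g 0 0 ^ 2 + b * (g 0 0 * g 0 1) + c * g 0 1 ^ 2)
      (a * (2 * g 0 0 * g 1 0) + b * (g 0 0 * g 1 1 + g 1 0 * g 0 1) + c * (2 * g 0 1 * g 1 1))
      (a * g 1 0 ^ 2 + b * (g 1 0 * g 1 1) + c * g 1 1 ^ 2) := by
  simp only [symAct, quadPoly, map_add, map_mul, map_pow, aeval_X, Fin.sum_univ_two, algHom_C,
    algebraMap_eq, map_ofNat]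
  ring

/-- The linear map underlying the identification of `Sym²` with the complexified imaginary
quaternions. -/
def symTwoMap (Θ : ℍ[ℝ] → FormSeq) : homogeneousSubmodule (Fin 2) ℂ 2 →ₗ[ℂ] FormSeq :=
  -- The images of `X₀²`, `X₀ X₁`, `X₁²` are weight vectors for the circle `exp(iθ)`: conjugation by
  -- it fixes the unit `i` and rotates the plane of `j, k` by `2θ`, with complex eigenvectors `j ∓
  -- √-1 k`.
  ((lcoeff ℂ (Finsupp.single 0 2)).smulRight
      (Θ (quatUnit 2) - Complex.I • Θ (quatUnit 3))
    + (lcoeff ℂ (Finsupp.single 0 1 + Finsupp.single 1 1)).smulRight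
      (-(Complex.I • Θ (quatUnit 1)))
    + (lcoeff ℂ (Finsupp.single 1 2)).smulRight
      (Θ (quatUnit 2) + Complex.I • Θ (quatUnit 3))) ∘ₗ Submodule.subtype _

theorem symTwoMap_apply (Θ : ℍ[ℝ] → FormSeq) (p : homogeneousSubmodule (Fin 2) ℂ 2) :
    symTwoMap Θ p = coeff (Finsupp.single 0 2) (p : MvPolynomial (Fin 2) ℂ)
        • (Θ (quatUnit 2) - Complex.I • Θ (quatUnit 3))
      + coeff (Finsupp.single 0 1 + Finsupp.single 1 1) (p : MvPolynomial (Fin 2) ℂ)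
        • (-(Complex.I • Θ (quatUnit 1)))
      + coeff (Finsupp.single 1 2) (p : MvPolynomial (Fin 2) ℂ)
        • (Θ (quatUnit 2) + Complex.I • Θ (quatUnit 3)) := rfl

/-- The complexified imaginary quaternions under conjugation by `Sp(1)` are isomorphic to `V_2`. The
functionals `ℓ` certify that the three values of `Θ` are linearly independent, so that no dimension
is lost. -/
theorem isCopyOf_two {Θ : ℍ[ℝ] → FormSeq} (hadd : ∀ p q, Θ (p + q) = Θ p + Θ q)
    (hsmul : ∀ (r : ℝ) q, Θ (r • q) = (r : ℂ) • Θ q)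
    (hact : ∀ (r : Sp1) q, sp1Act r (Θ q) = Θ ((r : ℍ[ℝ]) * q * star (r : ℍ[ℝ])))
    (ℓ : Fin 4 → FormSeq →ₗ[ℂ] ℂ) {κ : ℂ} (hκ : κ ≠ 0)
    (hℓ : ∀ c d, c ≠ 0 → d ≠ 0 → ℓ c (Θ (quatUnit d)) = if c = d then κ else 0) :
    IsCopyOf 2 (Submodule.span ℂ {Θ (quatUnit 1), Θ (quatUnit 2), Θ (quatUnit 3)}) := by
  have hinj : Function.Injective (symTwoMap Θ) := by
    refine (injective_iff_map_eq_zero _).mpr fun p hp => ?_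
    rw [symTwoMap_apply] at hp
    have h1 := congrArg (ℓ 1) hp
    have h2 := congrArg (ℓ 2) hp
    have h3 := congrArg (ℓ 3) hp
    simp only [map_add, map_sub, map_neg, map_smul, map_zero, smul_eq_mul,
      hℓ 1 1 (by decide) (by decide), hℓ 1 2 (by decide) (by decide), hℓ 1 3 (by decide) (by decide),
      hℓ 2 1 (by decide) (by decide), hℓ 2 2 (by decide) (by decide), hℓ 2 3 (by decide) (by decide),
      hℓ 3 1 (by decide) (by decide), hℓ 3 2 (by decide) (by decide),
      hℓ 3 3 (by decide) (by decide)] at h1 h2 h3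
    simp [hκ] at h1 h2 h3
    have e2 : (coeff (Finsupp.single 0 2) (p : MvPolynomial (Fin 2) ℂ)
        + coeff (Finsupp.single 1 2) (p : MvPolynomial (Fin 2) ℂ)) * κ = 0 := by
      linear_combination h2
    have e3 : (coeff (Finsupp.single 1 2) (p : MvPolynomial (Fin 2) ℂ)
        - coeff (Finsupp.single 0 2) (p : MvPolynomial (Fin 2) ℂ)) * (Complex.I * κ) = 0 := by
      linear_combination h3
    have e2' := (mul_eq_zero.mp e2).resolve_right hκ
    have e3' := (mul_eq_zero.mp e3).resolve_right (mul_ne_zero Complex.I_ne_zero hκ)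
    refine Subtype.ext ?_
    rw [eq_quadPoly p.2, h1]
    have ha : coeff (Finsupp.single 0 2) (p : MvPolynomial (Fin 2) ℂ) = 0 := by
      linear_combination (e2' - e3') / 2
    have hc : coeff (Finsupp.single 1 2) (p : MvPolynomial (Fin 2) ℂ) = 0 := by
      linear_combination (e2' + e3') / 2
    rw [ha, hc]
    simp [quadPoly]
  have hrange : LinearMap.range (symTwoMap Θ)
      = Submodule.span ℂ {Θ (quatUnit 1), Θ (quatUnit 2), Θ (quatUnit 3)} := by
    have hval : ∀ a b c : ℂ, a • (Θ (quatUnit 2) - Complex.I • Θ (quatUnit 3))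
      + b • (-(Complex.I • Θ (quatUnit 1))) + c • (Θ (quatUnit 2) + Complex.I • Θ (quatUnit 3))
        ∈ LinearMap.range (symTwoMap Θ) := by
      intro a b c
      have hq : quadPoly a b c ∈ homogeneousSubmodule (Fin 2) ℂ 2 := by
        rw [mem_homogeneousSubmodule, quadPoly_eq]
        refine ((isHomogeneous_monomial _ ?_).add (isHomogeneous_monomial _ ?_)).add
          (isHomogeneous_monomial _ ?_) <;> simp [Finsupp.degree_eq_sum]
      obtain ⟨h1, h2, h3⟩ := coeff_quadPoly a b c
      refine ⟨⟨_, hq⟩, ?_⟩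
      rw [symTwoMap_apply, h1, h2, h3]
    have hI := Complex.I_mul_I
    apply le_antisymm
    · rintro _ ⟨p, rfl⟩
      have m1 : Θ (quatUnit 1) ∈ Submodule.span ℂ
        {Θ (quatUnit 1), Θ (quatUnit 2), Θ (quatUnit 3)} := Submodule.subset_span (by simp)
      have m2 : Θ (quatUnit 2) ∈ Submodule.span ℂ
        {Θ (quatUnit 1), Θ (quatUnit 2), Θ (quatUnit 3)} := Submodule.subset_span (by simp)
      have m3 : Θ (quatUnit 3) ∈ Submodule.span ℂ
        {Θ (quatUnit 1), Θ (quatUnit 2), Θ (quatUnit 3)} := Submodule.subset_span (by simp)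
      rw [symTwoMap_apply]
      exact add_mem (add_mem
        (Submodule.smul_mem _ _ (sub_mem m2 (Submodule.smul_mem _ _ m3)))
        (Submodule.smul_mem _ _ (neg_mem (Submodule.smul_mem _ _ m1))))
        (Submodule.smul_mem _ _ (add_mem m2 (Submodule.smul_mem _ _ m3)))
    · rw [Submodule.span_le]
      rintro x (rfl | rfl | rfl)
      · have h := hval 0 Complex.I 0
        rwa [zero_smul, zero_smul, zero_add, add_zero, smul_neg, smul_smul, hI, neg_smul, one_smul,
          neg_neg] at h
      · have h := hval (1 / 2) 0 (1 / 2)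
        rwa [zero_smul, add_zero, ← smul_add, sub_add_add_cancel, ← two_smul ℂ, smul_smul,
          one_div, inv_mul_cancel₀ two_ne_zero, one_smul] at h
      · have h := hval (Complex.I / 2) 0 (-(Complex.I / 2))
        have e : (Complex.I / 2) • (Θ (quatUnit 2) - Complex.I • Θ (quatUnit 3))
            + (0 : ℂ) • (-(Complex.I • Θ (quatUnit 1)))
            + (-(Complex.I / 2)) • (Θ (quatUnit 2) + Complex.I • Θ (quatUnit 3))
            = (-(Complex.I * Complex.I)) • Θ (quatUnit 3) := by module
        rwa [e, hI, neg_neg, one_smul] at h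
  rw [← hrange]
  refine ⟨LinearEquiv.ofInjective _ hinj, fun r p => ?_⟩
  rw [LinearEquiv.ofInjective_apply, LinearEquiv.ofInjective_apply]
  have hdec : ∀ q : ℍ[ℝ], q.re = 0 → Θ q = (q.imI : ℂ) • Θ (quatUnit 1)
      + (q.imJ : ℂ) • Θ (quatUnit 2) + (q.imK : ℂ) • Θ (quatUnit 3) := by
    intro q hq
    rw [← hsmul, ← hsmul, ← hsmul, ← hadd, ← hadd]
    congr 1
    apply Quaternion.ext <;> simp [quatUnit_re, quatUnit_imI, quatUnit_imJ, quatUnit_imK, hq]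
  have hre : ∀ d : Fin 4, d ≠ 0 →
      ((r : ℍ[ℝ]) * quatUnit d * star (r : ℍ[ℝ])).re = 0 := by
    intro d hd
    simp only [Quaternion.re_mul, Quaternion.imI_mul, Quaternion.imJ_mul, Quaternion.imK_mul,
      Quaternion.re_star, Quaternion.imI_star, Quaternion.imJ_star, Quaternion.imK_star,
      quatUnit_re, quatUnit_imI, quatUnit_imJ, quatUnit_imK, if_neg hd]
    ring
  have hsym : ((symRep 2 (sp1ToSU2 r) p : homogeneousSubmodule (Fin 2) ℂ 2) :
      MvPolynomial (Fin 2) ℂ) = symAct (quatMatrix (r : ℍ[ℝ])) (p : MvPolynomial (Fin 2) ℂ) := rfl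
  obtain ⟨a, b, c, hP⟩ : ∃ a b c, (p : MvPolynomial (Fin 2) ℂ) = quadPoly a b c :=
    ⟨_, _, _, eq_quadPoly p.2⟩
  rw [symTwoMap_apply, symTwoMap_apply, hsym, hP, symAct_quadPoly, (coeff_quadPoly a b c).1,
    (coeff_quadPoly a b c).2.1, (coeff_quadPoly a b c).2.2, (coeff_quadPoly _ _ _).1,
    (coeff_quadPoly _ _ _).2.1, (coeff_quadPoly _ _ _).2.2]
  simp only [map_add, map_sub, map_neg, map_smul, hact]
  rw [hdec _ (hre 1 (by decide)), hdec _ (hre 2 (by decide)), hdec _ (hre 3 (by decide))]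
  -- Both sides are combinations of the three values of `Θ`, so equivariance follows from three
  -- scalar identities between the entries of `quatMatrix r` and the coordinates of `r e_d r̄`.
  have hlin : ∀ (α β γ a b c r₁₁ r₁₂ r₁₃ r₂₁ r₂₂ r₂₃ r₃₁ r₃₂ r₃₃ : ℂ) (A B D : FormSeq),
      -(Complex.I * β) = a * (r₂₁ - Complex.I * r₃₁) - b * (Complex.I * r₁₁)
        + c * (r₂₁ + Complex.I * r₃₁) →
      α + γ = a * (r₂₂ - Complex.I * r₃₂) - b * (Complex.I * r₁₂)
        + c * (r₂₂ + Complex.I * r₃₂) →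
      Complex.I * (γ - α) = a * (r₂₃ - Complex.I * r₃₃) - b * (Complex.I * r₁₃)
        + c * (r₂₃ + Complex.I * r₃₃) →
      α • (B - Complex.I • D) + β • (-(Complex.I • A)) + γ • (B + Complex.I • D)
        = a • (r₂₁ • A + r₂₂ • B + r₂₃ • D - Complex.I • (r₃₁ • A + r₃₂ • B + r₃₃ • D))
          + b • (-(Complex.I • (r₁₁ • A + r₁₂ • B + r₁₃ • D)))
          + c • (r₂₁ • A + r₂₂ • B + r₂₃ • D + Complex.I • (r₃₁ • A + r₃₂ • B + r₃₃ • D)) := by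
    intro α β γ a b c r₁₁ r₁₂ r₁₃ r₂₁ r₂₂ r₂₃ r₃₁ r₃₂ r₃₃ A B D h1 h2 h3
    have h4 : α • (B - Complex.I • D) + β • (-(Complex.I • A)) + γ • (B + Complex.I • D)
        = (-(Complex.I * β)) • A + (α + γ) • B + (Complex.I * (γ - α)) • D := by module
    rw [h4, h1, h2, h3]
    module
  apply hlin <;>
  · simp only [Quaternion.re_mul, Quaternion.imI_mul, Quaternion.imJ_mul, Quaternion.imK_mul,
      Quaternion.re_star, Quaternion.imI_star, Quaternion.imJ_star, Quaternion.imK_star,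
      quatUnit_re, quatUnit_imI, quatUnit_imJ, quatUnit_imK, quatMatrix, Matrix.of_apply,
      Matrix.cons_val', Matrix.cons_val_zero, Matrix.cons_val_one, Matrix.cons_val_fin_one]
    apply Complex.ext <;> simp [sq] <;> ring

theorem isCopyOf_zero {θ : FormSeq} (hθ : θ ≠ 0) (hact : ∀ r : Sp1, sp1Act r θ = θ) :
    IsCopyOf 0 (Submodule.span ℂ {θ}) := by
  let Ψ : homogeneousSubmodule (Fin 2) ℂ 0 →ₗ[ℂ] FormSeq :=
    ((lcoeff ℂ 0).smulRight θ) ∘ₗ Submodule.subtype _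
  have hΨ : ∀ p : homogeneousSubmodule (Fin 2) ℂ 0,
    Ψ p = coeff 0 (p : MvPolynomial (Fin 2) ℂ) • θ := fun _ => rfl
  have hC : ∀ p : homogeneousSubmodule (Fin 2) ℂ 0,
      (p : MvPolynomial (Fin 2) ℂ) = C (coeff 0 (p : MvPolynomial (Fin 2) ℂ)) := by
    intro p
    have hp := (mem_homogeneousSubmodule _ _).mp p.2
    ext m
    rw [coeff_C]
    split_ifs with hm
    · rw [hm]
    · refine hp.coeff_eq_zero fun h => hm ?_
      exact ((Finsupp.degree_eq_zero_iff m).mp h).symm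
  have hinj : Function.Injective Ψ := by
    refine (injective_iff_map_eq_zero _).mpr fun p hp => Subtype.ext ?_
    rw [hΨ] at hp
    rw [hC p, (smul_eq_zero.mp hp).resolve_right hθ, C_0]
    rfl
  have hrange : LinearMap.range Ψ = Submodule.span ℂ {θ} := by
    apply le_antisymm
    · rintro _ ⟨p, rfl⟩
      exact Submodule.smul_mem _ _ (Submodule.mem_span_singleton_self θ)
    · rw [Submodule.span_singleton_le_iff_mem]
      refine ⟨⟨C 1, isHomogeneous_C _ _⟩, ?_⟩
      rw [hΨ, coeff_zero_C, one_smul]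
  rw [← hrange]
  refine ⟨LinearEquiv.ofInjective _ hinj, fun r p => ?_⟩
  rw [LinearEquiv.ofInjective_apply, LinearEquiv.ofInjective_apply, hΨ, hΨ, map_smul, hact]
  have hsym : ((symRep 0 (sp1ToSU2 r) p : homogeneousSubmodule (Fin 2) ℂ 0) :
      MvPolynomial (Fin 2) ℂ) = symAct (quatMatrix (r : ℍ[ℝ])) (p : MvPolynomial (Fin 2) ℂ) := rfl
  rw [hsym, hC p, symAct, algHom_C]
  rfl

theorem evalAt_coFun {n : ℕ} (t t' : Fin 2) (x y : Hn n) :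
    evalAt (pairIncl (Hn n) t x) (coFun t' y) = ((if t' = t then ⟪y, x⟫ else 0 : ℝ) : ℂ) := by
  change coFun t' y (pairIncl (Hn n) t x) = _
  rw [coFun_apply, pairProj_pairIncl]
  split_ifs <;> simp

theorem scalarPart_contr_ι {M : Type*} [AddCommGroup M] [Module ℂ M] (d : Dual ℂ M) (m : M) :
    scalarPart (contr d (ExteriorAlgebra.ι ℂ m)) = d m := by
  have h := contr_ι_mul d m 1
  rw [mul_one, contr_one, mul_zero, sub_zero] at h
  rw [h, map_smul, map_one, smul_eq_mul, mul_one]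

theorem scalarPart_contr_contr_ι_mul_ι {M : Type*} [AddCommGroup M] [Module ℂ M]
    (d d' : Dual ℂ M) (m m' : M) :
    scalarPart (contr d' (contr d (ExteriorAlgebra.ι ℂ m * ExteriorAlgebra.ι ℂ m')))
      = d m * d' m' - d m' * d' m := by
  have h := contr_ι_mul d m' 1
  rw [mul_one, contr_one, mul_zero, sub_zero] at h
  rw [contr_ι_mul, h, mul_smul_comm, mul_one, map_sub, map_sub, map_smul, map_smul, map_smul,
    map_smul, scalarPart_contr_ι, scalarPart_contr_ι]
  rfl

theorem scalarPart_contr_contr_quadAmb {n : ℕ} (t t' : Fin 2) (q : ℍ[ℝ]) (x y : Hn n) :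
    scalarPart (contr (evalAt (pairIncl (Hn n) t' y)) (contr (evalAt (pairIncl (Hn n) t x))
      (quadAmb n t t' q)))
      = ((⟪opLin q x, y⟫ - if t = t' then ⟪opLin q y, x⟫ else 0 : ℝ) : ℂ) := by
  have h1 : ∀ x y : Hn n, ∑ i, ⟪unitVec i, x⟫ * ⟪opLin q (unitVec i), y⟫ = ⟪opLin q x, y⟫ := by
    intro x y
    rw [inner_opLin_left, ← sum_inner_mul_inner_unitVec]
    exact Finset.sum_congr rfl fun i _ => by rw [inner_opLin_left]
  rw [quadAmb, map_sum, map_sum, map_sum]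
  simp only [oneForm, scalarPart_contr_contr_ι_mul_ι, evalAt_coFun, if_true]
  rw [← h1, ← h1]
  by_cases ht : t = t'
  · subst ht
    simp only [if_true]
    push_cast
    rw [← Finset.sum_sub_distrib]
    exact Finset.sum_congr rfl fun i _ => by ring
  · simp only [if_neg ht, if_neg (Ne.symm ht)]
    push_cast
    simp

theorem opLin_unitVec_zero {n : ℕ} (s : Fin n) (c : Fin 4) :
    opLin (quatUnit c) (unitVec (s, 0)) = (unitVec (s, c) : Hn n) :=
  op_smul_unitVec_zero s (quatUnit c)

/-- The standard basis vectors as points of the sphere. -/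
def sphereVec {n : ℕ} (s : Fin n) : Metric.sphere (0 : Hn n) 1 :=
  ⟨unitVec (s, 0), by
    have h : ⟪(unitVec (s, 0) : Hn n), unitVec (s, 0)⟫ = 1 := by rw [inner_unitVec, if_pos rfl]
    rw [real_inner_self_eq_norm_sq] at h
    rw [mem_sphere_zero_iff_norm]
    exact (sq_eq_sq₀ (norm_nonneg _) zero_le_one).mp (by rw [h, one_pow])⟩

theorem perpSq_pairIncl {n : ℕ} {v x : Hn n} (h : ⟪v, x⟫ = 0) (t : Fin 2) :
    perpSq v (pairIncl (Hn n) t x) = pairIncl (Hn n) t x := by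
  have h1 : perpMap v x = x := by rw [perpMap_apply, h, zero_smul, sub_zero]
  fin_cases t
  · exact Prod.ext h1 (map_zero (perpMap v))
  · exact Prod.ext (map_zero (perpMap v)) h1

theorem isCopyOf_linSeq (t : Fin 2) : IsCopyOf 2 (Submodule.span ℂ
    {linSeq t (quatUnit 1), linSeq t (quatUnit 2), linSeq t (quatUnit 3)}) := by
  -- Independence is already visible on `ℍ^1`: at `v = 1` the form `linSeq t e_d` is evaluated on
  -- the tangent vectors `e_c` with `c ≠ 0`.
  refine isCopyOf_two (linSeq_add t) (linSeq_smul t) (fun r q => sp1Act_linSeq r t q)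
    (fun c => scalarPart.toLinearMap ∘ₗ contr (evalAt (pairIncl (Hn 1) t (unitVec (0, c))))
      ∘ₗ (hFib (sphereVec 0)).toLinearMap ∘ₗ LinearMap.proj 1) one_ne_zero fun c d hc hd => ?_
  change scalarPart (contr _ (hFib (sphereVec 0) (linForm 1 t (quatUnit d)))) = _
  have h : ⟪((sphereVec 0 : Metric.sphere (0 : Hn 1) 1) : Hn 1), unitVec (0, c)⟫ = 0 :=
    (inner_unitVec _ _).trans (if_neg fun h => hc (Prod.ext_iff.mp h).2.symm)
  rw [hFib_linForm, contr_extComap, scalarPart_extComap, perpSq_pairIncl h, oneForm,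
    scalarPart_contr_ι, evalAt_coFun, if_pos rfl]
  have h2 : opLin (quatUnit d) ((sphereVec 0 : Metric.sphere (0 : Hn 1) 1) : Hn 1)
    = unitVec (0, d) := opLin_unitVec_zero 0 d
  rw [h2, inner_unitVec]
  by_cases hcd : c = d
  · simp [hcd]
  · simp [hcd, Ne.symm hcd]

/-- The functional detecting `quadSeq`. -/
def quadProbe (t t' : Fin 2) (c : Fin 4) : FormSeq →ₗ[ℂ] ℂ :=
  scalarPart.toLinearMap ∘ₗ contr (evalAt (pairIncl (Hn 2) t' (unitVec (1, c))))
    ∘ₗ contr (evalAt (pairIncl (Hn 2) t (unitVec (1, 0))))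
      ∘ₗ (hFib (sphereVec 0)).toLinearMap ∘ₗ LinearMap.proj 2

/-- The test vectors lie in the second coordinate of `ℍ^2`, orthogonal to the base point. For `t =
t'` both orders of the two vectors contribute; they add up to `2` when `e_d` is imaginary and cancel
when `e_d = 1`. -/
theorem quadProbe_quadSeq (t t' : Fin 2) (c d : Fin 4) : quadProbe t t' c (quadSeq t t' (quatUnit d))
    = if c = d then (if t = t' ∧ d = 0 then 0 else if t = t' then 2 else 1) else 0 := by
  change scalarPart (contr _ (contr _ (hFib (sphereVec 0) (quadForm 2 t t' (quatUnit d))))) = _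
  have h : ∀ c, ⟪((sphereVec 0 : Metric.sphere (0 : Hn 2) 1) : Hn 2), unitVec (1, c)⟫ = 0 :=
    fun c => (inner_unitVec _ _).trans (if_neg (by simp))
  have h2 : ∀ a b : Fin 4, ⟪(unitVec (1, a) : Hn 2), unitVec (1, b)⟫ = if a = b then 1 else 0 := by
    intro a b
    rw [inner_unitVec]
    simp
  rw [hFib_quadForm, contr_extComap, contr_extComap, scalarPart_extComap, perpSq_pairIncl (h c),
    perpSq_pairIncl (h 0), scalarPart_contr_contr_quadAmb, opLin_unitVec_zero, h2,
    inner_opLin_left]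
  by_cases hd : d = 0
  · subst hd
    rw [quatUnit_zero, star_one, opLin_one, h2]
    by_cases hc : c = 0
    · by_cases ht : t = t' <;> simp [hc, ht]
    · simp [hc, Ne.symm hc]
  · rw [star_quatUnit hd]
    have h3 : opLin (-quatUnit d) (unitVec (1, 0) : Hn 2) = -unitVec (1, d) := by
      rw [← opLin_unitVec_zero 1 d, opLin_apply, MulOpposite.op_neg, neg_smul]
      rfl
    rw [h3, inner_neg_right, h2]
    by_cases hc : c = d
    · by_cases ht : t = t'
      · simp [hc, ht, hd]; norm_num
      · simp [hc, ht]
    · simp [hc, Ne.symm hc]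

theorem isCopyOf_quadSeq (t t' : Fin 2) : IsCopyOf 2 (Submodule.span ℂ
    {quadSeq t t' (quatUnit 1), quadSeq t t' (quatUnit 2), quadSeq t t' (quatUnit 3)}) := by
  refine isCopyOf_two (κ := if t = t' then 2 else 1) (quadSeq_add t t') (quadSeq_smul t t')
    (fun r q => sp1Act_quadSeq r t t' q) (quadProbe t t') (by split_ifs <;> simp)
    fun c d hc hd => ?_
  rw [quadProbe_quadSeq]
  simp [hd]

theorem isCopyOf_quadSeq_one : IsCopyOf 0 (Submodule.span ℂ {quadSeq 0 1 1}) := by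
  refine isCopyOf_zero (fun h => ?_) fun r => ?_
  · have h1 := quadProbe_quadSeq 0 1 0 0
    rw [quatUnit_zero, h, map_zero] at h1
    simp at h1
  · have hr : (r : ℍ[ℝ]) * 1 * star (r : ℍ[ℝ]) = 1 := by
      rw [mul_one, Quaternion.self_mul_star, Quaternion.normSq_eq_norm_mul_self]
      simp
    rw [sp1Act_quadSeq, hr]

end Representations

/-! ### Injectivity -/

section Stability

open Module
open scoped RealInnerProductSpace

variable (j : (n : ℕ) → QuatIsometry n (n + 1))

/-- Contraction with a vector in the image of `f` commutes with pull-back along `f`, so a vanishing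
restriction stays zero under such contractions. -/
theorem extComap_ct_list_eq_zero {n m : ℕ} (f : Hn n →ₗ[ℝ] Hn m) (l : List (CoordIdx m))
    (hl : ∀ i ∈ l, ∃ y, f y = unitVec (i.1, i.2.1)) {x : Ext (Hn m × Hn m)}
    (hx : extComap (diagMap f) x = 0) :
    extComap (diagMap f) ((l.map (ct (coBasis m))).prod x) = 0 := by
  induction l with
  | nil => simpa using hx
  | cons i l ih =>
    obtain ⟨y, hy⟩ := hl i (by simp)
    have h1 : diagMap f (pairIncl (Hn n) i.2.2 y) = pairIncl (Hn m) i.2.2 (f y) := by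
      obtain ⟨s, c, t⟩ := i
      fin_cases t
      · exact Prod.ext rfl (map_zero f)
      · exact Prod.ext (map_zero f) rfl
    rw [List.map_cons, List.prod_cons, End.mul_apply, ct_coBasis, ← hy, ← h1, ← contr_extComap,
      ih fun i hi => hl i (List.mem_cons_of_mem _ hi), map_zero]

/-- The value of the form at `v` on `k + l` basis vectors involves `k + l + 1` vectors. All of them
lie in an `Sp(n+1)`-translate of the image of `f`, and by invariance the form also restricts to zero
there. -/
theorem eq_zero_of_restriction_eq_zero {n k l : ℕ} (hn : k + l + 1 ≤ n) (f : QuatIsometry n (n + 1))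
    {τ : HForms (Hn (n + 1))} (hτ : τ ∈ invForms (n + 1) k l)
    (h : hPullback f.toIsometry τ = 0) : τ = 0 := by
  refine eq_zero_of_hFib_eq_zero fun v => ?_
  have hnum := num_one_of_mem_eigBideg (coBasis (n + 1))
    (mem_eigBideg_of_mem_bideg (hFib_mem_bideg v hτ.1))
  refine eq_zero_of_contractions (coBasis (n + 1)) (k + l) (by simpa using hnum) fun L hL => ?_
  -- Positions below `k + l` hold the contraction vectors; position `k + l` is beyond the list and
  -- defaults to the base point `v`.
  obtain ⟨A, hA⟩ := exists_quatIsometry_range f (k + l + 1) hn fun i =>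
    if hi : i < L.length then unitVec ((L[i]).1, (L[i]).2.1) else (v : Hn (n + 1))
  have hv : ∃ y, A.toLin (f.toLin y) = (v : Hn (n + 1)) := by
    obtain ⟨y, _, hy⟩ := hA (k + l) (by omega)
    rw [dif_neg (by omega)] at hy
    exact ⟨y, hy.symm⟩
  obtain ⟨y, hy⟩ := hv
  let g : Hn n →ₗᵢ[ℝ] Hn (n + 1) := A.toIsometry.comp f.toIsometry
  have hg : hPullback g τ = 0 := by
    rw [← hPullback_comp, hPullback_eq_of_mem_invForms hτ, h]
  have hyn : ‖y‖ = 1 := by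
    have h1 : g y = v := hy
    rw [← g.norm_map, h1]
    simp
  let u : Metric.sphere (0 : Hn n) 1 := ⟨y, by simp [hyn]⟩
  have hu : sphereMap g u = v := Subtype.ext hy
  have h2 := hFib_hPullback g u τ
  rw [hg, map_zero, hu] at h2
  have h3 := extComap_ct_list_eq_zero g.toLinearMap L (fun i hi => ?_) h2.symm
  · rw [← scalarPart_extComap (diagMap g.toLinearMap), h3, map_zero]
  · obtain ⟨a, ha, rfl⟩ := List.getElem_of_mem hi
    obtain ⟨z, _, hz⟩ := hA a (by omega)
    rw [dif_pos ha] at hz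
    exact ⟨z, hz.symm⟩

/-- Vanishing propagates upward by injectivity of each single restriction and downward by
compatibility of the sequence. -/
theorem eq_zero_of_limForms {n k l : ℕ} (hn : k + l + 1 ≤ n) {τ : FormSeq}
    (hτ : τ ∈ limForms j k l) (h : τ n = 0) : τ = 0 := by
  have hup : ∀ d, τ (n + d) = 0 := by
    intro d
    induction d with
    | zero => exact h
    | succ d ih =>
      exact eq_zero_of_restriction_eq_zero (by omega) (j (n + d)) (hτ.1 _) ((hτ.2 _).trans ih)
  have hdown : ∀ d m, m + d = n → τ m = 0 := by
    intro d
    induction d with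
    | zero => rintro m rfl; exact h
    | succ d ih =>
      intro m hm
      rw [← hτ.2, ih (m + 1) (by omega), map_zero]
  funext m
  rcases le_total n m with hm | hm
  · obtain ⟨d, rfl⟩ := Nat.exists_eq_add_of_le hm
    exact hup d
  · exact hdown (n - m) m (by omega)

end Stability

/-! ### Surjectivity -/

section Generation

open Module
open scoped RealInnerProductSpace

variable (j : (n : ℕ) → QuatIsometry n (n + 1))

/-- The span of the forms `linSeq t q` for imaginary `q`. -/
def linSpan (t : Fin 2) : Submodule ℂ FormSeq :=
  Submodule.span ℂ {linSeq t (quatUnit 1), linSeq t (quatUnit 2), linSeq t (quatUnit 3)}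

/-- The span of the forms `quadSeq t t' q` for imaginary `q`. -/
def quadSpan (t t' : Fin 2) : Submodule ℂ FormSeq :=
  Submodule.span ℂ
    {quadSeq t t' (quatUnit 1), quadSeq t t' (quatUnit 2), quadSeq t t' (quatUnit 3)}

/-- The algebra generated by the forms `linSeq` and `quadSeq`. -/
def genAlgebra : Subalgebra ℂ FormSeq :=
  Algebra.adjoin ℂ (linSpan 0 ∪ linSpan 1 ∪ quadSpan 0 0 ∪ quadSpan 0 1 ∪ quadSpan 1 1
    ∪ Submodule.span ℂ {quadSeq 0 1 1} : Set FormSeq)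

theorem linSpan_le (t : Fin 2) : linSpan t
    ≤ limForms j ((Pi.single t 1 : Fin 2 → ℕ) 0) ((Pi.single t 1 : Fin 2 → ℕ) 1) := by
  rw [linSpan, Submodule.span_le]
  rintro _ (rfl | rfl | rfl) <;> exact linSeq_mem j t _

theorem quadSpan_le (t t' : Fin 2) : quadSpan t t'
    ≤ limForms j ((Pi.single t 1 + Pi.single t' 1 : Fin 2 → ℕ) 0)
      ((Pi.single t 1 + Pi.single t' 1 : Fin 2 → ℕ) 1) := by
  rw [quadSpan, Submodule.span_le]
  rintro _ (rfl | rfl | rfl) <;> exact quadSeq_mem j t t' _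

theorem linSeq_mem_genAlgebra (t : Fin 2) (c : Fin 4) : linSeq t (quatUnit c) ∈ genAlgebra := by
  by_cases hc : c = 0
  · rw [hc, quatUnit_zero, linSeq_one]
    exact zero_mem _
  · have h : linSeq t (quatUnit c) ∈ linSpan t := by
      refine Submodule.subset_span ?_
      fin_cases c <;> simp at hc ⊢
    refine Algebra.subset_adjoin ?_
    fin_cases t <;> simp only [Set.mem_union, SetLike.mem_coe] <;> tauto

theorem quadSeq_mem_genAlgebra (t t' : Fin 2) (c : Fin 4) :
    quadSeq t t' (quatUnit c) ∈ genAlgebra := by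
  have h01 : ∀ c, quadSeq 0 1 (quatUnit c) ∈ genAlgebra := by
    intro c
    refine Algebra.subset_adjoin ?_
    by_cases hc : c = 0
    · rw [hc, quatUnit_zero]
      exact Or.inr (Submodule.mem_span_singleton_self _)
    · have h : quadSeq 0 1 (quatUnit c) ∈ quadSpan 0 1 := by
        refine Submodule.subset_span ?_
        fin_cases c <;> simp at hc ⊢
      simp only [Set.mem_union, SetLike.mem_coe]
      tauto
  have htt : ∀ t c, quadSeq t t (quatUnit c) ∈ genAlgebra := by
    intro t c
    by_cases hc : c = 0
    · rw [hc, quatUnit_zero, quadSeq_self_one]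
      exact zero_mem _
    · have h : quadSeq t t (quatUnit c) ∈ quadSpan t t := by
        refine Submodule.subset_span ?_
        fin_cases c <;> simp at hc ⊢
      refine Algebra.subset_adjoin ?_
      fin_cases t <;> simp only [Set.mem_union, SetLike.mem_coe] <;> tauto
  have h10 : ∀ c, quadSeq 1 0 (quatUnit c) ∈ genAlgebra := by
    intro c
    rw [quadSeq_swap]
    refine neg_mem ?_
    by_cases hc : c = 0
    · rw [hc, quatUnit_zero, star_one]
      exact h01 0
    · have h : quadSeq 0 1 (-quatUnit c) = ((-1 : ℝ) : ℂ) • quadSeq 0 1 (quatUnit c) := by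
        rw [← quadSeq_smul, neg_one_smul]
      rw [star_quatUnit hc, h]
      exact Subalgebra.smul_mem _ (h01 c) _
  fin_cases t <;> fin_cases t'
  · exact htt 0 c
  · exact h01 c
  · exact h10 c
  · exact htt 1 c

open scoped Classical in
/-- `limForms` with integral degrees. -/
def limFormsInt (d : Fin 2 → ℤ) : Submodule ℂ FormSeq :=
  if 0 ≤ d then limForms j (d 0).toNat (d 1).toNat else ⊥

theorem mul_mem_limFormsInt {m : Fin 2 → ℕ} {d : Fin 2 → ℤ} {a b : FormSeq}
    (ha : a ∈ limForms j (m 0) (m 1)) (hb : b ∈ limFormsInt j d) :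
    a * b ∈ limFormsInt j (d + fun t => (m t : ℤ)) := by
  by_cases hd : 0 ≤ d
  · rw [limFormsInt, if_pos hd] at hb
    have hd0 : 0 ≤ d 0 := hd 0
    have hd1 : 0 ≤ d 1 := hd 1
    have hd' : 0 ≤ d + fun t => (m t : ℤ) := add_nonneg hd fun t => Int.natCast_nonneg _
    have h := SetLike.GradedMul.mul_mem (A := fun d : ℕ × ℕ => limForms j d.1 d.2)
      (i := (m 0, m 1)) (j := ((d 0).toNat, (d 1).toNat)) ha hb
    have e0 : ((d + fun t => (m t : ℤ)) 0).toNat = m 0 + (d 0).toNat := by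
      change (d 0 + (m 0 : ℤ)).toNat = _
      omega
    have e1 : ((d + fun t => (m t : ℤ)) 1).toNat = m 1 + (d 1).toNat := by
      change (d 1 + (m 1 : ℤ)).toNat = _
      omega
    rw [limFormsInt, if_pos hd', e0, e1]
    exact h
  · rw [limFormsInt, if_neg hd, Submodule.mem_bot] at hb
    rw [hb, mul_zero]
    exact zero_mem _

theorem sum_thetaAt_apply {n : ℕ} (t t' : Fin 2) (q : Fin 4) (x : Ext (Hn n × Hn n)) :
    (∑ s, thetaAt (coBasis n) q t t' s) x = quadAmb n t t' (quatUnit q) * x := by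
  have h1 : ∀ (s : Fin n) (c : Fin 4) (t : Fin 2) (y : Ext (Hn n × Hn n)),
      wd (coBasis n) (s, c, t) y = oneForm t (unitVec (s, c)) * y := by
    intro s c t y
    rw [wd, wedge_apply, coBasis_apply]
    rfl
  rw [quadAmb, Finset.sum_mul, LinearMap.sum_apply, Fintype.sum_prod_type]
  refine Finset.sum_congr rfl fun s _ => ?_
  rw [thetaAt, LinearMap.sum_apply]
  refine Finset.sum_congr rfl fun c _ => ?_
  have h2 : opLin (quatUnit q) (unitVec (s, c) : Hn n)
      = ∑ d, (quatCoef c d q : ℝ) • unitVec (s, d) := op_smul_unitVec (s, c) q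
  rw [LinearMap.sum_apply, h2, oneForm_sum, Finset.mul_sum, Finset.sum_mul]
  refine Finset.sum_congr rfl fun d _ => ?_
  rw [LinearMap.smul_apply, End.mul_apply, h1, h1, oneForm_smul, mul_smul_comm, smul_mul_assoc,
    mul_assoc]
  push_cast
  rfl

/-- The forms that agree at the point `e_{i₀}` with a form in the algebra `genAlgebra`. -/
def genAt {n : ℕ} (i₀ : Fin n) (d : Fin 2 → ℤ) : Submodule ℂ (Ext (Hn n × Hn n)) :=
  ((Subalgebra.toSubmodule genAlgebra ⊓ limFormsInt j d).map
    ((hFib (sphereVec i₀)).toLinearMap ∘ₗ LinearMap.proj n)).comap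
      (extComap (perpSq (sphereVec i₀ : Hn n))).toLinearMap

theorem mul_mem_genAt {n : ℕ} {i₀ : Fin n} {m : Fin 2 → ℕ} {d : Fin 2 → ℤ} {g : FormSeq}
    {y x : Ext (Hn n × Hn n)} (hg : g ∈ genAlgebra) (hg' : g ∈ limForms j (m 0) (m 1))
    (hy : hFib (sphereVec i₀) (g n) = extComap (perpSq (sphereVec i₀ : Hn n)) y)
    (hx : x ∈ genAt j i₀ d) : y * x ∈ genAt j i₀ (d + fun t => (m t : ℤ)) := by
  obtain ⟨a, ⟨ha, ha'⟩, hax⟩ := hx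
  refine ⟨g * a, ⟨Subalgebra.mul_mem _ hg ha, mul_mem_limFormsInt j hg' ha'⟩, ?_⟩
  change hFib (sphereVec i₀) (g n * a n) = extComap _ (y * x)
  rw [map_mul, map_mul, hy]
  exact congrArg _ hax

/-- At the base point `e_{i₀}` the generator `linSeq t e_c` is the restriction of the coordinate
one-form of `e_{i₀} e_c`. For `c = 0` both are zero on the contact hyperplane. -/
theorem wd_mem_genAt {n : ℕ} {i₀ : Fin n} {d : Fin 2 → ℤ} {x : Ext (Hn n × Hn n)}
    (hx : x ∈ genAt j i₀ d) (c : Fin 4) (t : Fin 2) :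
    wd (coBasis n) (i₀, c, t) x ∈ genAt j i₀ (d + Pi.single t 1) := by
  have h := mul_mem_genAt j (y := oneForm t (unitVec (i₀, c))) (linSeq_mem_genAlgebra t c)
    (linSeq_mem j t (quatUnit c)) ?_ hx
  · have e : (fun s => ((Pi.single t 1 : Fin 2 → ℕ) s : ℤ)) = Pi.single t 1 := by
      funext s; fin_cases t <;> fin_cases s <;> rfl
    rw [e] at h
    rw [wd, wedge_apply, coBasis_apply]
    exact h
  · rw [linSeq, hFib_linForm]
    exact congrArg (fun y => extComap _ (oneForm t y)) (opLin_unitVec_zero i₀ c)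

/-- The stabilizer only sees the coordinates different from `i₀`, while `quadSeq` sums over all of
them. The missing summand is a combination of products of two one-forms at `i₀`, which are available
by `wd_mem_genAt`. -/
theorem sum_thetaAt_mem_genAt {n : ℕ} {i₀ : Fin n} {d : Fin 2 → ℤ} {x : Ext (Hn n × Hn n)}
    (hx : x ∈ genAt j i₀ d) (q : Fin 4) (t t' : Fin 2) :
    (∑ s ∈ Finset.univ.erase i₀, thetaAt (coBasis n) q t t' s) x
      ∈ genAt j i₀ (d + Pi.single t 1 + Pi.single t' 1) := by
  have h1 : (∑ s ∈ Finset.univ.erase i₀, thetaAt (coBasis n) q t t' s) x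
      = quadAmb n t t' (quatUnit q) * x - thetaAt (coBasis n) q t t' i₀ x := by
    rw [← sum_thetaAt_apply, ← Finset.sum_erase_add _ _ (Finset.mem_univ i₀), LinearMap.add_apply,
      add_sub_cancel_right]
  rw [h1]
  refine sub_mem ?_ ?_
  · have h := mul_mem_genAt j (y := quadAmb n t t' (quatUnit q)) (quadSeq_mem_genAlgebra t t' q)
      (quadSeq_mem j t t' (quatUnit q)) (hFib_quadForm _ _ _ _) hx
    have e : (fun s => ((Pi.single t 1 + Pi.single t' 1 : Fin 2 → ℕ) s : ℤ))
        = Pi.single t 1 + Pi.single t' 1 := by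
      funext s; fin_cases t <;> fin_cases t' <;> fin_cases s <;> rfl
    rwa [e, ← add_assoc] at h
  · rw [thetaAt, LinearMap.sum_apply]
    refine Submodule.sum_mem _ fun c _ => ?_
    rw [LinearMap.sum_apply]
    refine Submodule.sum_mem _ fun c' _ => Submodule.smul_mem _ _ ?_
    have h := wd_mem_genAt j (wd_mem_genAt j hx c' t') c t
    rwa [add_right_comm] at h

/-- Surjectivity and generation at once: the first fundamental theorem, applied to the stabilizer of
`e_{i₀}` and the family `genAt`, produces a polynomial in the generators that agrees with `τ` at one
point of the sphere, and invariance spreads the agreement to all points. -/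
theorem exists_genAlgebra {n k l : ℕ} (hn : 1 ≤ n) {τ : HForms (Hn n)} (hτ : τ ∈ invForms n k l) :
    ∃ a ∈ genAlgebra, a ∈ limForms j k l ∧ a n = τ := by
  let i₀ : Fin n := ⟨0, hn⟩
  have hinv : ∀ A : QuatIsometry n n, A.toLin (unitVec (i₀, 0)) = unitVec (i₀, 0) →
      extComap (diagMap A.toIsometry.toLinearMap) (hFib (sphereVec i₀) τ)
        = hFib (sphereVec i₀) τ := by
    intro A hA
    have h := hFib_hPullback A.toIsometry (sphereVec i₀) τ
    have h2 : sphereMap A.toIsometry (sphereVec i₀) = sphereVec i₀ := Subtype.ext hA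
    rw [hPullback_eq_of_mem_invForms hτ, h2] at h
    exact h.symm
  have hmem := lieInv_mem (coBasis n) (S := Finset.univ.erase i₀) (genAt j i₀)
    ⟨1, ⟨Subalgebra.one_mem genAlgebra, by
      rw [limFormsInt, if_pos le_rfl]
      exact SetLike.GradedOne.one_mem (A := fun d : ℕ × ℕ => limForms j d.1 d.2)⟩, by
      change hFib (sphereVec i₀) 1 = extComap _ 1
      rw [map_one, map_one]⟩
    (fun d s hs c t x hx => by
      have hs' : s = i₀ := by simpa using hs
      rw [hs']
      exact wd_mem_genAt j hx c t)
    (fun d q t t' x hx => sum_thetaAt_mem_genAt j hx q t t') _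
    (mem_lieInv_of_invariant hinv) (mem_eigBideg_of_mem_bideg (hFib_mem_bideg _ hτ.1))
  obtain ⟨a, ⟨ha, ha'⟩, hax⟩ := hmem
  have hkl : (0 : Fin 2 → ℤ) ≤ ![(k : ℤ), (l : ℤ)] := by
    intro t; fin_cases t <;> simp
  rw [limFormsInt, if_pos hkl] at ha'
  replace ha' : a ∈ limForms j k l := ha'
  refine ⟨a, ha, ha', (sub_eq_zero.mp (eq_zero_of_hFib_eq_zero fun v => ?_)).symm⟩
  have hx : hFib (sphereVec i₀) (τ - a n) = 0 := by
    rw [map_sub, sub_eq_zero, ← extComap_perpSq_hFib]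
    exact hax.symm
  have hδ : τ - a n ∈ invForms n k l := sub_mem hτ (ha'.1 n)
  have hq : qForm (v : Hn n) v = qForm ((sphereVec i₀ : Metric.sphere (0 : Hn n) 1) : Hn n)
      (sphereVec i₀) := by
    rw [qForm_self, qForm_self]
    simp
  -- Transitivity of `Sp(n)` on the unit sphere: the fibre of the invariant form `τ - a n` at `v` is
  -- the pull-back of its fibre at `e_{i₀}`, which is zero.
  obtain ⟨A, hA, _⟩ := exists_quatIsometry_apply_eq hq
  have h := hFib_hPullback A.toIsometry v (τ - a n)
  have h2 : sphereMap A.toIsometry v = sphereVec i₀ := Subtype.ext hA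
  rw [hPullback_eq_of_mem_invForms hδ, h2, hx, map_zero] at h
  exact h

/-- At level `k + l + 1` restriction is injective, so an element of the limit coincides with the
polynomial in the generators that lifts its component there. -/
theorem limForms_le_genAlgebra (k l : ℕ) : limForms j k l ≤ Subalgebra.toSubmodule genAlgebra := by
  intro τ hτ
  obtain ⟨a, ha, ha', h⟩ := exists_genAlgebra j (n := k + l + 1) (by omega) (hτ.1 _)
  have h2 := eq_zero_of_limForms j le_rfl (sub_mem hτ ha') (by rw [Pi.sub_apply, h, sub_self])
  rw [sub_eq_zero.mp h2]
  exact ha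

theorem genAlgebra_eq_limAlgebra : genAlgebra = limAlgebra j := by
  apply le_antisymm
  · have hle : ∀ k l, ∀ τ ∈ limForms j k l, τ ∈ limAlgebra j := fun k l τ hτ =>
      (le_iSup (fun d : ℕ × ℕ => limForms j d.1 d.2) (k, l)) hτ
    refine Algebra.adjoin_le ?_
    rintro τ (((((h | h) | h) | h) | h) | h)
    · exact hle _ _ _ (linSpan_le j 0 h)
    · exact hle _ _ _ (linSpan_le j 1 h)
    · exact hle _ _ _ (quadSpan_le j 0 0 h)
    · exact hle _ _ _ (quadSpan_le j 0 1 h)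
    · exact hle _ _ _ (quadSpan_le j 1 1 h)
    · exact hle _ _ _ ((Submodule.span_singleton_le_iff_mem _ _).mpr (quadSeq_mem j 0 1 1) h)
  · have h : (⨆ d : ℕ × ℕ, limForms j d.1 d.2) ≤ Subalgebra.toSubmodule genAlgebra :=
      iSup_le fun d => limForms_le_genAlgebra j d.1 d.2
    exact fun τ hτ => h hτ

end Generation

end SphereForms

end

/-! ### The main theorem -/

theorem mainTheorem8 (j : (n : ℕ) → SphereForms.QuatIsometry n (n + 1)) :
    (∃ S₁₀ S₀₁ S₂₀ S₁₁ S₀₂ T₁₁ : Submodule ℂ SphereForms.FormSeq,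
      (S₁₀ ≤ SphereForms.limForms j 1 0 ∧ SphereForms.IsCopyOf 2 S₁₀) ∧
      (S₀₁ ≤ SphereForms.limForms j 0 1 ∧ SphereForms.IsCopyOf 2 S₀₁) ∧
      (S₂₀ ≤ SphereForms.limForms j 2 0 ∧ SphereForms.IsCopyOf 2 S₂₀) ∧
      (S₁₁ ≤ SphereForms.limForms j 1 1 ∧ SphereForms.IsCopyOf 2 S₁₁) ∧
      (S₀₂ ≤ SphereForms.limForms j 0 2 ∧ SphereForms.IsCopyOf 2 S₀₂) ∧
      (T₁₁ ≤ SphereForms.limForms j 1 1 ∧ SphereForms.IsCopyOf 0 T₁₁) ∧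
      Algebra.adjoin ℂ ((S₁₀ ∪ S₀₁ ∪ S₂₀ ∪ S₁₁ ∪ S₀₂ ∪ T₁₁ : Set SphereForms.FormSeq))
        = SphereForms.limAlgebra j) ∧
    (∀ k l n : ℕ, 1 ≤ n → Function.Surjective (SphereForms.restrictionMap j k l n)) ∧
    (∀ k l n : ℕ, 1 ≤ n → k + l ≤ n - 1 →
      Function.Injective (SphereForms.restrictionMap j k l n)) := by
  refine ⟨⟨SphereForms.linSpan 0, SphereForms.linSpan 1, SphereForms.quadSpan 0 0,
    SphereForms.quadSpan 0 1, SphereForms.quadSpan 1 1,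
    Submodule.span ℂ {SphereForms.quadSeq 0 1 1},
    ⟨SphereForms.linSpan_le j 0, SphereForms.isCopyOf_linSeq 0⟩,
    ⟨SphereForms.linSpan_le j 1, SphereForms.isCopyOf_linSeq 1⟩,
    ⟨SphereForms.quadSpan_le j 0 0, SphereForms.isCopyOf_quadSeq 0 0⟩,
    ⟨SphereForms.quadSpan_le j 0 1, SphereForms.isCopyOf_quadSeq 0 1⟩,
    ⟨SphereForms.quadSpan_le j 1 1, SphereForms.isCopyOf_quadSeq 1 1⟩,
    ⟨(Submodule.span_singleton_le_iff_mem _ _).mpr (SphereForms.quadSeq_mem j 0 1 1),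
      SphereForms.isCopyOf_quadSeq_one⟩,
    SphereForms.genAlgebra_eq_limAlgebra j⟩, ?_, ?_⟩
  · intro k l n hn τ
    obtain ⟨a, _, ha, h⟩ := SphereForms.exists_genAlgebra j hn τ.2
    exact ⟨⟨a, ha⟩, Subtype.ext h⟩
  · intro k l n hn hkl
    refine (injective_iff_map_eq_zero _).mpr fun τ hτ => Subtype.ext ?_
    exact SphereForms.eq_zero_of_limForms j (by omega) τ.2 (congrArg Subtype.val hτ)
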